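/- **Setting.** Let $n\in\mathbb N$ and let $f_1,f_2:\mathbb{R}^n\times\mathbb{R}_{\ge 0}\to\mathbb{R}^n$. For $\varepsilon>0$ put $f_\varepsilon=\varepsilon^{-1}f_1+f_2$ and consider $$\dot x=f_\varepsilon(x,\tau),\qquad \dot\tau=\varepsilon^{-2}.\tag{1}$$ A class $\mathcal K$ function is a continuous strictly increasing $\alpha:\mathbb{R}_{\ge0}\to\mathbb{R}_{\ge0}$ with $\alpha(0)=0$; it is of class $\mathcal K_\infty$ if moreover $\alpha(r)\to\infty$ as $r\to\infty$. A class $\mathcal{KL}$ function is a continuous $\beta:\mathbb{R}_{\ge0}^2\to\mathbb{R}_{\ge0}$ with $\beta(\cdot,s)\in\mathcal K_\infty$ for every $s\ge0$, with $\beta(r,\cdot)$ strictly decreasing for every $r>0$, and with $\lim_{s\to\infty}\beta(r,s)=0$ for every $r\geq 0$. A function $\phi:\mathbb{R}^n\to\mathbb{R}_{\ge0}$ is called positive definite if $\phi(0)=0$ and there is $\alpha\in\mathcal K$ with $\alpha(|x|)\le\phi(x)$ for all $x\in\mathbb{R}^n$. **Assumption 1 (with $\delta_1\ge0$ and $T>0$).**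 For $k\in\{1,2\}$: (a) $f_k$ is continuous and there is $L_k>0$ with $|f_k(x_1,\tau)-f_k(x_2,\tau)|\le L_k|x_1-x_2|$ whenever $|x_1|,|x_2|\ge\delta_1$, $\tau\ge0$; (b) $f_k(x,\tau+T)=f_k(x,\tau)$ and $\int_0^Tf_1(x,\tau)\,d\tau=0$ for all $(x,\tau)$; (c) for each $\tau\ge0$, $f_k(\cdot,\tau)$ is $C^{3-k}$ on an open neighbourhood of $\{|x|\ge\delta_1\}$; (d) there is $L_3>0$ with $|D_xf_1(x_1,\tau_1)f_1(x_1,\tau_2)-D_xf_1(x_2,\tau_1)f_1(x_2,\tau_2)|\le L_3|x_1-x_2|$ whenever $|x_1|,|x_2|\ge\delta_1$, $\tau_1,\tau_2\ge0$. **Constructions.** Call $(\delta_2,\delta_3)$ *admissible* (for $\delta_1$, with margin $\epsilon>0$) if $\delta_2\ge(1+\epsilon)\delta_1$ and $\delta_3>(1+\epsilon)\delta_2$. Let $\chi_1(r)=e^{-1/r}$ for $r>0$, $\chi_1(r)=0$ for $r\le0$, $\chi_2(r)=\chi_1(r)/(\chi_1(r)+\chi_1(1-r))$; let $\varphi(x)=\chi_2\big((|x|-\delta_1)/(\delta_2-\delta_1)\big)$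 if $\delta_2>\delta_1$, and $\varphi\equiv1$ if $\delta_2=\delta_1=0$. Put $\hat f_k=\varphi f_k$, $v_1(x,\tau)=\int_0^\tau\hat f_1(x,s)\,ds$, $$\bar f(x)=\frac1{2T}\int_0^T\big(2\hat f_2+D_x\hat f_1\,v_1-D_xv_1\,\hat f_1\big)(x,\tau)\,d\tau,$$ $$v_2(x,\tau)=\int_0^\tau\big(\hat f_2(x,s)+D_x\hat f_1(x,s)v_1(x,s)-\bar f(x)\big)ds-D_xv_1(x,\tau)v_1(x,\tau),$$ $$\Phi_\varepsilon=x-\varepsilon v_1-\varepsilon^2v_2,\qquad \Psi_\varepsilon(x,\tau)=(\Phi_\varepsilon(x,\tau),\tau),$$ and, when $\Psi_\varepsilon$ is a bijection of $\mathbb{R}^n\times\mathbb{R}_{\ge0}$, $\Psi_*f_\varepsilon=\big(D_x\Phi_\varepsilon\, f_\varepsilon+\varepsilon^{-2}D_\tau\Phi_\varepsilon\big)\circ\Psi_\varepsilon^{-1}$. All these objects depend on $(\delta_1,\delta_2)$. Let $g(x,\tau,\varepsilon)=\varepsilon^{-1}\big(\Psi_*f_\varepsilon(x,\tau)-\bar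 f(x)\big)$ and $\mathcal M_3=\{x\in\mathbb{R}^n:|x|\ge\delta_3\}$. **Assumption 2.** For some $\epsilon>0$ and some $(\delta_2,\delta_3)$ admissible for the $\delta_1$ of Assumption 1, there are a $C^1$ function $V:\mathbb{R}^n\to\mathbb{R}_{\ge0}$, $\alpha_1,\alpha_2\in\mathcal K_\infty$, $c_1,c_2>0$ and a positive definite $\phi$ such that: (a) $\alpha_1(|x|)\le V(x)\le\alpha_2(|x|)$ and $|\nabla V(x)|\le c_2\phi(x)$ for all $x\in\mathbb{R}^n$; (b) $\langle\nabla V(x),\bar f(x)\rangle\le-c_1\phi(x)^2$ for all $x\in\mathcal M_3$; (c) either (i) there are $\bar L_g,\varepsilon_0>0$ with $|g(x,\tau,\varepsilon)|\le\bar L_g(\phi(x)+1)$ for all $(x,\tau,\varepsilon)\in\mathcal M_3\times\mathbb{R}_{\ge0}\times(0,\varepsilon_0]$, or (ii) there is $\alpha_3\in\mathcal K$ with $\alpha_3(|x|)|x|\le\phi(x)$ for all $x\in\mathbb{R}^n$. **Theorem 1.** Suppose Assumptions 1 and 2 hold. Then for every $\epsilon>0$ and every $(\delta_2,\delta_3)$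 admissible for $\delta_1$ with margin $\epsilon$ (not necessarily those of Assumption 2), the map $\Psi_\varepsilon$ is a $C^1$ diffeomorphism of $\mathbb{R}^n\times\mathbb{R}_{\ge0}$ for all sufficiently small $\varepsilon>0$, and there is $\Delta>0$ such that the origin is $\Delta$-uniformly globally ultimately bounded for the transformed system $$\dot x=\Psi_*f_\varepsilon(x,\tau),\qquad\dot\tau=\varepsilon^{-2}.$$ That is: there are $\beta\in\mathcal{KL}$ and $\varepsilon^*>0$ such that, for all $\varepsilon\in(0,\varepsilon^*)$ and all $(x_0,\tau_0)\in\mathbb{R}^n\times\mathbb{R}_{\ge0}$, every $C^1$ solution $(x,\tau)$ on an interval $[0,t_s)$, $0<t_s\le\infty$, starting at $(x_0,\tau_0)$ satisfies $$|x(t)|\le\beta(|x_0|,t)+\Delta\qquad\text{for all }t\in[0,t_s),$$ and every maximal solution is complete ($t_s=\infty$). -/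

import Mathlib

open Set Filter Topology

noncomputable section

namespace SecondOrderAveraging

/-- `ℝⁿ` with the Euclidean norm. -/
abbrev Vec (n : ℕ) : Type := EuclideanSpace ℝ (Fin n)

/-- The space `ℝⁿ × ℝ≥0` of pairs `(x, τ)`, as a subset of `ℝⁿ × ℝ`. Maps on `ℝⁿ × ℝ≥0` are
represented by maps on `ℝⁿ × ℝ`, of which only the values at `τ ≥ 0` are ever used. -/
def halfSpace (n : ℕ) : Set (Vec n × ℝ) := univ ×ˢ Ici (0 : ℝ)

/-! ### Comparison functions -/

/-- Class `K`: continuous and strictly increasing on `[0, ∞)`, zero at zero. -/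
structure IsClassK (α : ℝ → ℝ) : Prop where
  continuousOn : ContinuousOn α (Ici 0)
  strictMonoOn : StrictMonoOn α (Ici 0)
  map_zero : α 0 = 0

/-- Class `K∞`: class `K` and unbounded. -/
structure IsClassKInfty (α : ℝ → ℝ) : Prop extends IsClassK α where
  tendsto_atTop : Tendsto α atTop atTop

/-- Class `KL`: jointly continuous, of class `K∞` in the first argument, and in the second argument
strictly decreasing (for `r > 0`; at `r = 0` the function vanishes) with limit zero. -/
structure IsClassKL (β : ℝ → ℝ → ℝ) : Prop where
  continuousOn : ContinuousOn (fun p : ℝ × ℝ => β p.1 p.2) (Ici 0 ×ˢ Ici 0)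
  kInfty : ∀ s, 0 ≤ s → IsClassKInfty (fun r => β r s)
  strictAntiOn : ∀ r, 0 < r → StrictAntiOn (β r) (Ici 0)
  tendsto_zero : ∀ r, 0 ≤ r → Tendsto (β r) atTop (𝓝 0)

/-- Positive definite functions on `ℝⁿ`: zero at the origin and bounded from below, on all of `ℝⁿ`,
by a class `K` function of the norm. In particular they are positive off the origin. -/
structure IsPositiveDefinite {n : ℕ} (φ : Vec n → ℝ) : Prop where
  map_zero : φ 0 = 0
  lower : ∃ α : ℝ → ℝ, IsClassK α ∧ ∀ x, α ‖x‖ ≤ φ x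

/-! ### Solutions, pushforward, ultimate boundedness -/

/-- The interval `[0, ts)`, where `ts` may be `∞`. -/
def solDom (ts : EReal) : Set ℝ := {t | 0 ≤ t ∧ (t : EReal) < ts}

/-- `(x, τ)`, with domain `[0, ts)`, is a solution of `x' = F(x, τ)`, `τ' = ε⁻²` in `ℝⁿ × ℝ≥0`
from the initial condition `(x₀, τ₀)`. -/
structure IsSolution {n : ℕ} (F : Vec n → ℝ → Vec n) (ε : ℝ) (x₀ : Vec n) (τ₀ : ℝ)
    (ts : EReal) (x : ℝ → Vec n) (τ : ℝ → ℝ) : Prop where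
  pos : 0 < ts
  init_x : x 0 = x₀
  init_τ : τ 0 = τ₀
  nonneg : ∀ t ∈ solDom ts, 0 ≤ τ t
  contDiffOn_x : ContDiffOn ℝ 1 x (solDom ts)
  contDiffOn_τ : ContDiffOn ℝ 1 τ (solDom ts)
  deriv_x : ∀ t ∈ solDom ts, HasDerivWithinAt x (F (x t) (τ t)) (solDom ts) t
  deriv_τ : ∀ t ∈ solDom ts, HasDerivWithinAt τ ((ε ^ 2)⁻¹) (solDom ts) t

/-- A solution that is not the restriction of a solution with a larger domain. -/
def IsMaximalSolution {n : ℕ} (F : Vec n → ℝ → Vec n) (ε : ℝ) (x₀ : Vec n) (τ₀ : ℝ)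
    (ts : EReal) (x : ℝ → Vec n) (τ : ℝ → ℝ) : Prop :=
  IsSolution F ε x₀ τ₀ ts x τ ∧
    ¬ ∃ (ts' : EReal) (x' : ℝ → Vec n) (τ' : ℝ → ℝ), ts < ts' ∧
      IsSolution F ε x₀ τ₀ ts' x' τ' ∧ EqOn x' x (solDom ts) ∧ EqOn τ' τ (solDom ts)

/-- The origin is `Δ`-uniformly globally ultimately bounded for the family of systems
`x' = F ε (x, τ)`, `τ' = ε⁻²`: one `KL` function serves all small `ε`, all initial conditions and
all solutions, and the solutions (once maximally extended) are complete. -/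
def IsUGUB {n : ℕ} (Δ : ℝ) (F : ℝ → Vec n → ℝ → Vec n) : Prop :=
  ∃ (β : ℝ → ℝ → ℝ) (εs : ℝ), IsClassKL β ∧ 0 < εs ∧
    ∀ ε ∈ Ioo 0 εs, ∀ (x₀ : Vec n) (τ₀ : ℝ), 0 ≤ τ₀ →
      ∀ (ts : EReal) (x : ℝ → Vec n) (τ : ℝ → ℝ),
        (IsSolution (F ε) ε x₀ τ₀ ts x τ → ∀ t ∈ solDom ts, ‖x t‖ ≤ β ‖x₀‖ t + Δ) ∧
        (IsMaximalSolution (F ε) ε x₀ τ₀ ts x τ → ts = ⊤)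

/-- The inverse of a map of `ℝⁿ × ℝ≥0` to itself. -/
def halfInv {n : ℕ} (Ψ : Vec n × ℝ → Vec n × ℝ) : Vec n × ℝ → Vec n × ℝ :=
  Function.invFunOn Ψ (halfSpace n)

/-- `Ψ` is a `C¹` diffeomorphism of `ℝⁿ × ℝ≥0` onto itself. -/
def IsC1Diffeo {n : ℕ} (Ψ : Vec n × ℝ → Vec n × ℝ) : Prop :=
  BijOn Ψ (halfSpace n) (halfSpace n) ∧ ContDiffOn ℝ 1 Ψ (halfSpace n) ∧
    ContDiffOn ℝ 1 (halfInv Ψ) (halfSpace n)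

/-- The pushforward `Ψ_* F` of the system `x' = F(x, τ)`, `τ' = ε⁻²`:
`(D_x(π₁ ∘ Ψ) F + ε⁻² D_τ(π₁ ∘ Ψ)) ∘ Ψ⁻¹`. -/
def pushforward {n : ℕ} (Ψ : Vec n × ℝ → Vec n × ℝ) (F : Vec n → ℝ → Vec n) (ε : ℝ)
    (x : Vec n) (τ : ℝ) : Vec n :=
  let p := halfInv Ψ (x, τ)
  fderiv ℝ (fun y => (Ψ (y, p.2)).1) p.1 (F p.1 p.2) +
    (ε ^ 2)⁻¹ • derivWithin (fun s => (Ψ (p.1, s)).1) (Ici 0) p.2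

/-! ### The near-identity transformation and the second-order average -/

/-- The vector field `f_ε = ε⁻¹ f₁ + f₂`. -/
def oscField {n : ℕ} (f₁ f₂ : Vec n → ℝ → Vec n) (ε : ℝ) (x : Vec n) (τ : ℝ) : Vec n :=
  ε⁻¹ • f₁ x τ + f₂ x τ

/-- The reverse bump function; `Real.smoothTransition r` is `χ(r) / (χ(r) + χ(1 - r))` with
`χ(r) = exp(-1/r)` for `r > 0` and `χ(r) = 0` for `r ≤ 0`. -/
def bump {n : ℕ} (δ₁ δ₂ : ℝ) (x : Vec n) : ℝ :=
  if δ₁ < δ₂ then Real.smoothTransition ((‖x‖ - δ₁) / (δ₂ - δ₁)) else 1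

/-- `f̂ = bump · f`. -/
def fHat {n : ℕ} (δ₁ δ₂ : ℝ) (f : Vec n → ℝ → Vec n) (x : Vec n) (τ : ℝ) : Vec n :=
  bump δ₁ δ₂ x • f x τ

/-- `v₁(x, τ) = ∫₀^τ f̂₁(x, s) ds`. -/
def v1 {n : ℕ} (δ₁ δ₂ : ℝ) (f₁ : Vec n → ℝ → Vec n) (x : Vec n) (τ : ℝ) : Vec n :=
  ∫ s in (0 : ℝ)..τ, fHat δ₁ δ₂ f₁ x s

/-- The second-order average `f̄(x) = (2T)⁻¹ ∫₀^T (2 f̂₂ + [v₁, f̂₁])(x, τ) dτ`, where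
`[v, w] = (D w) v - (D v) w`. -/
def fBar {n : ℕ} (δ₁ δ₂ T : ℝ) (f₁ f₂ : Vec n → ℝ → Vec n) (x : Vec n) : Vec n :=
  (2 * T)⁻¹ • ∫ τ in (0 : ℝ)..T, ((2 : ℝ) • fHat δ₁ δ₂ f₂ x τ +
    VectorField.lieBracket ℝ (fun y => v1 δ₁ δ₂ f₁ y τ) (fun y => fHat δ₁ δ₂ f₁ y τ) x)

/-- `w(x, τ) = ∫₀^τ (f̂₂(x, s) + D_x f̂₁(x, s) v₁(x, s) - f̄(x)) ds`. -/
def wFun {n : ℕ} (δ₁ δ₂ T : ℝ) (f₁ f₂ : Vec n → ℝ → Vec n) (x : Vec n) (τ : ℝ) : Vec n :=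
  ∫ s in (0 : ℝ)..τ, (fHat δ₁ δ₂ f₂ x s +
    fderiv ℝ (fun y => fHat δ₁ δ₂ f₁ y s) x (v1 δ₁ δ₂ f₁ x s) - fBar δ₁ δ₂ T f₁ f₂ x)

/-- `v₂ = w - (D_x v₁) v₁`. -/
def v2 {n : ℕ} (δ₁ δ₂ T : ℝ) (f₁ f₂ : Vec n → ℝ → Vec n) (x : Vec n) (τ : ℝ) : Vec n :=
  wFun δ₁ δ₂ T f₁ f₂ x τ - fderiv ℝ (fun y => v1 δ₁ δ₂ f₁ y τ) x (v1 δ₁ δ₂ f₁ x τ)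

/-- The near-identity transformation `Ψ(x, τ) = (x - ε v₁(x, τ) - ε² v₂(x, τ), τ)`. -/
def nearId {n : ℕ} (δ₁ δ₂ T : ℝ) (f₁ f₂ : Vec n → ℝ → Vec n) (ε : ℝ) (p : Vec n × ℝ) :
    Vec n × ℝ :=
  (p.1 - ε • v1 δ₁ δ₂ f₁ p.1 p.2 - ε ^ 2 • v2 δ₁ δ₂ T f₁ f₂ p.1 p.2, p.2)

/-- The transformed vector field `Ψ_* f_ε`. -/
def transformed {n : ℕ} (δ₁ δ₂ T : ℝ) (f₁ f₂ : Vec n → ℝ → Vec n) (ε : ℝ) :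
    Vec n → ℝ → Vec n :=
  pushforward (nearId δ₁ δ₂ T f₁ f₂ ε) (oscField f₁ f₂ ε) ε

/-- The perturbation `g` in `Ψ_* f_ε = f̄ + ε g` (for `ε > 0`). -/
def gFun {n : ℕ} (δ₁ δ₂ T : ℝ) (f₁ f₂ : Vec n → ℝ → Vec n) (x : Vec n) (τ ε : ℝ) : Vec n :=
  ε⁻¹ • (transformed δ₁ δ₂ T f₁ f₂ ε x τ - fBar δ₁ δ₂ T f₁ f₂ x)

/-! ### The assumptions -/

/-- The set `{x : |x| ≥ r}`. -/
def outer (n : ℕ) (r : ℝ) : Set (Vec n) := {x | r ≤ ‖x‖}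

/-- `f` is `C^k` with respect to `x` on the closed set `K`: for each `τ ≥ 0`, the map `f(·, τ)` is
`C^k` on an open neighbourhood of `K`. -/
def ContDiffInX {n : ℕ} (k : ℕ) (f : Vec n → ℝ → Vec n) (K : Set (Vec n)) : Prop :=
  ∀ τ, 0 ≤ τ → ∃ U : Set (Vec n), IsOpen U ∧ K ⊆ U ∧ ContDiffOn ℝ k (fun x => f x τ) U

/-- The regularity assumption on `f₁`, `f₂`, with period `T` and radius `δ₁`. -/
structure RegularityAssumption {n : ℕ} (f₁ f₂ : Vec n → ℝ → Vec n) (T δ₁ : ℝ) : Prop where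
  δ₁_nonneg : 0 ≤ δ₁
  T_pos : 0 < T
  cont₁ : ContinuousOn (fun p : Vec n × ℝ => f₁ p.1 p.2) (halfSpace n)
  cont₂ : ContinuousOn (fun p : Vec n × ℝ => f₂ p.1 p.2) (halfSpace n)
  lip₁ : ∃ L₁ : ℝ, 0 < L₁ ∧ ∀ x₁ ∈ outer n δ₁, ∀ x₂ ∈ outer n δ₁, ∀ τ, 0 ≤ τ →
    ‖f₁ x₁ τ - f₁ x₂ τ‖ ≤ L₁ * ‖x₁ - x₂‖
  lip₂ : ∃ L₂ : ℝ, 0 < L₂ ∧ ∀ x₁ ∈ outer n δ₁, ∀ x₂ ∈ outer n δ₁, ∀ τ, 0 ≤ τ →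
    ‖f₂ x₁ τ - f₂ x₂ τ‖ ≤ L₂ * ‖x₁ - x₂‖
  periodic₁ : ∀ x τ, 0 ≤ τ → f₁ x (τ + T) = f₁ x τ
  periodic₂ : ∀ x τ, 0 ≤ τ → f₂ x (τ + T) = f₂ x τ
  mean_zero : ∀ x, ∫ τ in (0 : ℝ)..T, f₁ x τ = 0
  smooth₁ : ContDiffInX 2 f₁ (outer n δ₁)
  smooth₂ : ContDiffInX 1 f₂ (outer n δ₁)
  lip₃ : ∃ L₃ : ℝ, 0 < L₃ ∧ ∀ x₁ ∈ outer n δ₁, ∀ x₂ ∈ outer n δ₁,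
    ∀ τ₁, 0 ≤ τ₁ → ∀ τ₂, 0 ≤ τ₂ →
      ‖fderiv ℝ (fun y => f₁ y τ₁) x₁ (f₁ x₁ τ₂) - fderiv ℝ (fun y => f₁ y τ₁) x₂ (f₁ x₂ τ₂)‖
        ≤ L₃ * ‖x₁ - x₂‖

/-- The constraints on the radii, with margin `η > 0`. -/
structure DeltaCondition (η δ₁ δ₂ δ₃ : ℝ) : Prop where
  η_pos : 0 < η
  δ₁_nonneg : 0 ≤ δ₁
  δ₁_δ₂ : (1 + η) * δ₁ ≤ δ₂
  δ₂_δ₃ : (1 + η) * δ₂ < δ₃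

/-- The Lyapunov conditions on the second-order average for given radii `δ₁, δ₂, δ₃`. -/
def LyapunovConditions {n : ℕ} (f₁ f₂ : Vec n → ℝ → Vec n) (T δ₁ δ₂ δ₃ : ℝ) : Prop :=
  ∃ (V : Vec n → ℝ) (α₁ α₂ : ℝ → ℝ) (c₁ c₂ : ℝ) (φ : Vec n → ℝ),
    ContDiff ℝ 1 V ∧ IsClassKInfty α₁ ∧ IsClassKInfty α₂ ∧ 0 < c₁ ∧ 0 < c₂ ∧
    IsPositiveDefinite φ ∧
    (∀ x, α₁ ‖x‖ ≤ V x ∧ V x ≤ α₂ ‖x‖) ∧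
    (∀ x, ‖gradient V x‖ ≤ c₂ * φ x) ∧
    (∀ x ∈ outer n δ₃, inner ℝ (gradient V x) (fBar δ₁ δ₂ T f₁ f₂ x) ≤ -c₁ * φ x ^ 2) ∧
    ((∃ (L ε₀ : ℝ), 0 < L ∧ 0 < ε₀ ∧ ∀ x ∈ outer n δ₃, ∀ τ, 0 ≤ τ → ∀ ε ∈ Ioc 0 ε₀,
        ‖gFun δ₁ δ₂ T f₁ f₂ x τ ε‖ ≤ L * (φ x + 1)) ∨
      (∃ α₃ : ℝ → ℝ, IsClassK α₃ ∧ ∀ x, α₃ ‖x‖ * ‖x‖ ≤ φ x))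

/-- The Lyapunov assumption: the conditions above hold for some admissible radii with the
given `δ₁`. -/
def LyapunovAssumption {n : ℕ} (f₁ f₂ : Vec n → ℝ → Vec n) (T δ₁ : ℝ) : Prop :=
  ∃ η δ₂ δ₃ : ℝ, DeltaCondition η δ₁ δ₂ δ₃ ∧ LyapunovConditions f₁ f₂ T δ₁ δ₂ δ₃

end SecondOrderAveraging

end

open SecondOrderAveraging

/-! The map Ψ_ε removes the oscillation to second order. The key is an integration by parts
(`integral_clm_parts`): it rewrites f̄ as the time mean of f̂₂ - (D_x v₁) f̂₁, and v₂ as the time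
primitive of f̂₂ - (D_x v₁) f̂₁ - f̄, which has mean zero over a period. In this form v₂ is C¹,
periodic and globally Lipschitz, because (D_x v₁) f̂₁ at time τ is the integral over r in [0, τ] of
D_x f̂₁(x, r) f̂₁(x, τ), the very product whose Lipschitz constant is controlled by `lip₃`. So Ψ_ε
is the identity plus a C¹ perturbation with small Lipschitz constant, hence a diffeomorphism
(`exists_contDiff_inverse`).

Let y be the preimage of x. If the bump equals one at y, the terms of order ε⁻¹ and the oscillating
terms of order one cancel in the pushforward, leaving f̄(y) + O(ε(1 + |y|)). Since |x - y| is of the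
same order and f̄ is Lipschitz, the transformed field is f̄(x) + O(ε(1 + |y|))
(`nearId_transformed`).

The Lyapunov function is given for possibly different radii, but far from the origin neither
truncation acts, so the averages and, for small ε, the transformed fields coincide there
(`fBar_congr`, `transformed_congr`). Either growth condition bounds the error by εL(φ + 1)
(`exists_perturbation_bound`). As φ is bounded below by a positive constant far out, the term -c₁φ²
absorbs this error, and V decreases at a rate independent of ε until it reaches a fixed level; this
gives the KL bound (`exists_isUGUB_of_lyapunov`).

Near the origin the fields are merely continuous, so uniqueness of solutions is not available.
Completeness rests on Peano's theorem instead: a solution bounded on a finite interval can be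
continued (`not_isMaximalSolution_of_bounded`). -/

namespace SecondOrderAveraging

/-! ### Peano's existence theorem -/

section Peano

variable {E : Type*} [NormedAddCommGroup E] [NormedSpace ℝ E]

/-- The nodes of the explicit Euler scheme with step `h`. -/
noncomputable def eulerNode (G : E → E) (p : E) (h : ℝ) : ℕ → E
  | 0 => p
  | k + 1 => eulerNode G p h k + h • G (eulerNode G p h k)

lemma eulerNode_sub_le {G : E → E} {p : E} {h M : ℝ} (hh : 0 ≤ h) (hM : ∀ x, ‖G x‖ ≤ M)
    (l d : ℕ) : ‖eulerNode G p h (l + d) - eulerNode G p h l‖ ≤ M * (h * d) := by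
  induction d with
  | zero => simp
  | succ d ih =>
    have h1 : eulerNode G p h (l + (d + 1)) - eulerNode G p h l
        = (eulerNode G p h (l + d) - eulerNode G p h l)
          + h • G (eulerNode G p h (l + d)) := by
      rw [← add_assoc, eulerNode]; abel
    rw [h1]
    refine (norm_add_le _ _).trans ?_
    have h2 : ‖h • G (eulerNode G p h (l + d))‖ ≤ h * M := by
      rw [norm_smul, Real.norm_of_nonneg hh]
      exact mul_le_mul_of_nonneg_left (hM _) hh
    push_cast
    nlinarith

lemma eulerNode_approx {G : E → E} {p v : E} {h e : ℝ} (hh : 0 ≤ h) (l d : ℕ)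
    (hv : ∀ j < d, ‖G (eulerNode G p h (l + j)) - v‖ ≤ e) :
    ‖eulerNode G p h (l + d) - eulerNode G p h l - (h * d) • v‖ ≤ e * (h * d) := by
  induction d with
  | zero => simp
  | succ d ih =>
    have h1 : eulerNode G p h (l + (d + 1)) - eulerNode G p h l - (h * ((d + 1 : ℕ) : ℝ)) • v
        = (eulerNode G p h (l + d) - eulerNode G p h l - (h * d) • v)
          + h • (G (eulerNode G p h (l + d)) - v) := by
      rw [← add_assoc, eulerNode]
      push_cast
      module
    rw [h1]
    refine (norm_add_le _ _).trans ?_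
    have h2 : ‖h • (G (eulerNode G p h (l + d)) - v)‖ ≤ h * e := by
      rw [norm_smul, Real.norm_of_nonneg hh]
      exact mul_le_mul_of_nonneg_left (hv d (Nat.lt_succ_self d)) hh
    have h3 := ih fun j hj => hv j (hj.trans (Nat.lt_succ_self d))
    push_cast
    nlinarith

/-- The Euler approximation with step `1 / (N + 1)`. -/
noncomputable def eulerPath (G : E → E) (p : E) (N : ℕ) (t : ℝ) : E :=
  eulerNode G p ((N + 1 : ℝ)⁻¹) ⌊t * (N + 1)⌋₊

lemma floor_step_tendsto {t : ℝ} (ht : 0 ≤ t) :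
    Tendsto (fun N : ℕ => ((N + 1 : ℝ)⁻¹) * (⌊t * (N + 1)⌋₊ : ℝ)) atTop (𝓝 t) := by
  have h0 : Tendsto (fun N : ℕ => (N + 1 : ℝ)) atTop atTop :=
    tendsto_atTop_add_const_right _ _ tendsto_natCast_atTop_atTop
  have := (tendsto_nat_floor_mul_div_atTop (R := ℝ) ht).comp h0
  refine this.congr fun N => ?_
  simp [div_eq_inv_mul]

/-- At each time the Euler values stay in a closed ball of a proper space, so they converge along
any ultrafilter. Using one ultrafilter for all times replaces the Arzelà–Ascoli selection of a
subsequence. -/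
lemma exists_eulerPath_limit [ProperSpace E] {G : E → E} {M : ℝ} (hM : ∀ x, ‖G x‖ ≤ M) (p : E)
    (t : ℝ) (ht : 0 ≤ t) :
    ∃ z, Tendsto (fun N => eulerPath G p N t) (hyperfilter ℕ : Filter ℕ) (𝓝 z) := by
  have hM0 : 0 ≤ M := (norm_nonneg _).trans (hM p)
  have hc : IsCompact (Metric.closedBall p (M * t)) := isCompact_closedBall _ _
  have hmem : ∀ N, eulerPath G p N t ∈ Metric.closedBall p (M * t) := by
    intro N
    rw [mem_closedBall_iff_norm]
    have hN : (0 : ℝ) < N + 1 := by positivity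
    have h1 := eulerNode_sub_le (p := p) (inv_nonneg.2 hN.le) hM 0 ⌊t * (N + 1)⌋₊
    rw [zero_add] at h1
    refine h1.trans ?_
    have h2 := Nat.floor_le (mul_nonneg ht hN.le)
    have h3 : (N + 1 : ℝ)⁻¹ * (⌊t * (N + 1)⌋₊ : ℝ) ≤ t := by
      rw [inv_mul_le_iff₀ hN]; linarith
    exact mul_le_mul_of_nonneg_left h3 hM0
  obtain ⟨z, -, hz⟩ := hc.ultrafilter_le_nhds ((hyperfilter ℕ).map fun N => eulerPath G p N t)
    (by
      rw [Ultrafilter.coe_map, le_principal_iff, mem_map]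
      exact Eventually.of_forall hmem)
  exact ⟨z, hz⟩

/-- The path moves by at most about M(t - s) < δ/2 between times s and t, and at time r it is
eventually within δ/2 of `z r`. Hence every Euler slope in between is within e of `G (z r)`, and the
estimate survives the limit. Taking r = s or r = t covers right and left difference quotients. -/
lemma eulerLimit_approx {G : E → E} {M : ℝ} (hM : ∀ x, ‖G x‖ ≤ M) {p : E} {z : ℝ → E}
    (hz : ∀ t, 0 ≤ t → Tendsto (fun N => eulerPath G p N t) (hyperfilter ℕ : Filter ℕ) (𝓝 (z t)))
    {s t r δ e : ℝ} (hs : 0 ≤ s) (hst : s ≤ t) (hr : r ∈ Icc s t) (hδ : 0 < δ)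
    (hG : ∀ q, ‖q - z r‖ < δ → ‖G q - G (z r)‖ ≤ e) (hM' : M * (t - s) < δ / 2) :
    ‖z t - z s - (t - s) • G (z r)‖ ≤ e * (t - s) := by
  have hM0 : 0 ≤ M := (norm_nonneg _).trans (hM p)
  have hat : (hyperfilter ℕ : Filter ℕ) ≤ atTop := Nat.hyperfilter_le_atTop
  have hft := (floor_step_tendsto (hs.trans hst)).mono_left hat
  have hfs := (floor_step_tendsto hs).mono_left hat
  have hfr := (floor_step_tendsto (hs.trans hr.1)).mono_left hat
  have h1 := hft.sub hfs
  have lim1 : Tendsto (fun N : ℕ => ‖eulerPath G p N t - eulerPath G p N s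
      - ((N + 1 : ℝ)⁻¹ * (⌊t * (N + 1)⌋₊ : ℝ) - (N + 1 : ℝ)⁻¹ * (⌊s * (N + 1)⌋₊ : ℝ)) • G (z r)‖)
      (hyperfilter ℕ : Filter ℕ) (𝓝 ‖z t - z s - (t - s) • G (z r)‖) :=
    (((hz t (hs.trans hst)).sub (hz s hs)).sub (h1.smul_const _)).norm
  refine le_of_tendsto_of_tendsto lim1 (h1.const_mul e) ?_
  have ev1 : ∀ᶠ N in (hyperfilter ℕ : Filter ℕ), ‖eulerPath G p N r - z r‖ < δ / 2 := by
    have := ((hz r (hs.trans hr.1)).sub_const (z r)).norm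
    rw [sub_self, norm_zero] at this
    exact this.eventually (gt_mem_nhds (half_pos hδ))
  have ev2 : ∀ᶠ N : ℕ in (hyperfilter ℕ : Filter ℕ), M * ((N + 1 : ℝ)⁻¹ * (⌊t * (N + 1)⌋₊ : ℝ)
      - (N + 1 : ℝ)⁻¹ * (⌊s * (N + 1)⌋₊ : ℝ)) < δ / 2 :=
    (h1.const_mul M).eventually (gt_mem_nhds hM')
  filter_upwards [ev1, ev2] with N hN1 hN2
  have hN : (0 : ℝ) < N + 1 := by positivity
  have hls : ⌊s * (N + 1)⌋₊ ≤ ⌊r * (N + 1)⌋₊ := by gcongr; exact hr.1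
  have hlt : ⌊r * (N + 1)⌋₊ ≤ ⌊t * (N + 1)⌋₊ := by gcongr; exact hr.2
  obtain ⟨d₁, hd₁⟩ := Nat.exists_eq_add_of_le hls
  obtain ⟨d₂, hd₂⟩ := Nat.exists_eq_add_of_le hlt
  have hd : ⌊t * (N + 1)⌋₊ = ⌊s * (N + 1)⌋₊ + (d₁ + d₂) := by omega
  have hcast : (N + 1 : ℝ)⁻¹ * (⌊t * (N + 1)⌋₊ : ℝ) - (N + 1 : ℝ)⁻¹ * (⌊s * (N + 1)⌋₊ : ℝ)
      = (N + 1 : ℝ)⁻¹ * ((d₁ + d₂ : ℕ) : ℝ) := by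
    rw [hd]; push_cast; ring
  rw [hcast] at hN2 ⊢
  unfold eulerPath at hN1 ⊢
  rw [hd]
  refine eulerNode_approx (inv_nonneg.2 hN.le) _ _ fun j hj => hG _ ?_
  set k := ⌊s * (N + 1)⌋₊
  have hh : (0 : ℝ) ≤ (N + 1 : ℝ)⁻¹ := inv_nonneg.2 hN.le
  have key : ‖eulerNode G p (N + 1 : ℝ)⁻¹ (k + j)
      - eulerNode G p (N + 1 : ℝ)⁻¹ ⌊r * (N + 1)⌋₊‖ ≤ M * ((N + 1 : ℝ)⁻¹ * ((d₁ + d₂ : ℕ) : ℝ)) := by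
    rcases le_total j d₁ with hj1 | hj1
    · obtain ⟨e', he'⟩ := Nat.exists_eq_add_of_le hj1
      have : ⌊r * (N + 1)⌋₊ = (k + j) + e' := by omega
      rw [this, norm_sub_rev]
      refine (eulerNode_sub_le hh hM _ _).trans ?_
      gcongr
      omega
    · obtain ⟨e', he'⟩ := Nat.exists_eq_add_of_le hj1
      have : k + j = ⌊r * (N + 1)⌋₊ + e' := by omega
      rw [this]
      refine (eulerNode_sub_le hh hM _ _).trans ?_
      gcongr
      omega
  calc _ = ‖(eulerNode G p (N + 1 : ℝ)⁻¹ (k + j)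
      - eulerNode G p (N + 1 : ℝ)⁻¹ ⌊r * (N + 1)⌋₊)
        + (eulerNode G p (N + 1 : ℝ)⁻¹ ⌊r * (N + 1)⌋₊ - z r)‖ := by congr 1; abel
    _ ≤ _ := norm_add_le _ _
    _ < δ := by linarith

/-- Peano's theorem for a bounded continuous vector field. -/
theorem exists_solution_of_bounded [ProperSpace E] {G : E → E} (hG : Continuous G) {M : ℝ}
    (hM : ∀ x, ‖G x‖ ≤ M) (p : E) :
    ∃ z : ℝ → E, z 0 = p ∧ ∀ t, 0 ≤ t → HasDerivWithinAt z (G (z t)) (Ici 0) t := by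
  choose! z hz using exists_eulerPath_limit hM p
  have hM0 : 0 ≤ M := (norm_nonneg _).trans (hM p)
  refine ⟨z, ?_, fun t ht => ?_⟩
  · refine tendsto_nhds_unique (hz 0 le_rfl) ?_
    simp [eulerPath, eulerNode]
  · rw [hasDerivWithinAt_iff_isLittleO, Asymptotics.isLittleO_iff]
    intro e he
    obtain ⟨δ, hδ, hGδ⟩ := Metric.continuous_iff.1 hG (z t) e he
    have hG' : ∀ q, ‖q - z t‖ < δ → ‖G q - G (z t)‖ ≤ e := fun q hq => by
      simpa [dist_eq_norm] using (hGδ q (by simpa [dist_eq_norm] using hq)).le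
    have hnear : ∀ᶠ s in 𝓝[Ici 0] t, M * |s - t| < δ / 2 := by
      have : Continuous fun s : ℝ => M * |s - t| := by fun_prop
      refine nhdsWithin_le_nhds ?_
      refine (this.tendsto t).eventually (gt_mem_nhds ?_)
      simpa using hδ
    filter_upwards [hnear, self_mem_nhdsWithin] with s hs hs0
    rcases le_total t s with hts | hts
    · rw [abs_of_nonneg (sub_nonneg.2 hts)] at hs
      rw [Real.norm_of_nonneg (sub_nonneg.2 hts)]
      exact eulerLimit_approx hM hz ht hts ⟨le_rfl, hts⟩ hδ hG' hs
    · rw [abs_of_nonpos (sub_nonpos.2 hts), neg_sub] at hs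
      rw [Real.norm_of_nonpos (sub_nonpos.2 hts), neg_sub]
      have := eulerLimit_approx hM hz hs0 hts ⟨hts, le_rfl⟩ hδ hG' hs
      have h2 : z s - z t - (s - t) • G (z t) = -(z t - z s - (t - s) • G (z t)) := by module
      rwa [h2, norm_neg]

/-- Peano's theorem. -/
theorem exists_local_solution [ProperSpace E] {G : E → E} (hG : Continuous G) (p : E) :
    ∃ (z : ℝ → E) (a : ℝ), 0 < a ∧ z 0 = p ∧
      ∀ t ∈ Ico 0 a, HasDerivWithinAt z (G (z t)) (Ici 0) t := by
  set M := ‖G p‖ + 1 with hMdef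
  have hM0 : 0 < M := by positivity
  -- Radial cutoff of G at level M: it is bounded by M and equals G wherever ‖G‖ < M, which holds
  -- for a short time because ‖G p‖ < M.
  let H : E → E := fun x => (M / max M ‖G x‖) • G x
  have hmax : ∀ x, 0 < max M ‖G x‖ := fun x => lt_max_of_lt_left hM0
  have hH : Continuous H :=
    (continuous_const.div (continuous_const.max hG.norm) fun x => (hmax x).ne').smul hG
  have hHM : ∀ x, ‖H x‖ ≤ M := by
    intro x
    rw [norm_smul, Real.norm_of_nonneg (div_nonneg hM0.le (hmax x).le), div_mul_eq_mul_div,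
      div_le_iff₀ (hmax x)]
    exact mul_le_mul_of_nonneg_left (le_max_right _ _) hM0.le
  obtain ⟨z, hz0, hz⟩ := exists_solution_of_bounded hH hHM p
  have hev : ∀ᶠ t in 𝓝[≥] (0 : ℝ), ‖G (z t)‖ < M := by
    have h1 : ContinuousWithinAt (fun t => ‖G (z t)‖) (Ici 0) 0 :=
      (hG.norm.continuousAt).comp_continuousWithinAt (hz 0 le_rfl).continuousWithinAt
    refine h1.eventually (gt_mem_nhds ?_)
    simp only [hz0]; linarith
  obtain ⟨a, ha, hsub⟩ := (mem_nhdsGE_iff_exists_Ico_subset).1 hev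
  refine ⟨z, a, ha, hz0, fun t ht => ?_⟩
  have h2 : ‖G (z t)‖ < M := hsub ht
  have h3 : H (z t) = G (z t) := by
    simp [H, max_eq_left h2.le, hM0.ne']
  rw [← h3]
  exact hz t ht.1

/-- A bounded solution of `p' = G(p)` on `[0, b)` extends beyond `b`. -/
theorem exists_extension [ProperSpace E] {G : E → E} (hG : Continuous G) {p : ℝ → E} {b B : ℝ}
    (hb : 0 < b) (hp : ∀ t ∈ Ico 0 b, HasDerivWithinAt p (G (p t)) (Ico 0 b) t)
    (hB : ∀ t ∈ Ico 0 b, ‖p t‖ ≤ B) :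
    ∃ (q : ℝ → E) (c : ℝ), b < c ∧ EqOn q p (Ico 0 b) ∧
      ∀ t ∈ Ico 0 c, HasDerivWithinAt q (G (q t)) (Ico 0 c) t := by
  obtain ⟨C, hC⟩ := (isCompact_closedBall (0 : E) B).exists_bound_of_continuousOn hG.continuousOn
  have hlip : ∀ s ∈ Ico 0 b, ∀ t ∈ Ico 0 b, ‖p t - p s‖ ≤ C * ‖t - s‖ := fun s hs t ht =>
    (convex_Ico 0 b).norm_image_sub_le_of_norm_hasDerivWithin_le hp
      (fun u hu => hC _ (by simpa using hB u hu)) hs ht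
  have hlip' : LipschitzOnWith C.toNNReal p (Ico 0 b) :=
    LipschitzOnWith.of_dist_le_mul fun s hs t ht => by
      rw [dist_eq_norm, dist_eq_norm]
      refine (hlip t ht s hs).trans ?_
      gcongr
      exact Real.le_coe_toNNReal C
  have hcl : b ∈ closure (Ico 0 b) := by
    rw [closure_Ico hb.ne]; exact ⟨hb.le, le_rfl⟩
  have : NeBot (𝓝[Ico 0 b] b) := mem_closure_iff_nhdsWithin_neBot.1 hcl
  -- A bounded solution has bounded speed, so it is Lipschitz and has a limit at b; the extension
  -- restarts from this limit.
  obtain ⟨pb, hpb⟩ : ∃ pb, Tendsto p (𝓝[Ico 0 b] b) (𝓝 pb) := by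
    have hc : Cauchy (map p (𝓝[Ico 0 b] b)) :=
      (cauchy_nhds.mono nhdsWithin_le_nhds).map_of_le hlip'.uniformContinuousOn
        (le_principal_iff.2 self_mem_nhdsWithin)
    exact CompleteSpace.complete hc
  obtain ⟨z, a, ha, hz0, hz⟩ := exists_local_solution hG pb
  let q : ℝ → E := fun t => if t < b then p t else z (t - b)
  have hql : ∀ t, t < b → q t = p t := fun t ht => if_pos ht
  have hqr : ∀ t, b ≤ t → q t = z (t - b) := fun t ht => if_neg ht.not_gt
  have hqb : q b = pb := by rw [hqr b le_rfl, sub_self, hz0]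
  have hderl : ∀ t ∈ Ico 0 b, HasDerivWithinAt q (G (q t)) (Ico 0 b) t := fun t ht => by
    rw [hql t ht.2]
    exact (hp t ht).congr (fun s hs => hql s hs.2) (hql t ht.2)
  have hderr : ∀ t ∈ Ico b (b + a), HasDerivWithinAt q (G (q t)) (Ici b) t := fun t ht => by
    rw [hqr t ht.1]
    have h1 : HasDerivWithinAt z (G (z (t - b))) (Ici 0) (t - b) :=
      hz _ ⟨sub_nonneg.2 ht.1, by linarith [ht.2]⟩
    have h2 := h1.scomp t ((hasDerivAt_id t).sub_const b).hasDerivWithinAt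
      (s := Ici b) (fun s hs => by simpa using hs)
    rw [one_smul] at h2
    exact h2.congr (fun s hs => hqr s hs) (hqr t ht.1)
  refine ⟨q, b + a, by linarith, fun t ht => hql t ht.2, fun t ht => ?_⟩
  rcases lt_trichotomy t b with htb | rfl | htb
  · refine (hderl t ⟨ht.1, htb⟩).mono_of_mem_nhdsWithin ?_
    filter_upwards [self_mem_nhdsWithin, nhdsWithin_le_nhds (gt_mem_nhds htb)] with s hs hs'
    exact ⟨hs.1, hs'⟩
  · have hIoo : Ioo 0 t ∈ 𝓝[<] t := Ioo_mem_nhdsLT hb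
    have hderiv : ∀ s ∈ Ioo 0 t, HasDerivAt q (G (q s)) s := fun s hs =>
      (hderl s ⟨hs.1.le, hs.2⟩).hasDerivAt (Ico_mem_nhds hs.1 hs.2)
    have hlim : Tendsto q (𝓝[Ico 0 t] t) (𝓝 (q t)) := by
      rw [hqb]
      refine hpb.congr' ?_
      filter_upwards [self_mem_nhdsWithin] with s hs
      exact (hql s hs.2).symm
    have hlim' : Tendsto q (𝓝[Ioo 0 t] t) (𝓝 (q t)) :=
      hlim.mono_left (nhdsWithin_mono _ Ioo_subset_Ico_self)
    have hlim2 : Tendsto q (𝓝[<] t) (𝓝 (q t)) := by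
      rwa [nhdsWithin_Ioo_eq_nhdsLT hb] at hlim'
    -- At the gluing time the left derivative exists because the derivative `G (q s)` has a limit
    -- from the left; the right derivative comes from the restarted solution.
    have hleft : HasDerivWithinAt q (G (q t)) (Iic t) t := by
      refine hasDerivWithinAt_Iic_of_tendsto_deriv
        (fun s hs => (hderiv s hs).differentiableAt.differentiableWithinAt) hlim' hIoo ?_
      refine ((hG.tendsto _).comp hlim2).congr' ?_
      filter_upwards [hIoo] with s hs
      exact (hderiv s hs).deriv.symm
    have := hleft.union (hderr t ⟨le_rfl, ht.2⟩)
    exact this.mono fun s _ => by simp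
  · exact ((hderr t ⟨htb.le, ht.2⟩).hasDerivAt (Ici_mem_nhds htb)).hasDerivWithinAt

end Peano

/-! ### Continuation of solutions of the time-dependent system -/

lemma solDom_coe (b : ℝ) : solDom (b : EReal) = Ico 0 b := by
  ext t; simp [solDom]

lemma contDiffOn_one_of_hasDerivWithinAt {E : Type*} [NormedAddCommGroup E] [NormedSpace ℝ E]
    {f f' : ℝ → E} {b : ℝ} (hf : ∀ t ∈ Ico 0 b, HasDerivWithinAt f (f' t) (Ico 0 b) t)
    (hf' : ContinuousOn f' (Ico 0 b)) : ContDiffOn ℝ 1 f (Ico 0 b) := by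
  rcases le_or_gt b 0 with hb | hb
  · rw [Ico_eq_empty hb.not_gt]
    exact contDiffOn_empty
  have hu : UniqueDiffOn ℝ (Ico (0 : ℝ) b) := uniqueDiffOn_Ico 0 b
  rw [show (1 : WithTop ℕ∞) = 0 + 1 by simp, contDiffOn_succ_iff_derivWithin hu]
  refine ⟨fun t ht => (hf t ht).differentiableWithinAt, by simp, contDiffOn_zero.2 ?_⟩
  exact hf'.congr fun t ht => (hf t ht).derivWithin (hu t ht)

/-- A solution of a system with continuous right-hand side, bounded on a bounded interval
`[0, b)`, is not maximal. -/
theorem not_isMaximalSolution_of_bounded {n : ℕ} {F : Vec n → ℝ → Vec n} {ε : ℝ}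
    (hF : ContinuousOn (fun p : Vec n × ℝ => F p.1 p.2) (halfSpace n)) {x₀ : Vec n} {τ₀ b B : ℝ}
    {x : ℝ → Vec n} {τ : ℝ → ℝ} (hsol : IsSolution F ε x₀ τ₀ b x τ)
    (hB : ∀ t ∈ solDom b, ‖x t‖ ≤ B) : ¬ IsMaximalSolution F ε x₀ τ₀ b x τ := by
  intro hmax
  have hb : 0 < b := by exact_mod_cast hsol.pos
  refine hmax.2 ?_
  obtain ⟨-, hx0, hτ0, hnn, -, -, hdx, hdτ⟩ := hsol
  rw [solDom_coe] at hnn hdx hdτ hB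
  set w := (ε ^ 2)⁻¹ with hw
  have hw0 : 0 ≤ w := by positivity
  -- Time becomes a state component, which makes the system autonomous. The maximum with 0 extends
  -- the field continuously to negative times and is inactive along solutions, where τ stays
  -- nonnegative.
  let G : Vec n × ℝ → Vec n × ℝ := fun p => (F p.1 (max p.2 0), w)
  have hG : Continuous G := by
    refine Continuous.prodMk ?_ continuous_const
    have : Continuous fun p : Vec n × ℝ => (p.1, max p.2 0) := by fun_prop
    exact hF.comp_continuous this fun p => ⟨mem_univ _, le_max_right p.2 0⟩
  have hp : ∀ t ∈ Ico 0 b, HasDerivWithinAt (fun t => (x t, τ t)) (G (x t, τ t)) (Ico 0 b) t := by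
    intro t ht
    have : G (x t, τ t) = (F (x t) (τ t), w) := by simp [G, max_eq_left (hnn t ht)]
    rw [this]
    exact (hdx t ht).prodMk (hdτ t ht)
  have hτb : ∀ t ∈ Ico 0 b, |τ t| ≤ |τ₀| + w * b := by
    intro t ht
    have h1 := (convex_Ico 0 b).norm_image_sub_le_of_norm_hasDerivWithin_le hdτ
      (fun _ _ => le_rfl) (left_mem_Ico.2 hb) ht
    rw [hτ0, sub_zero, Real.norm_of_nonneg hw0, Real.norm_of_nonneg ht.1] at h1
    have h2 : |τ t| ≤ |τ t - τ₀| + |τ₀| := by simpa using abs_add_le (τ t - τ₀) τ₀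
    have h3 : w * t ≤ w * b := mul_le_mul_of_nonneg_left ht.2.le hw0
    rw [Real.norm_eq_abs] at h1
    linarith
  obtain ⟨q, c, hbc, hqp, hq⟩ := exists_extension hG (B := max B (|τ₀| + w * b)) hb hp
    (fun t ht => by
      rw [Prod.norm_def]
      exact max_le_max (hB t ht) (hτb t ht))
  have hq0 : q 0 = (x₀, τ₀) := by
    simp only [hqp (left_mem_Ico.2 hb), hx0, hτ0]
  have hc : 0 < c := hb.trans hbc
  have hqc : ContinuousOn q (Ico 0 c) := fun t ht => (hq t ht).continuousWithinAt
  have h2 : ∀ t ∈ Ico 0 c, HasDerivWithinAt (fun t => (q t).2) w (Ico 0 c) t := fun t ht =>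
    (hasFDerivAt_snd (𝕜 := ℝ) (E := Vec n) (F := ℝ) (p := q t)).comp_hasDerivWithinAt t (hq t ht)
  have hqnn : ∀ t ∈ Ico 0 c, 0 ≤ (q t).2 := by
    have hmono : MonotoneOn (fun t => (q t).2) (Ico 0 c) := by
      refine monotoneOn_of_deriv_nonneg (convex_Ico 0 c)
        (fun t ht => (h2 t ht).continuousWithinAt) ?_ ?_
      · intro t ht
        exact ((h2 t (interior_subset ht)).mono interior_subset).differentiableWithinAt
      · intro t ht
        rw [((h2 t (interior_subset ht)).hasDerivAt (mem_interior_iff_mem_nhds.1 ht)).deriv]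
        exact hw0
    intro t ht
    have := hmono (left_mem_Ico.2 hc) ht ht.1
    have h3 : 0 ≤ (q 0).2 := by
      rw [hq0]; simpa [hτ0] using hnn 0 (left_mem_Ico.2 hb)
    exact h3.trans this
  have h1 : ∀ t ∈ Ico 0 c, HasDerivWithinAt (fun t => (q t).1) (F (q t).1 (q t).2) (Ico 0 c) t := by
    intro t ht
    have := (hasFDerivAt_fst (𝕜 := ℝ) (E := Vec n) (F := ℝ) (p := q t)).comp_hasDerivWithinAt t
      (hq t ht)
    have h4 : (ContinuousLinearMap.fst ℝ (Vec n) ℝ) (G (q t)) = F (q t).1 (q t).2 := by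
      simp [G, max_eq_left (hqnn t ht)]
    rw [h4] at this
    exact this
  refine ⟨c, fun t => (q t).1, fun t => (q t).2, by exact_mod_cast hbc, ?_, ?_, ?_⟩
  · refine ⟨by exact_mod_cast hc, by rw [hq0], by rw [hq0], ?_, ?_, ?_, ?_, ?_⟩ <;> rw [solDom_coe]
    · exact hqnn
    · refine contDiffOn_one_of_hasDerivWithinAt h1 ?_
      exact hF.comp hqc fun t ht => ⟨mem_univ _, hqnn t ht⟩
    · exact contDiffOn_one_of_hasDerivWithinAt h2 continuousOn_const
    · exact h1
    · exact h2
  · rw [solDom_coe]; intro t ht; simp [hqp ht]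
  · rw [solDom_coe]; intro t ht; simp [hqp ht]

end SecondOrderAveraging

namespace SecondOrderAveraging

/-! ### Ultimate boundedness from a Lyapunov function -/

/-- A function that decreases at rate `ρ` as long as it exceeds `c`. -/
lemma le_max_of_deriv_le {u u' : ℝ → ℝ} {c ρ t : ℝ} (hρ : 0 ≤ ρ) (ht : 0 ≤ t)
    (hu : ContinuousOn u (Icc 0 t)) (hu' : ∀ s ∈ Ioo 0 t, HasDerivAt u (u' s) s)
    (hd : ∀ s ∈ Ioo 0 t, c < u s → u' s ≤ -ρ) : u t ≤ max (u 0 - ρ * t) c := by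
  by_contra! hcon
  obtain ⟨h1, h2⟩ := max_lt_iff.1 hcon
  by_cases hex : ∃ s ∈ Icc 0 t, u s ≤ c
  · have hcomp : IsCompact (Icc 0 t ∩ u ⁻¹' Iic c) :=
      isCompact_Icc.of_isClosed_subset (hu.preimage_isClosed_of_isClosed isClosed_Icc isClosed_Iic)
        inter_subset_left
    obtain ⟨s₁, hs₁, hs₁'⟩ := hex
    -- The last time s with u ≤ c. After it u exceeds c, so its derivative is nonpositive, while the
    -- mean value theorem between s and t produces a positive one.
    obtain ⟨s, ⟨hs, hsc⟩, hmax⟩ := hcomp.exists_isGreatest ⟨s₁, hs₁, hs₁'⟩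
    have hsc' : u s ≤ c := hsc
    have hst : s < t := lt_of_le_of_ne hs.2 (by rintro rfl; linarith)
    obtain ⟨ξ, hξ, hslope⟩ := exists_hasDerivAt_eq_slope u u' hst
      (hu.mono (Icc_subset_Icc_left hs.1)) fun x hx => hu' x ⟨hs.1.trans_lt hx.1, hx.2⟩
    have hξ0 : ξ ∈ Ioo 0 t := ⟨hs.1.trans_lt hξ.1, hξ.2⟩
    have hξc : c < u ξ := by
      by_contra! h
      exact (hmax ⟨Ioo_subset_Icc_self hξ0, h⟩).not_gt hξ.1
    have h3 := hd ξ hξ0 hξc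
    rw [hslope] at h3
    have h4 : 0 < (u t - u s) / (t - s) := div_pos (by linarith) (by linarith)
    linarith
  · push Not at hex
    rcases ht.eq_or_lt with rfl | ht0
    · simp at h1
    obtain ⟨ξ, hξ, hslope⟩ := exists_hasDerivAt_eq_slope u u' ht0 hu hu'
    have h3 := hd ξ hξ (hex ξ (Ioo_subset_Icc_self hξ))
    rw [hslope, div_le_iff₀ (by linarith)] at h3
    linarith

/-- A `K∞` function extends to an increasing bijection of the line. -/
lemma IsClassKInfty.exists_orderIso {α : ℝ → ℝ} (h : IsClassKInfty α) :
    ∃ e : ℝ ≃o ℝ, ∀ r, 0 ≤ r → e r = α r := by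
  let a : ℝ → ℝ := fun x => if 0 ≤ x then α x else x
  have hpos : ∀ x, 0 ≤ x → a x = α x := fun x hx => if_pos hx
  have hneg : ∀ x, x < 0 → a x = x := fun x hx => if_neg hx.not_ge
  have hα0 : ∀ x, 0 ≤ x → 0 ≤ α x := fun x hx => by
    rw [← h.map_zero]; exact h.strictMonoOn.monotoneOn self_mem_Ici hx hx
  have hmono : StrictMono a := by
    intro x y hxy
    rcases le_or_gt 0 x with hx | hx
    · rw [hpos x hx, hpos y (hx.trans hxy.le)]
      exact h.strictMonoOn hx (hx.trans hxy.le) hxy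
    · rw [hneg x hx]
      rcases le_or_gt 0 y with hy | hy
      · rw [hpos y hy]; exact hx.trans_le (hα0 y hy)
      · rwa [hneg y hy]
  have hcont : ContinuousOn a (Ici 0) := h.continuousOn.congr fun x hx => hpos x hx
  have hsurj : Function.Surjective a := by
    intro y
    rcases lt_or_ge y 0 with hy | hy
    · exact ⟨y, hneg y hy⟩
    · obtain ⟨M, hM, hM0⟩ := ((h.tendsto_atTop.eventually_ge_atTop y).and
        (eventually_ge_atTop 0)).exists
      have := intermediate_value_Icc hM0 (h.continuousOn.mono Icc_subset_Ici_self)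
      obtain ⟨x, hx, hxy⟩ := this ⟨by rw [h.map_zero]; exact hy, hM⟩
      exact ⟨x, by rw [hpos x hx.1, hxy]⟩
  exact ⟨hmono.orderIsoOfSurjective a hsurj, fun r hr => hpos r hr⟩

/-- Linear decay cut off at zero, max(A - ρt, 0), is not of class KL, since it vanishes identically
for small A. Its majorant A²/(A + ρt) is strictly monotone in both variables. -/
lemma isClassKL_comp {e₁ e₂ : ℝ ≃o ℝ} (h₁ : e₁ 0 = 0) (h₂ : e₂ 0 = 0) {ρ : ℝ} (hρ : 0 < ρ) :
    IsClassKL fun r t => e₁.symm (e₂ r ^ 2 / (e₂ r + ρ * t)) := by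
  have h₁' : e₁.symm 0 = 0 := by rw [← h₁, e₁.symm_apply_apply, h₁]
  have hpos : ∀ r, 0 < r → 0 < e₂ r := fun r hr => by rw [← h₂]; exact e₂.strictMono hr
  have hnn : ∀ r, 0 ≤ r → 0 ≤ e₂ r := fun r hr => by rw [← h₂]; exact e₂.monotone hr
  have hγ : ContinuousOn (fun p : ℝ × ℝ => e₂ p.1 ^ 2 / (e₂ p.1 + ρ * p.2)) (Ici 0 ×ˢ Ici 0) := by
    rintro ⟨r, t⟩ ⟨hr, ht⟩
    have hr : 0 ≤ r := hr
    have ht : 0 ≤ t := ht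
    have hc2 : Continuous fun p : ℝ × ℝ => e₂ p.1 := e₂.continuous.comp continuous_fst
    -- Where the denominator vanishes the quotient is 0, and it is continuous there because it lies
    -- between 0 and `e₂ r`.
    by_cases hd : e₂ r + ρ * t = 0
    · have hr0 : e₂ r = 0 := by nlinarith [hnn r hr, mul_nonneg hρ.le ht]
      have hval : e₂ r ^ 2 / (e₂ r + ρ * t) = 0 := by simp [hr0]
      unfold ContinuousWithinAt
      simp only [hval]
      refine squeeze_zero' ?_ ?_ (((hc2.tendsto (r, t)).mono_left nhdsWithin_le_nhds).trans
        (by simp [hr0]))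
      · filter_upwards [self_mem_nhdsWithin] with p hp
        exact div_nonneg (sq_nonneg _) (add_nonneg (hnn _ hp.1) (mul_nonneg hρ.le hp.2))
      · filter_upwards [self_mem_nhdsWithin] with p hp
        refine div_le_of_le_mul₀ (add_nonneg (hnn _ hp.1) (mul_nonneg hρ.le hp.2)) (hnn _ hp.1) ?_
        have := mul_nonneg (hnn _ hp.1) (mul_nonneg hρ.le hp.2)
        nlinarith
    · refine ContinuousAt.continuousWithinAt ?_
      exact (hc2.pow 2).continuousAt.div (by fun_prop) hd
  refine ⟨e₁.symm.continuous.comp_continuousOn hγ, fun s hs => ⟨⟨?_, ?_, ?_⟩, ?_⟩, ?_, ?_⟩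
  · have hpair : ContinuousOn (fun r : ℝ => (r, s)) (Ici 0) := by fun_prop
    exact e₁.symm.continuous.comp_continuousOn
      (hγ.comp hpair fun r hr => ⟨hr, hs⟩)
  · intro r hr r' hr' hrr
    refine e₁.symm.strictMono ?_
    have ha : 0 ≤ e₂ r := hnn r hr
    have hb : e₂ r < e₂ r' := e₂.strictMono hrr
    have hc : 0 ≤ ρ * s := mul_nonneg hρ.le hs
    rcases ha.eq_or_lt with ha0 | ha0
    · rw [← ha0]; simp only [ne_eq, OfNat.ofNat_ne_zero, not_false_eq_true, zero_pow, zero_div]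
      have : 0 < e₂ r' := ha.trans_lt hb
      positivity
    -- With a < b the two values and c = ρs, cross-multiplication reduces the claim to ab(b - a) +
    -- c(b² - a²) > 0.
    · rw [div_lt_div_iff₀ (by linarith) (by linarith)]
      nlinarith [mul_pos ha0 (ha0.trans hb), mul_pos (mul_pos ha0 (ha0.trans hb)) (sub_pos.2 hb),
        mul_nonneg hc (mul_nonneg (sub_pos.2 hb).le (add_pos ha0 (ha0.trans hb)).le)]
  · simp [h₂, h₁']
  · refine e₁.symm.tendsto_atTop.comp ?_
    have h3 : Tendsto (fun r => e₂ r - ρ * s) atTop atTop :=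
      tendsto_atTop_add_const_right _ _ e₂.tendsto_atTop
    refine tendsto_atTop_mono' _ ?_ h3
    filter_upwards [eventually_gt_atTop 0] with r hr
    have := hpos r hr
    have hc : 0 ≤ ρ * s := mul_nonneg hρ.le hs
    rw [le_div_iff₀ (by linarith)]
    nlinarith [mul_nonneg hc hc]
  · intro r hr t ht t' ht' htt
    refine e₁.symm.strictMono ?_
    have := hpos r hr
    have h4 : 0 ≤ ρ * t := mul_nonneg hρ.le ht
    gcongr
  · intro r hr
    have : Tendsto (fun t => e₂ r ^ 2 / (e₂ r + ρ * t)) atTop (𝓝 0) :=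
      tendsto_const_nhds.div_atTop
        (tendsto_atTop_add_const_left _ _ (tendsto_id.const_mul_atTop hρ))
    have h5 := (e₁.symm.continuous.tendsto 0).comp this
    rwa [h₁'] at h5

/-- (A - s)(A + s) = A² - s² ≤ A². If A + s = 0, then A = s = 0 and the nonnegative c takes over. -/
lemma max_sub_le_sq_div {A s c : ℝ} (hA : 0 ≤ A) (hs : 0 ≤ s) (hc : 0 ≤ c) :
    max (A - s) c ≤ max (A ^ 2 / (A + s)) c := by
  refine max_le ?_ (le_max_right _ _)
  rcases (add_nonneg hA hs).eq_or_lt with h | h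
  · have : A = 0 := by linarith
    exact le_max_of_le_right (by linarith)
  · refine le_max_of_le_left ?_
    rw [le_div_iff₀ h]
    nlinarith [sq_nonneg s]

/-- A Lyapunov function that decreases at a uniform rate outside a ball yields ultimate
boundedness. -/
theorem exists_isUGUB_of_lyapunov {n : ℕ} {F : ℝ → Vec n → ℝ → Vec n} {V : Vec n → ℝ}
    {α₁ α₂ : ℝ → ℝ} {ρ R εs : ℝ} (hV : ContDiff ℝ 1 V) (h₁ : IsClassKInfty α₁)
    (h₂ : IsClassKInfty α₂) (hVα : ∀ x, α₁ ‖x‖ ≤ V x ∧ V x ≤ α₂ ‖x‖) (hρ : 0 < ρ) (hR : 0 < R)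
    (hεs : 0 < εs)
    (hcont : ∀ ε ∈ Ioo 0 εs, ContinuousOn (fun p : Vec n × ℝ => F ε p.1 p.2) (halfSpace n))
    (hdec : ∀ ε ∈ Ioo 0 εs, ∀ x, R ≤ ‖x‖ → ∀ τ, 0 ≤ τ →
      inner ℝ (gradient V x) (F ε x τ) ≤ -ρ) :
    ∃ Δ : ℝ, 0 < Δ ∧ IsUGUB Δ F := by
  obtain ⟨e₁, he₁⟩ := h₁.exists_orderIso
  obtain ⟨e₂, he₂⟩ := h₂.exists_orderIso
  have h10 : e₁ 0 = 0 := by rw [he₁ 0 le_rfl, h₁.map_zero]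
  have h20 : e₂ 0 = 0 := by rw [he₂ 0 le_rfl, h₂.map_zero]
  have h1s : e₁.symm 0 = 0 := by rw [← h10, e₁.symm_apply_apply, h10]
  -- V > α₂(R) forces ‖x‖ ≥ R, so the decay holds whenever V exceeds c. The ultimate bound is
  -- accordingly Δ = α₁⁻¹(α₂(R)).
  set c := e₂ R with hc
  have hc0 : 0 < c := by rw [hc, ← h20]; exact e₂.strictMono hR
  have hΔ : 0 < e₁.symm c := by rw [← h1s]; exact e₁.symm.strictMono hc0
  refine ⟨e₁.symm c, hΔ, _, εs, isClassKL_comp h10 h20 hρ, hεs, fun ε hε x₀ τ₀ hτ₀ ts x τ => ?_⟩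
  have hbound : IsSolution (F ε) ε x₀ τ₀ ts x τ → ∀ t ∈ solDom ts,
      ‖x t‖ ≤ e₁.symm (e₂ ‖x₀‖ ^ 2 / (e₂ ‖x₀‖ + ρ * t)) + e₁.symm c := by
    intro hsol t ht
    have ht0 : 0 ≤ t := ht.1
    have hsub : Icc 0 t ⊆ solDom ts := fun s hs =>
      ⟨hs.1, lt_of_le_of_lt (by exact_mod_cast hs.2) ht.2⟩
    have hcx : ContinuousOn x (Icc 0 t) := fun s hs =>
      (hsol.deriv_x s (hsub hs)).continuousWithinAt.mono hsub
    have hdx : ∀ s ∈ Ioo 0 t, HasDerivAt x (F ε (x s) (τ s)) s := fun s hs =>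
      (hsol.deriv_x s (hsub (Ioo_subset_Icc_self hs))).hasDerivAt
        (mem_of_superset (Icc_mem_nhds hs.1 hs.2) hsub)
    have hu := le_max_of_deriv_le (u := fun s => V (x s))
      (u' := fun s => inner ℝ (gradient V (x s)) (F ε (x s) (τ s))) (c := c) hρ.le ht0
      (hV.continuous.comp_continuousOn hcx)
      (fun s hs => by
        have hg := ((hV.differentiable (by simp)) (x s)).hasGradientAt.hasFDerivAt
        have : HasDerivAt (fun s => V (x s)) _ s := hg.comp_hasDerivAt s (hdx s hs)
        rwa [InnerProductSpace.toDual_apply_apply] at this)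
      (fun s hs hcs => by
        refine hdec ε hε _ ?_ _ (hsol.nonneg s (hsub (Ioo_subset_Icc_self hs)))
        by_contra! hlt
        have h3 := (hVα (x s)).2
        rw [← he₂ _ (norm_nonneg _)] at h3
        have h4 := e₂.strictMono hlt
        linarith)
    have hA : 0 ≤ e₂ ‖x₀‖ := by rw [← h20]; exact e₂.monotone (norm_nonneg _)
    have h5 : e₁ ‖x t‖ ≤ max (e₂ ‖x₀‖ - ρ * t) c := by
      rw [he₁ _ (norm_nonneg _)]
      refine (hVα (x t)).1.trans (hu.trans (max_le_max_right _ ?_))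
      have := (hVα (x 0)).2
      rw [hsol.init_x, ← he₂ _ (norm_nonneg _)] at this
      simp only [hsol.init_x]
      linarith
    have h6 := h5.trans (max_sub_le_sq_div hA (mul_nonneg hρ.le ht0) hc0.le)
    have h7 : ‖x t‖ ≤ e₁.symm (max (e₂ ‖x₀‖ ^ 2 / (e₂ ‖x₀‖ + ρ * t)) c) :=
      e₁.le_symm_apply.2 h6
    rw [e₁.symm.monotone.map_max] at h7
    have h8 : 0 ≤ e₁.symm (e₂ ‖x₀‖ ^ 2 / (e₂ ‖x₀‖ + ρ * t)) := by
      rw [← h1s]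
      refine e₁.symm.monotone (div_nonneg (sq_nonneg _) (add_nonneg hA (mul_nonneg hρ.le ht0)))
    exact h7.trans (max_le (by linarith) (by linarith))
  refine ⟨hbound, fun hmax => ?_⟩
  induction ts with
  | bot => exact absurd hmax.1.pos (by simp)
  | top => rfl
  | coe b =>
    exfalso
    -- A finite end time is impossible: the KL term is at most its value at time 0, so the solution
    -- stays bounded.
    refine not_isMaximalSolution_of_bounded (hcont ε hε) hmax.1 (B := e₁.symm (e₂ ‖x₀‖) + e₁.symm c)
      (fun t ht => (hbound hmax.1 t ht).trans ?_) hmax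
    gcongr
    have hA : 0 ≤ e₂ ‖x₀‖ := by rw [← h20]; exact e₂.monotone (norm_nonneg _)
    have hs : 0 ≤ ρ * t := mul_nonneg hρ.le ht.1
    refine div_le_of_le_mul₀ (add_nonneg hA hs) hA ?_
    nlinarith [mul_nonneg hA hs]

end SecondOrderAveraging

namespace SecondOrderAveraging

/-! ### Smoothness of the reverse bump function -/

section Bump

variable {E : Type*} [NormedAddCommGroup E] [InnerProductSpace ℝ E]

/-- The gradient of the norm is x/‖x‖, and the factor r in the derivative of ψ cancels its
denominator. At the origin ψ'(0) = 0 suffices. -/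
lemma hasFDerivAt_comp_norm {ψ q : ℝ → ℝ} (h : ∀ r, HasDerivAt ψ (r * q r) r) (x : E) :
    HasFDerivAt (fun y : E => ψ ‖y‖) (q ‖x‖ • innerSL ℝ x) x := by
  by_cases hx : x = 0
  · subst hx
    simp only [map_zero, smul_zero]
    have h0 := h 0
    rw [zero_mul, hasDerivAt_iff_isLittleO_nhds_zero] at h0
    rw [hasFDerivAt_iff_isLittleO_nhds_zero]
    have h1 := (h0.comp_tendsto (tendsto_norm_zero (E := E))).of_norm_right
    simpa [Function.comp_def] using h1
  · have hx' : ‖x‖ ≠ 0 := norm_ne_zero_iff.2 hx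
    have h1 : HasFDerivAt (fun y : E => ‖y‖) ((1 / ‖x‖) • innerSL ℝ x) x := by
      have h2 := (hasStrictFDerivAt_norm_sq x).hasFDerivAt.sqrt (by positivity)
      simp only [Real.sqrt_sq (norm_nonneg _)] at h2
      convert! h2 using 1
      rw [two_smul, ← two_smul ℝ, smul_smul]
      congr 1
      field_simp
    have h3 := (h ‖x‖).comp_hasFDerivAt x h1
    convert! h3 using 1
    rw [smul_smul]
    congr 1
    field_simp

open Polynomial in
/-- Functions of the form `p(1/r) e^{-1/r} k(r)`, flat at the origin. -/
noncomputable def flatFun (p : ℝ[X]) (k : ℝ → ℝ) (r : ℝ) : ℝ :=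
  p.eval r⁻¹ * expNegInvGlue r * k r

-- Flat functions are stable under ψ ↦ ψ'(r)/r: differentiating p(1/r)e^{-1/r} gives the polynomial
-- X²(p - p') in 1/r, and dividing by r adds one more power of X. The default value 0⁻¹ = 0 is
-- harmless, since e^{-1/r} is glued by 0.
open Polynomial in
lemma hasDerivAt_flatFun (p : ℝ[X]) {k : ℝ → ℝ} (hk : Differentiable ℝ k) (r : ℝ) :
    HasDerivAt (flatFun p k)
      (r * (flatFun (X ^ 3 * (p - derivative p)) k r + flatFun (X * p) (deriv k) r)) r := by
  have h := (expNegInvGlue.hasDerivAt_polynomial_eval_inv_mul p r).mul (hk r).hasDerivAt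
  refine h.congr_deriv ?_
  rcases eq_or_ne r 0 with rfl | hr
  · simp [expNegInvGlue.zero]
  · simp only [flatFun, eval_mul, eval_pow, eval_X, eval_sub]
    field_simp

-- Induction on the order: the gradient of a radial flat function is a radial flat function times x.
open Polynomial in
lemma contDiff_flatFun_norm (m : ℕ) (p : ℝ[X]) {k : ℝ → ℝ} (hk : ContDiff ℝ (⊤ : ℕ∞) k) :
    ContDiff ℝ m (fun x : E => flatFun p k ‖x‖) := by
  have hfd : ∀ (p : ℝ[X]) {k : ℝ → ℝ}, ContDiff ℝ (⊤ : ℕ∞) k → ∀ x : E,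
      HasFDerivAt (fun x : E => flatFun p k ‖x‖)
        ((flatFun (X ^ 3 * (p - derivative p)) k ‖x‖ + flatFun (X * p) (deriv k) ‖x‖) •
          innerSL ℝ x) x := fun p k hk x =>
    hasFDerivAt_comp_norm (fun r => hasDerivAt_flatFun p (hk.differentiable (by simp)) r) x
  induction m generalizing p k with
  | zero =>
    exact contDiff_zero.2 (continuous_iff_continuousAt.2 fun x => (hfd p hk x).continuousAt)
  | succ m ih =>
    rw [show ((m + 1 : ℕ) : WithTop ℕ∞) = m + 1 from rfl]
    refine contDiff_succ_iff_fderiv.2 ⟨fun x => (hfd p hk x).differentiableAt, by simp, ?_⟩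
    have hk' : ContDiff ℝ (⊤ : ℕ∞) (deriv k) := (contDiff_infty_iff_deriv.1 hk).2
    rw [show fderiv ℝ (fun x : E => flatFun p k ‖x‖) = fun x => _ from
      funext fun x => (hfd p hk x).fderiv]
    exact ((ih _ hk).add (ih _ hk')).smul (innerSL ℝ).contDiff

/-- Serves the case δ₁ = 0 < δ₂, where the bump is not constant near the origin. The norm is
singular there and only the flatness of e^{-1/r} gives smoothness. -/
lemma contDiff_smoothTransition_norm (m : ℕ) :
    ContDiff ℝ m (fun x : E => Real.smoothTransition ‖x‖) := by
  have hk : ContDiff ℝ (⊤ : ℕ∞) fun r : ℝ => (expNegInvGlue r + expNegInvGlue (1 - r))⁻¹ :=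
    (expNegInvGlue.contDiff.add (expNegInvGlue.contDiff.comp
      (contDiff_const.sub contDiff_id))).inv
      fun r => (Real.smoothTransition.pos_denom r).ne'
  have := contDiff_flatFun_norm (E := E) m 1 hk
  simpa [flatFun, Real.smoothTransition, div_eq_mul_inv] using this

end Bump

variable {n : ℕ} {δ₁ δ₂ : ℝ}

lemma bump_eq_one {x : Vec n} (hx : δ₂ ≤ ‖x‖) : bump δ₁ δ₂ x = 1 := by
  unfold bump
  split_ifs with h
  · refine Real.smoothTransition.one_of_one_le ?_
    rw [le_div_iff₀ (sub_pos.2 h)]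
    linarith
  · rfl

lemma bump_eq_zero (h : δ₁ < δ₂) {x : Vec n} (hx : ‖x‖ ≤ δ₁) : bump δ₁ δ₂ x = 0 := by
  unfold bump
  rw [if_pos h]
  exact Real.smoothTransition.zero_of_nonpos
    (div_nonpos_of_nonpos_of_nonneg (by linarith) (by linarith))

lemma contDiff_bump (hδ₁ : 0 ≤ δ₁) : ContDiff ℝ 2 (bump (n := n) δ₁ δ₂) := by
  by_cases h : δ₁ < δ₂
  swap
  · have : bump (n := n) δ₁ δ₂ = fun _ => 1 := funext fun x => if_neg h
    rw [this]; exact contDiff_const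
  have hb : bump (n := n) δ₁ δ₂ = fun x => Real.smoothTransition ((‖x‖ - δ₁) / (δ₂ - δ₁)) :=
    funext fun x => if_pos h
  rcases hδ₁.eq_or_lt with rfl | h0
  · have : bump (n := n) 0 δ₂ = fun x => Real.smoothTransition ‖δ₂⁻¹ • x‖ := by
      rw [hb]; funext x
      rw [norm_smul, norm_inv, Real.norm_of_nonneg h.le]
      simp [div_eq_inv_mul]
    rw [this]
    exact (contDiff_smoothTransition_norm 2).comp (contDiff_const_smul _)
  · rw [contDiff_iff_contDiffAt]
    intro x
    by_cases hx : x = 0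
    · subst hx
      refine (contDiffAt_const (c := (0 : ℝ))).congr_of_eventuallyEq ?_
      filter_upwards [Metric.ball_mem_nhds (0 : Vec n) h0] with y hy
      exact bump_eq_zero h (by simpa using (mem_ball_zero_iff.1 hy).le)
    · rw [hb]
      exact (Real.smoothTransition.contDiffAt (n := 2)).comp x
        (((contDiffAt_norm ℝ hx).sub contDiffAt_const).div_const _)

end SecondOrderAveraging

namespace SecondOrderAveraging

open MeasureTheory intervalIntegral

/-! ### Integrals depending on a parameter -/

variable {n : ℕ}

/-- A family of `C¹` maps, uniformly Lipschitz, depending measurably on a parameter. -/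
structure LipschitzField (F : Vec n → ℝ → Vec n) (K : ℝ) : Prop where
  meas : ∀ x, StronglyMeasurable (F x)
  smooth : ∀ s, ContDiff ℝ 1 (fun x => F x s)
  lip : ∀ s x y, ‖F x s - F y s‖ ≤ K * ‖x - y‖
  bdd : ∀ x, ∃ C, ∀ s, ‖F x s‖ ≤ C

lemma norm_fderiv_le_of_forall_norm_sub_le {f : Vec n → Vec n} {K : ℝ} (hK : 0 ≤ K)
    (hf : ∀ x y, ‖f x - f y‖ ≤ K * ‖x - y‖) (x : Vec n) : ‖fderiv ℝ f x‖ ≤ K := by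
  lift K to NNReal using hK
  exact norm_fderiv_le_of_lipschitz ℝ
    (LipschitzWith.of_dist_le_mul fun x y => by simpa [dist_eq_norm] using hf x y)

/-- No continuity of D_x F in time is assumed. Each directional derivative is a pointwise limit of
measurable difference quotients, and the operator is reassembled from its values on a basis. -/
lemma stronglyMeasurable_fderiv_of_measurable {F : Vec n → ℝ → Vec n}
    (hm : ∀ x, StronglyMeasurable (F x)) (hd : ∀ s, Differentiable ℝ (fun x => F x s))
    (x : Vec n) : StronglyMeasurable fun s => fderiv ℝ (fun y => F y s) x := by
  have happ : ∀ v, StronglyMeasurable fun s => fderiv ℝ (fun y => F y s) x v := by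
    intro v
    have hlim : ∀ s, Tendsto (fun k : ℕ => (k : ℝ) • (F (x + (k : ℝ)⁻¹ • v) s - F x s)) atTop
        (𝓝 (fderiv ℝ (fun y => F y s) x v)) := fun s =>
      ((hd s x).hasFDerivAt.lim_real v).comp tendsto_natCast_atTop_atTop
    refine stronglyMeasurable_of_tendsto atTop
      (f := fun (k : ℕ) s => (k : ℝ) • (F (x + (k : ℝ)⁻¹ • v) s - F x s))
      (fun k => ((hm (x + (k : ℝ)⁻¹ • v)).sub (hm x)).const_smul (k : ℝ)) (tendsto_pi_nhds.2 hlim)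
  let b := (EuclideanSpace.basisFun (Fin n) ℝ)
  have hsum : (fun s => fderiv ℝ (fun y => F y s) x) = fun s =>
      ∑ i, (EuclideanSpace.proj (𝕜 := ℝ) i : Vec n →L[ℝ] ℝ).smulRight
        (fderiv ℝ (fun y => F y s) x (b i)) := by
    funext s
    ext1 v
    conv_lhs => rw [← b.sum_repr v]
    simp [b]
  rw [hsum]
  refine Finset.stronglyMeasurable_fun_sum _ fun i _ => ?_
  exact (ContinuousLinearMap.smulRightL ℝ (Vec n) (Vec n)
    (EuclideanSpace.proj (𝕜 := ℝ) i)).continuous.comp_stronglyMeasurable (happ _)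

namespace LipschitzField

variable {F : Vec n → ℝ → Vec n} {K : ℝ}

lemma norm_fderiv_le (h : LipschitzField F K) (hK : 0 ≤ K) (x : Vec n) (s : ℝ) :
    ‖fderiv ℝ (fun y => F y s) x‖ ≤ K :=
  norm_fderiv_le_of_forall_norm_sub_le hK (h.lip s) x

lemma intervalIntegrable (h : LipschitzField F K) (x : Vec n) (a b : ℝ) :
    IntervalIntegrable (F x) volume a b := by
  obtain ⟨C, hC⟩ := h.bdd x
  exact (intervalIntegrable_const (c := C)).mono_fun (h.meas x).aestronglyMeasurable
    (ae_of_all _ fun s => (hC s).trans (Real.le_norm_self _))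

lemma stronglyMeasurable_fderiv (h : LipschitzField F K) (x : Vec n) :
    StronglyMeasurable fun s => fderiv ℝ (fun y => F y s) x :=
  stronglyMeasurable_fderiv_of_measurable h.meas (fun s => (h.smooth s).differentiable (by simp)) x

lemma intervalIntegrable_fderiv (h : LipschitzField F K) (hK : 0 ≤ K) (x : Vec n) (a b : ℝ) :
    IntervalIntegrable (fun s => fderiv ℝ (fun y => F y s) x) volume a b :=
  (intervalIntegrable_const (c := K)).mono_fun (h.stronglyMeasurable_fderiv x).aestronglyMeasurable
    (ae_of_all _ fun s => (h.norm_fderiv_le hK x s).trans (Real.le_norm_self _))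

lemma hasFDerivAt_integral (h : LipschitzField F K) (hK : 0 ≤ K) (a b : ℝ) (x : Vec n) :
    HasFDerivAt (fun y => ∫ s in a..b, F y s) (∫ s in a..b, fderiv ℝ (fun y => F y s) x) x := by
  refine (hasFDerivAt_integral_of_dominated_loc_of_lip (bound := fun _ => K) univ_mem
    (Eventually.of_forall fun y => (h.meas y).aestronglyMeasurable) (h.intervalIntegrable x a b)
    (h.stronglyMeasurable_fderiv x).aestronglyMeasurable (ae_of_all _ fun s _ => ?_)
    intervalIntegrable_const (ae_of_all _ fun s _ => ?_)).2
  · refine LipschitzOnWith.of_dist_le_mul fun y _ z _ => ?_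
    simpa [dist_eq_norm, abs_of_nonneg hK] using h.lip s y z
  · exact ((h.smooth s).differentiable (by simp) x).hasFDerivAt

/-- The integrand need not be continuous in time. For fixed τ₀ dominated convergence gives
continuity in x, and replacing τ₀ by τ costs at most K|τ - τ₀|, uniformly in x. -/
lemma continuous_integral_fderiv (h : LipschitzField F K) (hK : 0 ≤ K) :
    Continuous fun p : Vec n × ℝ => ∫ s in (0 : ℝ)..p.2, fderiv ℝ (fun y => F y s) p.1 := by
  have hx : ∀ τ : ℝ, Continuous fun x : Vec n => ∫ s in (0 : ℝ)..τ, fderiv ℝ (fun y => F y s) x :=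
    fun τ => continuous_of_dominated_interval (bound := fun _ => K)
      (fun x => (h.stronglyMeasurable_fderiv x).aestronglyMeasurable)
      (fun x => ae_of_all _ fun s _ => h.norm_fderiv_le hK x s) intervalIntegrable_const
      (ae_of_all _ fun s _ => (h.smooth s).continuous_fderiv (by simp))
  rw [continuous_iff_continuousAt]
  rintro ⟨x₀, τ₀⟩
  have h1 : Tendsto (fun p : Vec n × ℝ => ∫ s in (0 : ℝ)..τ₀, fderiv ℝ (fun y => F y s) p.1)
      (𝓝 (x₀, τ₀)) (𝓝 (∫ s in (0 : ℝ)..τ₀, fderiv ℝ (fun y => F y s) x₀)) :=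
    ((hx τ₀).comp continuous_fst).tendsto _
  have h2 : Tendsto (fun p : Vec n × ℝ => ∫ s in τ₀..p.2, fderiv ℝ (fun y => F y s) p.1)
      (𝓝 (x₀, τ₀)) (𝓝 0) := by
    have hc : Continuous fun p : Vec n × ℝ => K * |p.2 - τ₀| := by fun_prop
    refine squeeze_zero_norm (fun p => ?_) ((hc.tendsto (x₀, τ₀)).trans (by simp))
    exact norm_integral_le_of_norm_le_const fun s _ => h.norm_fderiv_le hK _ s
  have h3 := h1.add h2
  rw [add_zero] at h3
  refine h3.congr fun p => ?_
  exact integral_add_adjacent_intervals (h.intervalIntegrable_fderiv hK _ _ _)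
    (h.intervalIntegrable_fderiv hK _ _ _)

lemma norm_integral_sub_le (h : LipschitzField F K) (a b : ℝ) (x y : Vec n) :
    ‖(∫ s in a..b, F x s) - ∫ s in a..b, F y s‖ ≤ K * |b - a| * ‖x - y‖ := by
  rw [← integral_sub (h.intervalIntegrable x a b) (h.intervalIntegrable y a b)]
  refine (norm_integral_le_of_norm_le_const fun s _ => h.lip s x y).trans (le_of_eq ?_)
  ring

lemma contDiff_integral (h : LipschitzField F K) (hK : 0 ≤ K) (b : ℝ) :
    ContDiff ℝ 1 fun y => ∫ s in (0 : ℝ)..b, F y s := by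
  rw [contDiff_one_iff_fderiv]
  refine ⟨fun x => (h.hasFDerivAt_integral hK 0 b x).differentiableAt, ?_⟩
  rw [show fderiv ℝ (fun y => ∫ s in (0 : ℝ)..b, F y s) = _ from
    funext fun x => (h.hasFDerivAt_integral hK 0 b x).fderiv]
  exact (h.continuous_integral_fderiv hK).comp (continuous_id.prodMk continuous_const)

lemma hasDerivAt_integral (hc : Continuous (Function.uncurry F)) (x : Vec n) (τ : ℝ) :
    HasDerivAt (fun τ => ∫ s in (0 : ℝ)..τ, F x s) (F x τ) τ :=
  (hc.uncurry_left x).integral_hasStrictDerivAt 0 τ |>.hasDerivAt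

/-- Both partial derivatives exist everywhere and are jointly continuous, which is enough for joint
C¹ regularity. -/
lemma contDiff_integral_uncurry (h : LipschitzField F K) (hK : 0 ≤ K)
    (hc : Continuous (Function.uncurry F)) :
    ContDiff ℝ 1 fun p : Vec n × ℝ => ∫ s in (0 : ℝ)..p.2, F p.1 s := by
  let f : Vec n → ℝ → Vec n := fun x τ => ∫ s in (0 : ℝ)..τ, F x s
  let f₁ : Vec n → ℝ → Vec n →L[ℝ] Vec n := fun x τ => ∫ s in (0 : ℝ)..τ, fderiv ℝ (fun y => F y s) x
  let f₂ : Vec n → ℝ → ℝ →L[ℝ] Vec n := fun x τ => ContinuousLinearMap.toSpanSingleton ℝ (F x τ)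
  have c₁ : Continuous (Function.uncurry f₁) := h.continuous_integral_fderiv hK
  have c₂ : Continuous (Function.uncurry f₂) := by
    refine (ContinuousLinearMap.toSpanSingletonCLE (𝕜 := ℝ) (E := Vec n)).continuous.comp hc
  have hd : ∀ u : Vec n × ℝ, HasStrictFDerivAt (Function.uncurry f)
      ((Function.uncurry f₁ u).coprod (Function.uncurry f₂ u)) u := fun u =>
    hasStrictFDerivAt_uncurry_coprod (f := f) (f₁ := f₁) (f₂ := f₂)
      (Eventually.of_forall fun v => h.hasFDerivAt_integral hK 0 v.2 v.1)
      (Eventually.of_forall fun v => (hasDerivAt_integral hc v.1 v.2).hasFDerivAt)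
      c₁.continuousAt c₂.continuousAt
  rw [show (fun p : Vec n × ℝ => ∫ s in (0 : ℝ)..p.2, F p.1 s) = Function.uncurry f from rfl,
    contDiff_one_iff_fderiv]
  refine ⟨fun u => (hd u).hasFDerivAt.differentiableAt, ?_⟩
  rw [show fderiv ℝ (Function.uncurry f) = _ from funext fun u => (hd u).hasFDerivAt.fderiv]
  exact c₁.continuousLinearMapCoprod c₂

end LipschitzField

lemma periodic_primitive {f : ℝ → Vec n} {T : ℝ} (hf : Continuous f) (hp : ∀ s, f (s + T) = f s)
    (h0 : ∫ s in (0 : ℝ)..T, f s = 0) (τ : ℝ) :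
    ∫ s in (0 : ℝ)..(τ + T), f s = ∫ s in (0 : ℝ)..τ, f s := by
  rw [← integral_add_adjacent_intervals (hf.intervalIntegrable 0 τ)
    (hf.intervalIntegrable τ (τ + T)),
    Function.Periodic.intervalIntegral_add_eq (show Function.Periodic f T from hp) τ 0, zero_add,
    h0, add_zero]

/-- A periodic function takes each of its values on `[0, T)`. -/
lemma exists_mem_Ico_of_periodic {X : Type*} {f : ℝ → X} {T : ℝ} (hT : 0 < T)
    (hp : ∀ s, f (s + T) = f s) (τ : ℝ) : ∃ s ∈ Ico 0 T, f τ = f s := by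
  simpa using (show Function.Periodic f T from hp).exists_mem_Ico₀ hT τ

lemma bounded_of_continuous_periodic {f : ℝ → Vec n} {T : ℝ} (hT : 0 < T) (hf : Continuous f)
    (hp : ∀ s, f (s + T) = f s) : ∃ C, ∀ s, ‖f s‖ ≤ C := by
  obtain ⟨C, hC⟩ := (isCompact_Icc (a := (0 : ℝ)) (b := T)).exists_bound_of_continuousOn
    hf.continuousOn
  refine ⟨C, fun τ => ?_⟩
  obtain ⟨s, hs, h⟩ := exists_mem_Ico_of_periodic hT hp τ
  rw [h]
  exact hC s (Ico_subset_Icc_self hs)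

end SecondOrderAveraging

namespace SecondOrderAveraging

open MeasureTheory intervalIntegral

variable {n : ℕ}

/-! ### Second-order averaging of globally regular periodic vector fields -/

/-- Integration by parts for the product of an absolutely continuous family of operators and a
`C¹` curve. -/
lemma integral_clm_parts {A : ℝ → Vec n →L[ℝ] Vec n} {f : ℝ → Vec n} {K C : ℝ}
    (hA : StronglyMeasurable A) (hK : ∀ s, ‖A s‖ ≤ K) (hf : Continuous f) (hC : ∀ s, ‖f s‖ ≤ C)
    (τ : ℝ) :
    (∫ s in (0 : ℝ)..τ, A s (∫ r in (0 : ℝ)..s, f r)) +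
      ∫ s in (0 : ℝ)..τ, (∫ r in (0 : ℝ)..s, A r) (f s) =
      (∫ r in (0 : ℝ)..τ, A r) (∫ r in (0 : ℝ)..τ, f r) := by
  have hK0 : 0 ≤ K := (norm_nonneg _).trans (hK 0)
  have hC0 : 0 ≤ C := (norm_nonneg _).trans (hC 0)
  set a : ℝ → Vec n →L[ℝ] Vec n := fun s => ∫ r in (0 : ℝ)..s, A r with ha
  set b : ℝ → Vec n := fun s => ∫ r in (0 : ℝ)..s, f r with hb
  have hAi : ∀ s t, IntervalIntegrable A volume s t := fun s t =>
    (intervalIntegrable_const (c := K)).mono_fun hA.aestronglyMeasurable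
      (ae_of_all _ fun s => (hK s).trans (Real.le_norm_self _))
  have hfi : ∀ s t, IntervalIntegrable f volume s t := fun s t => hf.intervalIntegrable s t
  have hac : Continuous a := continuous_primitive hAi 0
  have hbc : Continuous b := continuous_primitive hfi 0
  have hAb : ∀ s t, IntervalIntegrable (fun r => A r (b r)) volume s t := fun s t => by
    have h1 : Continuous fun r => K * ‖b r‖ := by fun_prop
    refine (h1.intervalIntegrable s t).mono_fun ?_ (ae_of_all _ fun r => ?_)
    · exact ((isBoundedBilinearMap_apply (𝕜 := ℝ) (E := Vec n) (F := Vec n)).continuous.comp_stronglyMeasurable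
        (hA.prodMk hbc.stronglyMeasurable)).aestronglyMeasurable
    · refine ((A r).le_opNorm _).trans (le_trans ?_ (Real.le_norm_self _))
      exact mul_le_mul_of_nonneg_right (hK r) (norm_nonneg _)
  have haf : ∀ s t, IntervalIntegrable (fun r => a r (f r)) volume s t := fun s t =>
    (hac.clm_apply hf).intervalIntegrable s t
  have hAv : ∀ s t v, IntervalIntegrable (fun r => A r v) volume s t := fun s t v =>
    ⟨(hAi s t).1.apply_continuousLinearMap v, (hAi s t).2.apply_continuousLinearMap v⟩
  have hsub_a : ∀ s t, a t - a s = ∫ r in s..t, A r := fun s t =>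
    integral_interval_sub_left (hAi _ _) (hAi _ _)
  have hsub_b : ∀ s t, b t - b s = ∫ r in s..t, f r := fun s t =>
    integral_interval_sub_left (hfi _ _) (hfi _ _)
  have hna : ∀ s t, ‖a t - a s‖ ≤ K * |t - s| := fun s t => by
    rw [hsub_a]; exact norm_integral_le_of_norm_le_const fun r _ => hK r
  have hnb : ∀ s t, ‖b t - b s‖ ≤ C * |t - s| := fun s t => by
    rw [hsub_b]; exact norm_integral_le_of_norm_le_const fun r _ => hC r
  -- The operators A are only bounded and measurable, so the product rule may fail at some times.
  -- Instead the defect J of the identity is shown to have increments of order |t - s|², hence zero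
  -- derivative everywhere.
  let J : ℝ → Vec n := fun t => a t (b t) - (∫ s in (0 : ℝ)..t, A s (b s)) -
    ∫ s in (0 : ℝ)..t, a s (f s)
  have hJ : ∀ s t, ‖J t - J s‖ ≤ (2 * K * C) * |t - s| ^ 2 := by
    intro s t
    -- Bilinearity turns the increment into integrals of A and f against increments of the
    -- primitives, so each integrand already carries a factor |t - s|.
    have h1 : J t - J s = (∫ r in s..t, A r (b t - b r)) + ∫ r in s..t, (a s - a r) (f r) := by
      have e1 : ∫ r in s..t, A r (b t - b r) = (a t - a s) (b t) - ∫ r in s..t, A r (b r) := by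
        simp only [map_sub]
        rw [integral_sub (hAv s t _) (hAb s t), hsub_a,
          ContinuousLinearMap.intervalIntegral_apply (hAi s t)]
      have e2 : ∫ r in s..t, (a s - a r) (f r) = a s (b t - b s) - ∫ r in s..t, a r (f r) := by
        simp only [sub_apply]
        rw [integral_sub _ (haf s t), hsub_b,
          ContinuousLinearMap.intervalIntegral_comp_comm _ (hfi s t)]
        exact ((a s).continuous.comp hf).intervalIntegrable s t
      have e3 : (∫ r in (0 : ℝ)..t, A r (b r)) - ∫ r in (0 : ℝ)..s, A r (b r)
          = ∫ r in s..t, A r (b r) := integral_interval_sub_left (hAb _ _) (hAb _ _)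
      have e4 : (∫ r in (0 : ℝ)..t, a r (f r)) - ∫ r in (0 : ℝ)..s, a r (f r)
          = ∫ r in s..t, a r (f r) := integral_interval_sub_left (haf _ _) (haf _ _)
      rw [e1, e2, ← e3, ← e4]
      simp only [J, sub_apply, map_sub]
      abel
    have hst : ∀ r ∈ uIoc s t, |t - r| ≤ |t - s| ∧ |s - r| ≤ |t - s| := by
      intro r hr
      rcases le_total s t with h | h
      · rw [uIoc_of_le h] at hr
        rw [abs_of_nonneg (by linarith [hr.2]), abs_of_nonneg (by linarith),
          abs_of_nonpos (by linarith [hr.1])]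
        constructor <;> linarith [hr.1, hr.2]
      · rw [uIoc_of_ge h] at hr
        rw [abs_of_nonpos (by linarith [hr.1]), abs_of_nonpos (by linarith),
          abs_of_nonneg (by linarith [hr.2])]
        constructor <;> linarith [hr.1, hr.2]
    have n1 : ‖∫ r in s..t, A r (b t - b r)‖ ≤ K * (C * |t - s|) * |t - s| := by
      refine norm_integral_le_of_norm_le_const fun r hr => ?_
      refine ((A r).le_opNorm _).trans ?_
      refine mul_le_mul (hK r) ((hnb r t).trans ?_) (norm_nonneg _) hK0
      exact mul_le_mul_of_nonneg_left (hst r hr).1 hC0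
    have n2 : ‖∫ r in s..t, (a s - a r) (f r)‖ ≤ K * |t - s| * C * |t - s| := by
      refine norm_integral_le_of_norm_le_const fun r hr => ?_
      refine ((a s - a r).le_opNorm _).trans ?_
      refine mul_le_mul ((hna r s).trans ?_) (hC r) (norm_nonneg _) (by positivity)
      exact mul_le_mul_of_nonneg_left (hst r hr).2 hK0
    rw [h1]
    refine (norm_add_le _ _).trans ((add_le_add n1 n2).trans (le_of_eq ?_))
    ring
  have hderiv : ∀ s, HasDerivAt J 0 s := fun s => by
    rw [hasDerivAt_iff_isLittleO]
    have h1 : (fun t => J t - J s - (t - s) • (0 : Vec n)) =O[𝓝 s] fun t => ‖t - s‖ ^ 2 := by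
      refine Asymptotics.IsBigO.of_bound (2 * K * C) (Eventually.of_forall fun t => ?_)
      simpa using hJ s t
    exact h1.trans_isLittleO (Asymptotics.isLittleO_pow_sub_sub s one_lt_two)
  have hconst := is_const_of_deriv_eq_zero (fun s => (hderiv s).differentiableAt)
    (fun s => (hderiv s).deriv) τ 0
  have h0 : J 0 = 0 := by simp [J, a, b]
  rw [h0] at hconst
  rw [eq_comm, ← sub_eq_zero, ← sub_sub]
  exact hconst

/-- Periodic vector fields, the first one with zero mean, with the regularity that
second-order averaging requires on the whole space. -/
structure AveragingData (F₁ F₂ : Vec n → ℝ → Vec n) (T K : ℝ) : Prop where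
  T_pos : 0 < T
  K_nonneg : 0 ≤ K
  cont₁ : Continuous (Function.uncurry F₁)
  cont₂ : Continuous (Function.uncurry F₂)
  periodic₁ : ∀ x τ, F₁ x (τ + T) = F₁ x τ
  periodic₂ : ∀ x τ, F₂ x (τ + T) = F₂ x τ
  mean_zero : ∀ x, ∫ τ in (0 : ℝ)..T, F₁ x τ = 0
  smooth₁ : ∀ τ, ContDiff ℝ 2 (fun x => F₁ x τ)
  smooth₂ : ∀ τ, ContDiff ℝ 1 (fun x => F₂ x τ)
  lip₁ : ∀ τ x y, ‖F₁ x τ - F₁ y τ‖ ≤ K * ‖x - y‖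
  lip₂ : ∀ τ x y, ‖F₂ x τ - F₂ y τ‖ ≤ K * ‖x - y‖
  lip₃ : ∀ r s x y, ‖fderiv ℝ (fun z => F₁ z r) x (F₁ x s) -
    fderiv ℝ (fun z => F₁ z r) y (F₁ y s)‖ ≤ K * ‖x - y‖

/-- The primitive `∫₀^τ F(x, s) ds`. -/
noncomputable def primitive (F : Vec n → ℝ → Vec n) (x : Vec n) (τ : ℝ) : Vec n :=
  ∫ s in (0 : ℝ)..τ, F x s

/-- `D_x (∫₀^τ F) F(x, τ)`. -/
noncomputable def selfTransport (F : Vec n → ℝ → Vec n) (x : Vec n) (τ : ℝ) : Vec n :=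
  fderiv ℝ (fun y => primitive F y τ) x (F x τ)

/-- The second-order average. -/
noncomputable def secondAverage (F₁ F₂ : Vec n → ℝ → Vec n) (T : ℝ) (x : Vec n) : Vec n :=
  T⁻¹ • ∫ s in (0 : ℝ)..T, (F₂ x s - selfTransport F₁ x s)

/-- The mean-free part of the second-order field. -/
noncomputable def secondResidual (F₁ F₂ : Vec n → ℝ → Vec n) (T : ℝ) (x : Vec n) (s : ℝ) : Vec n :=
  F₂ x s - selfTransport F₁ x s - secondAverage F₁ F₂ T x

/-! ### Regularity, periodicity and uniform Lipschitz bounds of the correctors -/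

namespace AveragingData

variable {F₁ F₂ : Vec n → ℝ → Vec n} {T K : ℝ}

lemma field₁ (h : AveragingData F₁ F₂ T K) : LipschitzField F₁ K where
  meas x := (h.cont₁.uncurry_left x).stronglyMeasurable
  smooth s := (h.smooth₁ s).of_le (by norm_num)
  lip := h.lip₁
  bdd x := bounded_of_continuous_periodic h.T_pos (h.cont₁.uncurry_left x) (h.periodic₁ x)

lemma field₂ (h : AveragingData F₁ F₂ T K) : LipschitzField F₂ K where
  meas x := (h.cont₂.uncurry_left x).stronglyMeasurable
  smooth := h.smooth₂
  lip := h.lip₂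
  bdd x := bounded_of_continuous_periodic h.T_pos (h.cont₂.uncurry_left x) (h.periodic₂ x)

/-- Freezing the second time s makes this a one-parameter field in r. It is the place where `lip₃`
and the C² regularity of F₁ are used. -/
lemma field_fderiv_apply (h : AveragingData F₁ F₂ T K) (s : ℝ) :
    LipschitzField (fun x r => fderiv ℝ (fun z => F₁ z r) x (F₁ x s)) K where
  meas x := (ContinuousLinearMap.apply ℝ (Vec n) (F₁ x s)).continuous.comp_stronglyMeasurable
    (h.field₁.stronglyMeasurable_fderiv x)
  smooth r := ((h.smooth₁ r).fderiv_right (m := 1) (by norm_num)).clm_apply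
    ((h.smooth₁ s).of_le (by norm_num))
  lip r x y := h.lip₃ r s x y
  bdd x := ⟨K * ‖F₁ x s‖, fun r => ((fderiv ℝ (fun z => F₁ z r) x).le_opNorm _).trans
    (mul_le_mul_of_nonneg_right (h.field₁.norm_fderiv_le h.K_nonneg x r) (norm_nonneg _))⟩

lemma fderiv_primitive (h : AveragingData F₁ F₂ T K) (x : Vec n) (τ : ℝ) :
    fderiv ℝ (fun y => primitive F₁ y τ) x = ∫ s in (0 : ℝ)..τ, fderiv ℝ (fun y => F₁ y s) x :=
  (h.field₁.hasFDerivAt_integral h.K_nonneg 0 τ x).fderiv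

lemma contDiff_primitive (h : AveragingData F₁ F₂ T K) :
    ContDiff ℝ 1 (Function.uncurry (primitive F₁)) :=
  h.field₁.contDiff_integral_uncurry h.K_nonneg h.cont₁

lemma hasDerivAt_primitive (h : AveragingData F₁ F₂ T K) (x : Vec n) (τ : ℝ) :
    HasDerivAt (primitive F₁ x) (F₁ x τ) τ :=
  LipschitzField.hasDerivAt_integral h.cont₁ x τ

lemma primitive_add_period (h : AveragingData F₁ F₂ T K) (x : Vec n) (τ : ℝ) :
    primitive F₁ x (τ + T) = primitive F₁ x τ :=
  periodic_primitive (h.cont₁.uncurry_left x) (h.periodic₁ x) (h.mean_zero x) τ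

/-- The Lipschitz constant of a primitive grows with the length of the interval; periodicity moves τ
back into [0, T), which makes it uniform in time. -/
lemma norm_primitive_sub_le_of_periodic {F : Vec n → ℝ → Vec n} {K : ℝ} (hK : 0 ≤ K)
    (hF : LipschitzField F K) (hT : 0 < T) (hp : ∀ x τ, primitive F x (τ + T) = primitive F x τ)
    (τ : ℝ) (x y : Vec n) : ‖primitive F x τ - primitive F y τ‖ ≤ K * T * ‖x - y‖ := by
  obtain ⟨s, hs, hτ⟩ := exists_mem_Ico_of_periodic (f := fun τ => (primitive F x τ, primitive F y τ))
    hT (fun s => by rw [hp, hp]) τ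
  obtain ⟨h1, h2⟩ := Prod.mk.injEq .. ▸ hτ
  rw [h1, h2]
  refine (hF.norm_integral_sub_le 0 s x y).trans ?_
  rw [sub_zero, abs_of_nonneg hs.1]
  gcongr
  exact hs.2.le

lemma lip_primitive (h : AveragingData F₁ F₂ T K) (τ : ℝ) (x y : Vec n) :
    ‖primitive F₁ x τ - primitive F₁ y τ‖ ≤ K * T * ‖x - y‖ :=
  norm_primitive_sub_le_of_periodic h.K_nonneg h.field₁ h.T_pos h.primitive_add_period τ x y

/-- With the derivative under the integral, regularity in x follows from that of the two-time
product D_x F₁(x, r) F₁(x, τ). No Lipschitz bound on D_x F₁ alone is needed. -/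
lemma selfTransport_eq (h : AveragingData F₁ F₂ T K) (x : Vec n) (τ : ℝ) :
    selfTransport F₁ x τ = ∫ r in (0 : ℝ)..τ, fderiv ℝ (fun z => F₁ z r) x (F₁ x τ) := by
  unfold selfTransport
  rw [h.fderiv_primitive, ContinuousLinearMap.intervalIntegral_apply
    (h.field₁.intervalIntegrable_fderiv h.K_nonneg x 0 τ)]

lemma selfTransport_add_period (h : AveragingData F₁ F₂ T K) (x : Vec n) (τ : ℝ) :
    selfTransport F₁ x (τ + T) = selfTransport F₁ x τ := by
  unfold selfTransport
  simp only [h.primitive_add_period, h.periodic₁]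

lemma continuous_selfTransport (h : AveragingData F₁ F₂ T K) :
    Continuous (Function.uncurry (selfTransport F₁)) := by
  have : Function.uncurry (selfTransport F₁) = fun p : Vec n × ℝ =>
      (∫ s in (0 : ℝ)..p.2, fderiv ℝ (fun y => F₁ y s) p.1) (F₁ p.1 p.2) := by
    funext p
    simp only [Function.uncurry, selfTransport, h.fderiv_primitive]
  rw [this]
  exact (h.field₁.continuous_integral_fderiv h.K_nonneg).clm_apply h.cont₁

lemma contDiff_selfTransport (h : AveragingData F₁ F₂ T K) (τ : ℝ) :
    ContDiff ℝ 1 fun x => selfTransport F₁ x τ := by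
  simp only [h.selfTransport_eq]
  exact (h.field_fderiv_apply τ).contDiff_integral h.K_nonneg τ

lemma lip_selfTransport (h : AveragingData F₁ F₂ T K) (τ : ℝ) (x y : Vec n) :
    ‖selfTransport F₁ x τ - selfTransport F₁ y τ‖ ≤ K * T * ‖x - y‖ := by
  obtain ⟨s, hs, hτ⟩ := exists_mem_Ico_of_periodic
    (f := fun τ => (selfTransport F₁ x τ, selfTransport F₁ y τ))
    h.T_pos (fun s => by rw [h.selfTransport_add_period, h.selfTransport_add_period]) τ
  obtain ⟨h1, h2⟩ := Prod.mk.injEq .. ▸ hτ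
  rw [h1, h2, h.selfTransport_eq, h.selfTransport_eq]
  refine ((h.field_fderiv_apply s).norm_integral_sub_le 0 s x y).trans ?_
  rw [sub_zero, abs_of_nonneg hs.1]
  have := h.K_nonneg
  gcongr
  exact hs.2.le

lemma field_sub_selfTransport (h : AveragingData F₁ F₂ T K) :
    LipschitzField (fun x s => F₂ x s - selfTransport F₁ x s) (K + K * T) where
  meas x := (h.field₂.meas x).sub (h.continuous_selfTransport.uncurry_left x).stronglyMeasurable
  smooth s := (h.smooth₂ s).sub (h.contDiff_selfTransport s)
  lip s x y := by
    rw [sub_sub_sub_comm, add_mul]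
    exact (norm_sub_le _ _).trans (add_le_add (h.lip₂ s x y) (h.lip_selfTransport s x y))
  bdd x := bounded_of_continuous_periodic h.T_pos
    ((h.cont₂.uncurry_left x).sub (h.continuous_selfTransport.uncurry_left x))
    fun s => by rw [h.periodic₂, h.selfTransport_add_period]

lemma const_nonneg (h : AveragingData F₁ F₂ T K) : 0 ≤ K + K * T :=
  add_nonneg h.K_nonneg (mul_nonneg h.K_nonneg h.T_pos.le)

lemma contDiff_secondAverage (h : AveragingData F₁ F₂ T K) :
    ContDiff ℝ 1 (secondAverage F₁ F₂ T) :=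
  (h.field_sub_selfTransport.contDiff_integral h.const_nonneg T).const_smul T⁻¹

lemma lip_secondAverage (h : AveragingData F₁ F₂ T K) (x y : Vec n) :
    ‖secondAverage F₁ F₂ T x - secondAverage F₁ F₂ T y‖ ≤ (K + K * T) * ‖x - y‖ := by
  unfold secondAverage
  rw [← smul_sub, norm_smul, norm_inv, Real.norm_of_nonneg h.T_pos.le,
    inv_mul_le_iff₀ h.T_pos]
  refine (h.field_sub_selfTransport.norm_integral_sub_le 0 T x y).trans (le_of_eq ?_)
  rw [sub_zero, abs_of_nonneg h.T_pos.le]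
  ring

lemma continuous_secondResidual (h : AveragingData F₁ F₂ T K) :
    Continuous (Function.uncurry (secondResidual F₁ F₂ T)) :=
  (h.cont₂.sub h.continuous_selfTransport).sub
    (h.contDiff_secondAverage.continuous.comp continuous_fst)

lemma secondResidual_add_period (h : AveragingData F₁ F₂ T K) (x : Vec n) (s : ℝ) :
    secondResidual F₁ F₂ T x (s + T) = secondResidual F₁ F₂ T x s := by
  unfold secondResidual
  rw [h.periodic₂, h.selfTransport_add_period]

lemma field_secondResidual (h : AveragingData F₁ F₂ T K) :
    LipschitzField (secondResidual F₁ F₂ T) (2 * (K + K * T)) where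
  meas x := (h.continuous_secondResidual.uncurry_left x).stronglyMeasurable
  smooth s := (h.field_sub_selfTransport.smooth s).sub h.contDiff_secondAverage
  lip s x y := by
    unfold secondResidual
    rw [sub_sub_sub_comm, two_mul, add_mul]
    exact (norm_sub_le _ _).trans
      (add_le_add (h.field_sub_selfTransport.lip s x y) (h.lip_secondAverage x y))
  bdd x := bounded_of_continuous_periodic h.T_pos (h.continuous_secondResidual.uncurry_left x)
    (h.secondResidual_add_period x)

lemma integral_secondResidual (h : AveragingData F₁ F₂ T K) (x : Vec n) :
    ∫ s in (0 : ℝ)..T, secondResidual F₁ F₂ T x s = 0 := by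
  unfold secondResidual
  rw [integral_sub (h.field_sub_selfTransport.intervalIntegrable x 0 T) intervalIntegrable_const]
  unfold secondAverage
  rw [intervalIntegral.integral_const, sub_zero, smul_smul, mul_inv_cancel₀ h.T_pos.ne', one_smul, sub_self]

lemma primitive_secondResidual_add_period (h : AveragingData F₁ F₂ T K) (x : Vec n) (τ : ℝ) :
    primitive (secondResidual F₁ F₂ T) x (τ + T) = primitive (secondResidual F₁ F₂ T) x τ :=
  periodic_primitive (h.continuous_secondResidual.uncurry_left x) (h.secondResidual_add_period x)
    (h.integral_secondResidual x) τ

lemma contDiff_primitive_secondResidual (h : AveragingData F₁ F₂ T K) :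
    ContDiff ℝ 1 (Function.uncurry (primitive (secondResidual F₁ F₂ T))) :=
  h.field_secondResidual.contDiff_integral_uncurry (mul_nonneg zero_le_two h.const_nonneg)
    h.continuous_secondResidual

lemma hasDerivAt_primitive_secondResidual (h : AveragingData F₁ F₂ T K) (x : Vec n) (τ : ℝ) :
    HasDerivAt (primitive (secondResidual F₁ F₂ T) x) (secondResidual F₁ F₂ T x τ) τ :=
  LipschitzField.hasDerivAt_integral h.continuous_secondResidual x τ

lemma lip_primitive_secondResidual (h : AveragingData F₁ F₂ T K) (τ : ℝ) (x y : Vec n) :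
    ‖primitive (secondResidual F₁ F₂ T) x τ - primitive (secondResidual F₁ F₂ T) y τ‖
      ≤ 2 * (K + K * T) * T * ‖x - y‖ :=
  norm_primitive_sub_le_of_periodic (mul_nonneg zero_le_two h.const_nonneg) h.field_secondResidual
    h.T_pos h.primitive_secondResidual_add_period τ x y

lemma intervalIntegrable_fderiv_primitive (h : AveragingData F₁ F₂ T K) (x : Vec n) (a b : ℝ) :
    IntervalIntegrable (fun s => fderiv ℝ (fun z => F₁ z s) x (primitive F₁ x s)) volume a b := by
  have hc : Continuous (primitive F₁ x) := h.contDiff_primitive.continuous.uncurry_left x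
  have h1 : Continuous fun s => K * ‖primitive F₁ x s‖ := by fun_prop
  refine (h1.intervalIntegrable a b).mono_fun ?_ (ae_of_all _ fun s => ?_)
  · exact ((isBoundedBilinearMap_apply (𝕜 := ℝ) (E := Vec n) (F := Vec n)).continuous.comp_stronglyMeasurable
      ((h.field₁.stronglyMeasurable_fderiv x).prodMk hc.stronglyMeasurable)).aestronglyMeasurable
  · refine ((fderiv ℝ (fun z => F₁ z s) x).le_opNorm _).trans (le_trans ?_ (Real.le_norm_self _))
    exact mul_le_mul_of_nonneg_right (h.field₁.norm_fderiv_le h.K_nonneg x s) (norm_nonneg _)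

/-- Trades D_x F₁ applied to the primitive for the self-transport term. Both the bracket form of the
average and the original form of v₂ reduce to this identity. -/
lemma integral_fderiv_primitive (h : AveragingData F₁ F₂ T K) (x : Vec n) (τ : ℝ) :
    ∫ s in (0 : ℝ)..τ, fderiv ℝ (fun z => F₁ z s) x (primitive F₁ x s) =
      fderiv ℝ (fun y => primitive F₁ y τ) x (primitive F₁ x τ) -
        ∫ s in (0 : ℝ)..τ, selfTransport F₁ x s := by
  obtain ⟨C, hC⟩ := h.field₁.bdd x
  have := integral_clm_parts (h.field₁.stronglyMeasurable_fderiv x)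
    (h.field₁.norm_fderiv_le h.K_nonneg x) (h.cont₁.uncurry_left x) hC τ
  simp only [selfTransport, h.fderiv_primitive]
  exact eq_sub_of_add_eq this

/-- The second-order average in terms of the Lie bracket. -/
lemma secondAverage_eq (h : AveragingData F₁ F₂ T K) (x : Vec n) :
    secondAverage F₁ F₂ T x = (2 * T)⁻¹ • ∫ s in (0 : ℝ)..T, ((2 : ℝ) • F₂ x s +
      VectorField.lieBracket ℝ (fun y => primitive F₁ y s) (fun y => F₁ y s) x) := by
  have hz : primitive F₁ x T = 0 := h.mean_zero x
  have i1 := h.field₂.intervalIntegrable x 0 T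
  have i2 := h.intervalIntegrable_fderiv_primitive x 0 T
  have i3 := (h.continuous_selfTransport.uncurry_left x).intervalIntegrable (μ := volume) 0 T
  -- Over a full period the boundary term vanishes, so the two halves of the bracket contribute
  -- equally and the factor 1/(2T) becomes 1/T.
  have h1 := h.integral_fderiv_primitive x T
  rw [hz, map_zero, zero_sub] at h1
  have h2 : ∫ s in (0 : ℝ)..T, ((2 : ℝ) • F₂ x s +
      VectorField.lieBracket ℝ (fun y => primitive F₁ y s) (fun y => F₁ y s) x) =
      (2 : ℝ) • ((∫ s in (0 : ℝ)..T, F₂ x s) - ∫ s in (0 : ℝ)..T, selfTransport F₁ x s) := by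
    simp only [VectorField.lieBracket]
    change ∫ s in (0 : ℝ)..T, ((2 : ℝ) • F₂ x s +
      (fderiv ℝ (fun z => F₁ z s) x (primitive F₁ x s) - selfTransport F₁ x s)) = _
    have i4 : IntervalIntegrable (fun s => (2 : ℝ) • F₂ x s) volume 0 T := i1.smul (2 : ℝ)
    rw [integral_add i4 (i2.sub i3), integral_sub i2 i3, h1, intervalIntegral.integral_smul]
    module
  rw [h2, smul_smul, secondAverage, integral_sub i1 i3]
  congr 1
  have := h.T_pos.ne'
  field_simp

/-- The second corrector in terms of `D_x F₁` and the primitive of `F₁`. -/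
lemma primitive_secondResidual_eq (h : AveragingData F₁ F₂ T K) (x : Vec n) (τ : ℝ) :
    primitive (secondResidual F₁ F₂ T) x τ =
      (∫ s in (0 : ℝ)..τ, (F₂ x s + fderiv ℝ (fun z => F₁ z s) x (primitive F₁ x s) -
        secondAverage F₁ F₂ T x)) - fderiv ℝ (fun y => primitive F₁ y τ) x (primitive F₁ x τ) := by
  have i1 := h.field₂.intervalIntegrable x 0 τ
  have i2 := h.intervalIntegrable_fderiv_primitive x 0 τ
  have i3 := (h.continuous_selfTransport.uncurry_left x).intervalIntegrable (μ := volume) 0 τ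
  have h1 := h.integral_fderiv_primitive x τ
  rw [integral_sub (i1.add i2) intervalIntegrable_const, integral_add i1 i2, h1]
  simp only [primitive, secondResidual]
  rw [integral_sub (i1.sub i3) intervalIntegrable_const]
  erw [integral_sub i1 i3]
  abel

end AveragingData

end SecondOrderAveraging

namespace SecondOrderAveraging

open MeasureTheory intervalIntegral

variable {n : ℕ}

/-! ### Periodic extension to negative times -/

/-- The extension to all times of a function that is `T`-periodic on `[0, ∞)`. -/
noncomputable def periodicExtension (T : ℝ) (f : Vec n → ℝ → Vec n) (x : Vec n) (τ : ℝ) : Vec n :=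
  f x (τ + (⌈|τ| / T⌉₊ : ℝ) * T)

section PeriodicExtension

variable {T : ℝ} {f : Vec n → ℝ → Vec n}

lemma apply_add_nat_mul (hT : 0 < T) (hp : ∀ x τ, 0 ≤ τ → f x (τ + T) = f x τ) (x : Vec n)
    {τ : ℝ} (hτ : 0 ≤ τ) (k : ℕ) : f x (τ + k * T) = f x τ := by
  induction k with
  | zero => simp
  | succ k ih =>
    rw [← ih, ← hp x (τ + k * T) (by positivity)]
    congr 1; push_cast; ring

lemma nonneg_add_ceil_mul (hT : 0 < T) (τ : ℝ) : 0 ≤ τ + (⌈|τ| / T⌉₊ : ℝ) * T := by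
  have h1 : |τ| ≤ (⌈|τ| / T⌉₊ : ℝ) * T := (div_le_iff₀ hT).1 (Nat.le_ceil _)
  linarith [neg_abs_le τ]

/-- The ceiling in the definition jumps with τ. Since every admissible shift gives the same value, a
shift that is constant near a given time may be used, and continuity follows. -/
lemma periodicExtension_eq (hT : 0 < T) (hp : ∀ x τ, 0 ≤ τ → f x (τ + T) = f x τ) (x : Vec n)
    {τ : ℝ} {k : ℕ} (hk : 0 ≤ τ + k * T) : periodicExtension T f x τ = f x (τ + k * T) := by
  unfold periodicExtension
  have h0 := nonneg_add_ceil_mul hT τ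
  set m := ⌈|τ| / T⌉₊
  rcases le_total k m with h | h
  · obtain ⟨d, hd⟩ := Nat.exists_eq_add_of_le h
    rw [← apply_add_nat_mul hT hp x hk d, hd]
    congr 1; push_cast; ring
  · obtain ⟨d, hd⟩ := Nat.exists_eq_add_of_le h
    rw [← apply_add_nat_mul hT hp x h0 d, hd]
    congr 1; push_cast; ring

lemma periodicExtension_of_nonneg (hT : 0 < T) (hp : ∀ x τ, 0 ≤ τ → f x (τ + T) = f x τ)
    (x : Vec n) {τ : ℝ} (hτ : 0 ≤ τ) : periodicExtension T f x τ = f x τ := by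
  have := periodicExtension_eq hT hp x (τ := τ) (k := 0) (by simpa using hτ)
  simpa using this

lemma periodicExtension_add_period (hT : 0 < T) (hp : ∀ x τ, 0 ≤ τ → f x (τ + T) = f x τ)
    (x : Vec n) (τ : ℝ) : periodicExtension T f x (τ + T) = periodicExtension T f x τ := by
  have h0 := nonneg_add_ceil_mul hT τ
  rw [periodicExtension_eq hT hp x (τ := τ + T) (k := ⌈|τ| / T⌉₊) (by linarith)]
  unfold periodicExtension
  rw [← hp x _ h0]
  congr 1; ring

lemma exists_periodicExtension_eq (hT : 0 < T) (f : Vec n → ℝ → Vec n) (τ : ℝ) :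
    ∃ s, 0 ≤ s ∧ ∀ x, periodicExtension T f x τ = f x s :=
  ⟨_, nonneg_add_ceil_mul hT τ, fun _ => rfl⟩

lemma continuous_periodicExtension (hT : 0 < T) (hp : ∀ x τ, 0 ≤ τ → f x (τ + T) = f x τ)
    (hf : ContinuousOn (fun p : Vec n × ℝ => f p.1 p.2) (halfSpace n)) :
    Continuous (Function.uncurry (periodicExtension T f)) := by
  rw [continuous_iff_continuousAt]
  rintro ⟨x, τ⟩
  obtain ⟨k, hk⟩ := exists_nat_gt (-τ / T)
  have hk' : 0 < τ + k * T := by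
    rw [div_lt_iff₀ hT] at hk; linarith
  have hopen : ∀ᶠ p : Vec n × ℝ in 𝓝 (x, τ), 0 < p.2 + k * T :=
    (by fun_prop : Continuous fun p : Vec n × ℝ => p.2 + k * T).continuousAt.eventually
      (lt_mem_nhds hk')
  have hc : ContinuousAt (fun p : Vec n × ℝ => f p.1 (p.2 + k * T)) (x, τ) := by
    have h1 : ContinuousAt (fun p : Vec n × ℝ => f p.1 p.2) (x, τ + k * T) := by
      refine hf.continuousAt ?_
      exact prod_mem_nhds univ_mem (Ici_mem_nhds hk')
    have h2 : ContinuousAt (fun p : Vec n × ℝ => (p.1, p.2 + k * T)) (x, τ) := by fun_prop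
    exact ContinuousAt.comp (f := fun p : Vec n × ℝ => (p.1, p.2 + k * T))
      (g := fun p : Vec n × ℝ => f p.1 p.2) h1 h2
  refine hc.congr ?_
  filter_upwards [hopen] with p hp'
  exact (periodicExtension_eq hT hp p.1 hp'.le).symm

lemma bounded_on_ball (hT : 0 < T) (hp : ∀ x τ, 0 ≤ τ → f x (τ + T) = f x τ)
    (hf : ContinuousOn (fun p : Vec n × ℝ => f p.1 p.2) (halfSpace n)) (R : ℝ) :
    ∃ M, 0 ≤ M ∧ ∀ x τ, 0 ≤ τ → ‖x‖ ≤ R → ‖f x τ‖ ≤ M := by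
  have hc := continuous_periodicExtension hT hp hf
  obtain ⟨C, hC⟩ := ((isCompact_closedBall (0 : Vec n) R).prod
    (isCompact_Icc (a := (0 : ℝ)) (b := T))).exists_bound_of_continuousOn hc.continuousOn
  refine ⟨max C 0, le_max_right _ _, fun x τ hτ hx => le_max_of_le_left ?_⟩
  obtain ⟨s, hs, h⟩ := exists_mem_Ico_of_periodic hT (periodicExtension_add_period hT hp x) τ
  rw [← periodicExtension_of_nonneg hT hp x hτ, h]
  exact hC (x, s) ⟨by simpa using hx, Ico_subset_Icc_self hs⟩

end PeriodicExtension

/-! ### Lipschitz estimates -/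

section Lipschitz

variable {E₀ E₁ E₂ : Type*} [NormedAddCommGroup E₀] [NormedSpace ℝ E₀] [NormedAddCommGroup E₁]
  [NormedSpace ℝ E₁] [NormedAddCommGroup E₂] [NormedSpace ℝ E₂]

/-- The factor g may be unbounded, so the usual product estimate fails. But A is constant outside
the ball of radius R: if either point lies in the ball, g can be evaluated there, and if both lie
outside, the difference of the values of A vanishes. -/
lemma lipschitz_bilinear {S : Set (Vec n)} (L : E₀ →L[ℝ] E₁ →L[ℝ] E₂)
    (hL : ∀ u v, ‖L u v‖ ≤ ‖u‖ * ‖v‖) {A : Vec n → E₀} {A' : E₀} {g : Vec n → E₁} {a c l M R : ℝ}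
    (ha0 : 0 ≤ a) (hc0 : 0 ≤ c) (hM0 : 0 ≤ M) (ha : ∀ x ∈ S, ‖A x‖ ≤ a)
    (hA : ∀ x ∈ S, ∀ y ∈ S, ‖A x - A y‖ ≤ c * ‖x - y‖) (hA' : ∀ x ∈ S, R < ‖x‖ → A x = A')
    (hg : ∀ x ∈ S, ∀ y ∈ S, ‖g x - g y‖ ≤ l * ‖x - y‖) (hM : ∀ x ∈ S, ‖x‖ ≤ R → ‖g x‖ ≤ M) :
    ∀ x ∈ S, ∀ y ∈ S, ‖L (A x) (g x) - L (A y) (g y)‖ ≤ (a * l + c * M) * ‖x - y‖ := by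
  have key : ∀ x ∈ S, ∀ y ∈ S, ‖y‖ ≤ R →
      ‖L (A x) (g x) - L (A y) (g y)‖ ≤ (a * l + c * M) * ‖x - y‖ := by
    intro x hx y hy hyR
    have e : L (A x) (g x) - L (A y) (g y) = L (A x) (g x - g y) + L (A x - A y) (g y) := by
      simp
    rw [e]
    refine (norm_add_le _ _).trans ?_
    have h1 : ‖L (A x) (g x - g y)‖ ≤ a * (l * ‖x - y‖) :=
      (hL _ _).trans (mul_le_mul (ha x hx) (hg x hx y hy) (norm_nonneg _) ha0)
    have h2 : ‖L (A x - A y) (g y)‖ ≤ (c * ‖x - y‖) * M :=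
      (hL _ _).trans (mul_le_mul (hA x hx y hy) (hM y hy hyR) (norm_nonneg _)
        (mul_nonneg hc0 (norm_nonneg _)))
    linarith
  intro x hx y hy
  rcases le_or_gt ‖y‖ R with hyR | hyR
  · exact key x hx y hy hyR
  rcases le_or_gt ‖x‖ R with hxR | hxR
  · rw [norm_sub_rev, norm_sub_rev x y]
    exact key y hy x hx hxR
  · rw [hA' y hy hyR, ← hA' x hx hxR, ← map_sub]
    refine (hL _ _).trans ((mul_le_mul (ha x hx) (hg x hx y hy) (norm_nonneg _) ha0).trans ?_)
    have := mul_nonneg (mul_nonneg hc0 hM0) (norm_nonneg (x - y))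
    linarith

/-- A segment leaving the ball crosses the sphere of radius δ at a point where f vanishes, as it
does at the inner endpoint, and that point is no farther from the outer endpoint. -/
lemma lipschitz_of_outer {f : Vec n → Vec n} {δ K : ℝ} (hK : 0 ≤ K)
    (hzero : 0 < δ → ∀ x, ‖x‖ ≤ δ → f x = 0)
    (hf : ∀ x ∈ outer n δ, ∀ y ∈ outer n δ, ‖f x - f y‖ ≤ K * ‖x - y‖) (x y : Vec n) :
    ‖f x - f y‖ ≤ K * ‖x - y‖ := by
  have key : ∀ x y : Vec n, ‖x‖ < δ → δ ≤ ‖y‖ → ‖f x - f y‖ ≤ K * ‖x - y‖ := by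
    intro x y hx hy
    have hδ : 0 < δ := (norm_nonneg _).trans_lt hx
    have hc : ContinuousOn (fun t : ℝ => ‖x + t • (y - x)‖) (Icc 0 1) := by fun_prop
    obtain ⟨t, ht, hts⟩ := intermediate_value_Icc zero_le_one hc
      (show δ ∈ Icc _ _ by simpa using ⟨hx.le, hy⟩)
    simp only at hts
    have hz : f (x + t • (y - x)) = f x := by
      rw [hzero hδ _ hts.le, hzero hδ _ hx.le]
    rw [← hz]
    refine (hf _ hts.ge _ hy).trans (mul_le_mul_of_nonneg_left ?_ hK)
    have e : x + t • (y - x) - y = (1 - t) • (x - y) := by module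
    rw [e, norm_smul, Real.norm_of_nonneg (by linarith [ht.2])]
    nlinarith [norm_nonneg (x - y), ht.1]
  rcases lt_or_ge ‖x‖ δ with hx | hx <;> rcases lt_or_ge ‖y‖ δ with hy | hy
  · have hδ : 0 < δ := (norm_nonneg _).trans_lt hx
    rw [hzero hδ x hx.le, hzero hδ y hy.le, sub_self, norm_zero]
    positivity
  · exact key x y hx hy
  · rw [norm_sub_rev, norm_sub_rev x y]
    exact key y x hy hx
  · exact hf x hx y hy

/-- At boundary points the Lipschitz bound is available only in directions that do not enter the
ball. If ⟨x, v⟩ ≥ 0 then x + v/c stays outside, and one of v, -v has this property. -/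
lemma norm_fderiv_le_of_outer {f : Vec n → Vec n} {δ L : ℝ} (hL : 0 ≤ L)
    (hf : ∀ x ∈ outer n δ, ∀ y ∈ outer n δ, ‖f x - f y‖ ≤ L * ‖x - y‖) {x : Vec n}
    (hx : x ∈ outer n δ) (hd : DifferentiableAt ℝ f x) : ‖fderiv ℝ f x‖ ≤ L := by
  have key : ∀ v : Vec n, 0 ≤ inner ℝ x v → ‖fderiv ℝ f x v‖ ≤ L * ‖v‖ := by
    intro v hv
    refine le_of_tendsto (hd.hasFDerivAt.lim_real v).norm ?_
    filter_upwards [eventually_gt_atTop 0] with c hc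
    have hmem : x + c⁻¹ • v ∈ outer n δ := by
      have h1 : ‖x‖ ^ 2 ≤ ‖x + c⁻¹ • v‖ ^ 2 := by
        rw [norm_add_sq_real, inner_smul_right]
        have : 0 ≤ c⁻¹ * inner ℝ x v := mul_nonneg (inv_nonneg.2 hc.le) hv
        nlinarith [sq_nonneg ‖c⁻¹ • v‖]
      exact le_trans hx ((pow_le_pow_iff_left₀ (norm_nonneg _) (norm_nonneg _) two_ne_zero).1 h1)
    rw [norm_smul, Real.norm_of_nonneg hc.le]
    have h2 := hf _ hmem x hx
    rw [add_sub_cancel_left, norm_smul, norm_inv, Real.norm_of_nonneg hc.le] at h2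
    calc c * ‖f (x + c⁻¹ • v) - f x‖ ≤ c * (L * (c⁻¹ * ‖v‖)) :=
          mul_le_mul_of_nonneg_left h2 hc.le
      _ = L * ‖v‖ := by field_simp
  refine ContinuousLinearMap.opNorm_le_bound _ hL fun v => ?_
  rcases le_total 0 (inner ℝ x v) with h | h
  · exact key v h
  · have := key (-v) (by rw [inner_neg_right]; linarith)
    rwa [map_neg, norm_neg, norm_neg] at this

lemma bounded_lipschitz_of_eventually_const {G : Vec n → E₁} {G' : E₁} {R : ℝ}
    (hG : ContDiff ℝ 1 G) (hG' : ∀ x, R < ‖x‖ → G x = G') :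
    ∃ C, 0 ≤ C ∧ (∀ x, ‖G x‖ ≤ C) ∧ ∀ x y, ‖G x - G y‖ ≤ C * ‖x - y‖ := by
  obtain ⟨C₁, hC₁⟩ := (isCompact_closedBall (0 : Vec n) R).exists_bound_of_continuousOn
    hG.continuous.continuousOn
  obtain ⟨C₂, hC₂⟩ := (isCompact_closedBall (0 : Vec n) R).exists_bound_of_continuousOn
    (hG.continuous_fderiv (by simp)).continuousOn
  have hopen : IsOpen {x : Vec n | R < ‖x‖} := isOpen_lt continuous_const continuous_norm
  set C := max (max C₁ ‖G'‖) (max C₂ 0) with hC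
  have hC0 : 0 ≤ C := le_max_of_le_right (le_max_right _ _)
  have hfd : ∀ x, ‖fderiv ℝ G x‖ ≤ C := by
    intro x
    rcases le_or_gt ‖x‖ R with h | h
    · exact (hC₂ x (by simpa using h)).trans (le_max_of_le_right (le_max_left _ _))
    · have : G =ᶠ[𝓝 x] fun _ => G' := by
        filter_upwards [hopen.mem_nhds h] with y hy using hG' y hy
      rw [this.fderiv_eq]
      simpa using hC0
  refine ⟨C, hC0, fun x => ?_, fun x y => ?_⟩
  · rcases le_or_gt ‖x‖ R with h | h
    · exact (hC₁ x (by simpa using h)).trans (le_max_of_le_left (le_max_left _ _))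
    · rw [hG' x h]
      exact le_max_of_le_left (le_max_right _ _)
  · exact convex_univ.norm_image_sub_le_of_norm_fderiv_le
      (fun z _ => (hG.differentiable (by simp)) z) (fun z _ => hfd z) (mem_univ y) (mem_univ x)

end Lipschitz

/-! ### Regularity of the truncated vector fields -/

/-- This dichotomy is all that the proof needs from admissibility: either the bump vanishes on the
inner ball, or the regularity hypotheses already hold on the whole space. -/
lemma DeltaCondition.lt_or_eq {η δ₁ δ₂ δ₃ : ℝ} (h : DeltaCondition η δ₁ δ₂ δ₃) :
    δ₁ < δ₂ ∨ δ₁ = 0 := by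
  rcases h.δ₁_nonneg.eq_or_lt with h0 | h0
  · exact Or.inr h0.symm
  · left
    have := h.δ₁_δ₂
    nlinarith [mul_pos h.η_pos h0]

section Truncation

variable {δ₁ δ₂ : ℝ} {f : Vec n → ℝ → Vec n}

lemma contDiff_fHat (hδ₁ : 0 ≤ δ₁) (hδ : δ₁ < δ₂ ∨ δ₁ = 0) {k : ℕ} (hk : k ≤ 2)
    (hf : ContDiffInX k f (outer n δ₁)) {τ : ℝ} (hτ : 0 ≤ τ) :
    ContDiff ℝ k fun x => fHat δ₁ δ₂ f x τ := by
  obtain ⟨U, hU, hsub, hfU⟩ := hf τ hτ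
  rw [contDiff_iff_contDiffAt]
  intro x
  rcases lt_or_ge ‖x‖ δ₁ with hx | hx
  · have hlt : δ₁ < δ₂ := hδ.resolve_right ((norm_nonneg _).trans_lt hx).ne'
    refine (contDiffAt_const (c := (0 : Vec n))).congr_of_eventuallyEq ?_
    filter_upwards [(isOpen_lt continuous_norm continuous_const).mem_nhds hx] with y hy
    have hy' : ‖y‖ < δ₁ := hy
    simp [fHat, bump_eq_zero hlt hy'.le]
  · have hb : ContDiff ℝ k (bump (n := n) δ₁ δ₂) :=
      (contDiff_bump hδ₁).of_le (by exact_mod_cast hk)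
    exact hb.contDiffAt.smul (hfU.contDiffAt (hU.mem_nhds (hsub hx)))

lemma fHat_eq_zero (hδ : δ₁ < δ₂ ∨ δ₁ = 0) (h0 : 0 < δ₁) {x : Vec n} (hx : ‖x‖ ≤ δ₁) (τ : ℝ) :
    fHat δ₁ δ₂ f x τ = 0 := by
  simp [fHat, bump_eq_zero (hδ.resolve_right h0.ne') hx]

lemma exists_lipschitz_fHat {T : ℝ} (hT : 0 < T) (hδ₁ : 0 ≤ δ₁) (hδ : δ₁ < δ₂ ∨ δ₁ = 0)
    (hp : ∀ x τ, 0 ≤ τ → f x (τ + T) = f x τ)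
    (hf : ContinuousOn (fun p : Vec n × ℝ => f p.1 p.2) (halfSpace n))
    (hlip : ∃ L : ℝ, 0 < L ∧ ∀ x₁ ∈ outer n δ₁, ∀ x₂ ∈ outer n δ₁, ∀ τ, 0 ≤ τ →
      ‖f x₁ τ - f x₂ τ‖ ≤ L * ‖x₁ - x₂‖) :
    ∃ K, 0 ≤ K ∧ ∀ τ, 0 ≤ τ → ∀ x y, ‖fHat δ₁ δ₂ f x τ - fHat δ₁ δ₂ f y τ‖ ≤ K * ‖x - y‖ := by
  obtain ⟨L, hL, hLip⟩ := hlip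
  obtain ⟨M, hM0, hM⟩ := bounded_on_ball hT hp hf δ₂
  obtain ⟨C, hC0, hC, hC'⟩ := bounded_lipschitz_of_eventually_const
    ((contDiff_bump (n := n) (δ₂ := δ₂) hδ₁).of_le one_le_two)
    (fun x hx => bump_eq_one (δ₁ := δ₁) (δ₂ := δ₂) (x := x) hx.le)
  have hK : 0 ≤ C * L + C * M := by positivity
  refine ⟨C * L + C * M, hK, fun τ hτ => lipschitz_of_outer hK
    (fun h0 x hx => fHat_eq_zero hδ h0 hx τ) ?_⟩
  exact lipschitz_bilinear (ContinuousLinearMap.lsmul ℝ ℝ) (fun u v => by simp [norm_smul]) hC0 hC0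
    hM0 (fun x _ => hC x) (fun x _ y _ => hC' x y) (fun x _ hx => bump_eq_one hx.le)
    (fun x hx y hy => hLip x hx y hy τ hτ) (fun x _ hx => hM x τ hτ hx)

/-- With φ the bump, the product rule gives φ² D_x f(x, r) f(x, s) + (φ Dφ f(x, s)) f(x, r). The
first product is controlled by the hypothesis on D_x f f, as φ² = 1 far out; in the second, φ Dφ
vanishes beyond δ₂, so the growth of f does no harm. -/
lemma exists_lipschitz_fderiv_fHat {T : ℝ} (hT : 0 < T) (hδ₁ : 0 ≤ δ₁) (hδ : δ₁ < δ₂ ∨ δ₁ = 0)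
    (hp : ∀ x τ, 0 ≤ τ → f x (τ + T) = f x τ)
    (hf : ContinuousOn (fun p : Vec n × ℝ => f p.1 p.2) (halfSpace n))
    (hsm : ContDiffInX 2 f (outer n δ₁))
    (hlip : ∃ L : ℝ, 0 < L ∧ ∀ x₁ ∈ outer n δ₁, ∀ x₂ ∈ outer n δ₁, ∀ τ, 0 ≤ τ →
      ‖f x₁ τ - f x₂ τ‖ ≤ L * ‖x₁ - x₂‖)
    (hlip' : ∃ L : ℝ, 0 < L ∧ ∀ x₁ ∈ outer n δ₁, ∀ x₂ ∈ outer n δ₁,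
      ∀ τ₁, 0 ≤ τ₁ → ∀ τ₂, 0 ≤ τ₂ →
      ‖fderiv ℝ (fun y => f y τ₁) x₁ (f x₁ τ₂) - fderiv ℝ (fun y => f y τ₁) x₂ (f x₂ τ₂)‖
        ≤ L * ‖x₁ - x₂‖) :
    ∃ K, 0 ≤ K ∧ ∀ r, 0 ≤ r → ∀ s, 0 ≤ s → ∀ x y,
      ‖fderiv ℝ (fun z => fHat δ₁ δ₂ f z r) x (fHat δ₁ δ₂ f x s) -
        fderiv ℝ (fun z => fHat δ₁ δ₂ f z r) y (fHat δ₁ δ₂ f y s)‖ ≤ K * ‖x - y‖ := by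
  obtain ⟨L, hL, hLip⟩ := hlip
  obtain ⟨L', hL', hLip'⟩ := hlip'
  obtain ⟨M, hM0, hM⟩ := bounded_on_ball hT hp hf δ₂
  have hb : ContDiff ℝ 2 (bump (n := n) δ₁ δ₂) := contDiff_bump hδ₁
  have hb1 : ContDiff ℝ 1 (bump (n := n) δ₁ δ₂) := hb.of_le one_le_two
  have hfb : ContDiff ℝ 1 (fderiv ℝ (bump (n := n) δ₁ δ₂)) :=
    hb.fderiv_right (m := 1) (by norm_num)
  have hopen : IsOpen {x : Vec n | δ₂ < ‖x‖} := isOpen_lt continuous_const continuous_norm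
  obtain ⟨C, hC0, hC, hC'⟩ := bounded_lipschitz_of_eventually_const (hb1.mul hb1) (R := δ₂)
    (G' := (1 : ℝ)) (fun x hx => by rw [bump_eq_one hx.le, mul_one])
  have hB' : ∀ x : Vec n, δ₂ < ‖x‖ →
      bump δ₁ δ₂ x • fderiv ℝ (bump (n := n) δ₁ δ₂) x = 0 := by
    intro x hx
    have : bump (n := n) δ₁ δ₂ =ᶠ[𝓝 x] fun _ => 1 := by
      filter_upwards [hopen.mem_nhds hx] with y hy using bump_eq_one (le_of_lt hy)
    rw [this.fderiv_eq]; simp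
  obtain ⟨B, hB0, hB, hBlip⟩ := bounded_lipschitz_of_eventually_const (hb1.smul hfb) hB'
  set K₂ := B * L + B * M with hK₂
  have hK₂0 : 0 ≤ K₂ := by positivity
  have hK : 0 ≤ (C * L' + C * (L * M)) + ((B * M) * L + K₂ * M) := by positivity
  refine ⟨(C * L' + C * (L * M)) + ((B * M) * L + K₂ * M), hK, fun r hr s hs => ?_⟩
  obtain ⟨U, hU, hsub, hfU⟩ := hsm r hr
  have hdf : ∀ x ∈ outer n δ₁, DifferentiableAt ℝ (fun z => f z r) x := fun x hx =>
    (hfU.contDiffAt (hU.mem_nhds (hsub hx))).differentiableAt (by simp)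
  have hform : ∀ x ∈ outer n δ₁,
      fderiv ℝ (fun z => fHat δ₁ δ₂ f z r) x (fHat δ₁ δ₂ f x s) =
        (bump δ₁ δ₂ x * bump δ₁ δ₂ x) • fderiv ℝ (fun z => f z r) x (f x s) +
          ((bump δ₁ δ₂ x • fderiv ℝ (bump (n := n) δ₁ δ₂) x) (f x s)) • f x r := by
    intro x hx
    have h1 : HasFDerivAt (fun z => fHat δ₁ δ₂ f z r) _ x :=
      ((hb1.differentiable (by simp)) x).hasFDerivAt.smul (hdf x hx).hasFDerivAt
    rw [h1.fderiv]
    simp [fHat, mul_smul]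
  have t1 : ∀ x ∈ outer n δ₁, ∀ y ∈ outer n δ₁,
      ‖(bump δ₁ δ₂ x * bump δ₁ δ₂ x) • fderiv ℝ (fun z => f z r) x (f x s) -
        (bump δ₁ δ₂ y * bump δ₁ δ₂ y) • fderiv ℝ (fun z => f z r) y (f y s)‖ ≤
        (C * L' + C * (L * M)) * ‖x - y‖ :=
    lipschitz_bilinear (ContinuousLinearMap.lsmul ℝ ℝ) (fun u v => by simp [norm_smul]) hC0 hC0
      (by positivity) (fun x _ => hC x) (fun x _ y _ => hC' x y)
      (fun x _ hx => by rw [bump_eq_one hx.le, mul_one])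
      (fun x hx y hy => hLip' x hx y hy r hr s hs)
      (fun x hx hxR => ((fderiv ℝ (fun z => f z r) x).le_opNorm _).trans
        (mul_le_mul (norm_fderiv_le_of_outer hL.le (fun x hx y hy => hLip x hx y hy r hr) hx
          (hdf x hx)) (hM x s hs hxR) (norm_nonneg _) hL.le))
  have t2 : ∀ x ∈ outer n δ₁, ∀ y ∈ outer n δ₁,
      ‖(bump δ₁ δ₂ x • fderiv ℝ (bump (n := n) δ₁ δ₂) x) (f x s) -
        (bump δ₁ δ₂ y • fderiv ℝ (bump (n := n) δ₁ δ₂) y) (f y s)‖ ≤ K₂ * ‖x - y‖ :=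
    lipschitz_bilinear (ContinuousLinearMap.id ℝ (Vec n →L[ℝ] ℝ)) (fun u v => u.le_opNorm v) hB0
      hB0 hM0 (fun x _ => hB x) (fun x _ y _ => hBlip x y) (fun x _ hx => hB' x hx)
      (fun x hx y hy => hLip x hx y hy s hs) (fun x _ hx => hM x s hs hx)
  have t3 : ∀ x ∈ outer n δ₁, ∀ y ∈ outer n δ₁,
      ‖((bump δ₁ δ₂ x • fderiv ℝ (bump (n := n) δ₁ δ₂) x) (f x s)) • f x r -
        ((bump δ₁ δ₂ y • fderiv ℝ (bump (n := n) δ₁ δ₂) y) (f y s)) • f y r‖ ≤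
        ((B * M) * L + K₂ * M) * ‖x - y‖ :=
    lipschitz_bilinear (A' := 0) (R := δ₂) (ContinuousLinearMap.lsmul ℝ ℝ)
      (fun u v => by simp [norm_smul]) (by positivity) hK₂0 hM0
      (fun x _ => by
        rcases le_or_gt ‖x‖ δ₂ with h | h
        · exact (ContinuousLinearMap.le_opNorm _ _).trans
            (mul_le_mul (hB x) (hM x s hs h) (norm_nonneg _) hB0)
        · rw [hB' x h]; simp; positivity)
      t2 (fun x _ hx => by rw [hB' x hx]; simp)
      (fun x hx y hy => hLip x hx y hy r hr) (fun x _ hx => hM x r hr hx)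
  refine lipschitz_of_outer hK (fun h0 x hx => by rw [fHat_eq_zero hδ h0 hx, map_zero])
    fun x hx y hy => ?_
  rw [hform x hx, hform y hy, add_sub_add_comm, add_mul]
  exact (norm_add_le _ _).trans (add_le_add (t1 x hx y hy) (t3 x hx y hy))

end Truncation

/-- The truncated fields, extended periodically to all times, satisfy the global assumptions. -/
theorem exists_averagingData {f₁ f₂ : Vec n → ℝ → Vec n} {T δ₁ δ₂ : ℝ}
    (h : RegularityAssumption f₁ f₂ T δ₁) (hδ : δ₁ < δ₂ ∨ δ₁ = 0) :
    ∃ K, AveragingData (fHat δ₁ δ₂ (periodicExtension T f₁))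
      (fHat δ₁ δ₂ (periodicExtension T f₂)) T K := by
  have hT := h.T_pos
  have hb : Continuous (bump (n := n) δ₁ δ₂) := (contDiff_bump h.δ₁_nonneg).continuous
  obtain ⟨K₁, hK₁, hlip₁⟩ := exists_lipschitz_fHat (δ₂ := δ₂) hT h.δ₁_nonneg hδ h.periodic₁ h.cont₁
    h.lip₁
  obtain ⟨K₂, hK₂, hlip₂⟩ := exists_lipschitz_fHat (δ₂ := δ₂) hT h.δ₁_nonneg hδ h.periodic₂ h.cont₂
    h.lip₂
  obtain ⟨K₃, hK₃, hlip₃⟩ := exists_lipschitz_fderiv_fHat (δ₂ := δ₂) hT h.δ₁_nonneg hδ h.periodic₁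
    h.cont₁ h.smooth₁ h.lip₁ h.lip₃
  -- Every time slice of the extended field is a slice of the original one at a nonnegative time
  -- that does not depend on x, so slicewise properties carry over.
  have hrep : ∀ (f : Vec n → ℝ → Vec n) (τ : ℝ), ∃ s, 0 ≤ s ∧
      ∀ x, fHat δ₁ δ₂ (periodicExtension T f) x τ = fHat δ₁ δ₂ f x s := fun f τ => by
    obtain ⟨s, hs, h⟩ := exists_periodicExtension_eq hT f τ
    exact ⟨s, hs, fun x => by simp only [fHat, h]⟩
  refine ⟨max K₁ (max K₂ K₃), hT, hK₁.trans (le_max_left _ _), ?_, ?_, ?_, ?_, ?_, ?_, ?_, ?_, ?_,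
    ?_⟩
  · exact (hb.comp continuous_fst).smul (continuous_periodicExtension hT h.periodic₁ h.cont₁)
  · exact (hb.comp continuous_fst).smul (continuous_periodicExtension hT h.periodic₂ h.cont₂)
  · intro x τ; simp only [fHat, periodicExtension_add_period hT h.periodic₁]
  · intro x τ; simp only [fHat, periodicExtension_add_period hT h.periodic₂]
  · intro x
    simp only [fHat]
    rw [intervalIntegral.integral_smul, integral_congr (g := f₁ x), h.mean_zero, smul_zero]
    intro τ hτ
    rw [uIcc_of_le hT.le] at hτ
    exact periodicExtension_of_nonneg hT h.periodic₁ x hτ.1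
  · intro τ
    obtain ⟨s, hs, e⟩ := hrep f₁ τ
    simp only [e]
    exact contDiff_fHat h.δ₁_nonneg hδ le_rfl h.smooth₁ hs
  · intro τ
    obtain ⟨s, hs, e⟩ := hrep f₂ τ
    simp only [e]
    exact_mod_cast contDiff_fHat h.δ₁_nonneg hδ one_le_two h.smooth₂ hs
  · intro τ x y
    obtain ⟨s, hs, e⟩ := hrep f₁ τ
    rw [e, e]
    refine (hlip₁ s hs x y).trans (mul_le_mul_of_nonneg_right ?_ (norm_nonneg _))
    exact le_max_left _ _
  · intro τ x y
    obtain ⟨s, hs, e⟩ := hrep f₂ τ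
    rw [e, e]
    refine (hlip₂ s hs x y).trans (mul_le_mul_of_nonneg_right ?_ (norm_nonneg _))
    exact le_max_of_le_right (le_max_left _ _)
  · intro r s x y
    obtain ⟨r', hr', er⟩ := hrep f₁ r
    obtain ⟨s', hs', es⟩ := hrep f₁ s
    simp only [er, es]
    refine (hlip₃ r' hr' s' hs' x y).trans (mul_le_mul_of_nonneg_right ?_ (norm_nonneg _))
    exact le_max_of_le_right (le_max_right _ _)

end SecondOrderAveraging

namespace SecondOrderAveraging

variable {n : ℕ}

/-! ### Near-identity diffeomorphisms -/

lemma fderiv_slice {U : Vec n → ℝ → Vec n} (hU : ContDiff ℝ 1 (Function.uncurry U)) (x : Vec n)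
    (τ : ℝ) : HasFDerivAt (fun z => U z τ)
      ((fderiv ℝ (Function.uncurry U) (x, τ)).comp (ContinuousLinearMap.inl ℝ (Vec n) ℝ)) x :=
  HasFDerivAt.comp (f := fun z : Vec n => (z, τ)) (g := Function.uncurry U) x
    ((hU.differentiable (by simp)) (x, τ)).hasFDerivAt (hasFDerivAt_prodMk_left x τ)

lemma continuous_fderiv_slice {U : Vec n → ℝ → Vec n} (hU : ContDiff ℝ 1 (Function.uncurry U)) :
    Continuous fun p : Vec n × ℝ => fderiv ℝ (fun z => U z p.2) p.1 := by
  simp only [(fderiv_slice hU _ _).fderiv]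
  exact (hU.continuous_fderiv (by simp)).clm_comp continuous_const

/-- A `C¹` perturbation of the identity in the first variable, with Lipschitz constant `1 / 2`,
is a `C¹` diffeomorphism. -/
theorem exists_contDiff_inverse {u : Vec n → ℝ → Vec n} (hu : ContDiff ℝ 1 (Function.uncurry u))
    (hlip : ∀ τ x y, ‖u x τ - u y τ‖ ≤ 1 / 2 * ‖x - y‖) :
    ∃ Ξ : Vec n × ℝ → Vec n × ℝ, ContDiff ℝ 1 Ξ ∧
      (∀ p, ((Ξ p).1 - u (Ξ p).1 (Ξ p).2, (Ξ p).2) = p) ∧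
      (∀ p : Vec n × ℝ, Ξ (p.1 - u p.1 p.2, p.2) = p) := by
  set Θ : Vec n × ℝ → Vec n × ℝ := fun p => (p.1 - u p.1 p.2, p.2) with hΘ
  have hinj : Function.Injective Θ := by
    rintro ⟨x, τ⟩ ⟨y, σ⟩ h
    obtain ⟨h1, h2⟩ := Prod.mk.injEq .. ▸ h
    simp only at h1 h2
    subst h2
    have h3 : x - y = u x τ - u y τ := by
      rw [sub_eq_sub_iff_sub_eq_sub] at h1; exact h1
    have h4 := hlip τ x y
    rw [← h3] at h4
    have h5 : ‖x - y‖ = 0 := by linarith [norm_nonneg (x - y)]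
    rw [norm_eq_zero, sub_eq_zero] at h5
    rw [h5]
  have hsurj : Function.Surjective Θ := by
    rintro ⟨z, τ⟩
    -- A preimage of (z, τ) is a fixed point of the contraction x ↦ z + u(x, τ).
    have hc : ContractingWith (1 / 2 : NNReal) fun x => z + u x τ := by
      refine ⟨by norm_num, LipschitzWith.of_dist_le_mul fun x y => ?_⟩
      simpa [dist_eq_norm] using hlip τ x y
    refine ⟨(hc.fixedPoint, τ), ?_⟩
    have h1 : z + u hc.fixedPoint τ = hc.fixedPoint := hc.fixedPoint_isFixedPt
    simp only [hΘ, Prod.mk.injEq, and_true]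
    exact (eq_sub_of_add_eq h1).symm
  have hΘc : ContDiff ℝ 1 Θ := (contDiff_fst.sub hu).prodMk contDiff_snd
  choose Ξ hΞ using hsurj
  refine ⟨Ξ, ?_, hΞ, fun p => hinj (hΞ _)⟩
  rw [contDiff_iff_contDiffAt]
  intro q
  set p := Ξ q with hp
  have hd : HasFDerivAt Θ (((ContinuousLinearMap.fst ℝ (Vec n) ℝ) -
      fderiv ℝ (Function.uncurry u) p).prod (ContinuousLinearMap.snd ℝ (Vec n) ℝ)) p :=
    (hasFDerivAt_fst.sub ((hu.differentiable (by simp)) p).hasFDerivAt).prodMk hasFDerivAt_snd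
  set D := ((ContinuousLinearMap.fst ℝ (Vec n) ℝ) -
      fderiv ℝ (Function.uncurry u) p).prod (ContinuousLinearMap.snd ℝ (Vec n) ℝ) with hD
  -- A kernel vector has σ = 0 and ξ = D_x u ξ with ‖D_x u‖ ≤ 1/2, so it is zero; in finite
  -- dimension injectivity makes D invertible.
  have hDinj : Function.Injective (D : Vec n × ℝ →ₗ[ℝ] Vec n × ℝ) := by
    rw [← LinearMap.ker_eq_bot, LinearMap.ker_eq_bot']
    rintro ⟨ξ, σ⟩ h
    have h0 : (ξ - fderiv ℝ (Function.uncurry u) p (ξ, σ), σ) = (0 : Vec n × ℝ) := h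
    obtain ⟨h1, h2⟩ := Prod.mk.injEq .. ▸ h0
    subst h2
    have h3 : ‖fderiv ℝ (Function.uncurry u) p (ξ, 0)‖ ≤ 1 / 2 * ‖ξ‖ := by
      have h4 := norm_fderiv_le_of_forall_norm_sub_le (by norm_num) (hlip p.2) p.1
      rw [(fderiv_slice hu p.1 p.2).fderiv] at h4
      exact (ContinuousLinearMap.le_opNorm ((fderiv ℝ (Function.uncurry u) (p.1, p.2)).comp
        (ContinuousLinearMap.inl ℝ (Vec n) ℝ)) ξ).trans
        (mul_le_mul_of_nonneg_right h4 (norm_nonneg _))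
    rw [← sub_eq_zero.1 h1] at h3
    have h5 : ‖ξ‖ = 0 := by linarith [norm_nonneg ξ]
    rw [norm_eq_zero.1 h5]
    rfl
  let e : (Vec n × ℝ) ≃L[ℝ] (Vec n × ℝ) :=
    (LinearEquiv.ofInjectiveEndo (D : Vec n × ℝ →ₗ[ℝ] Vec n × ℝ) hDinj).toContinuousLinearEquiv
  have he : HasFDerivAt Θ (e : Vec n × ℝ →L[ℝ] Vec n × ℝ) p := by
    convert! hd using 1
  have hn : (1 : WithTop ℕ∞) ≠ 0 := by simp
  have h1 := (hΘc.contDiffAt (x := p)).to_localInverse he hn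
  have h2 : Θ p = q := hΞ q
  rw [h2] at h1
  -- By global injectivity Ξ coincides near q with the local inverse from the inverse function
  -- theorem, and inherits its smoothness.
  refine h1.congr_of_eventuallyEq ?_
  have h3 := ((hΘc.contDiffAt (x := p)).hasStrictFDerivAt' he hn).eventually_right_inverse
  rw [h2] at h3
  filter_upwards [h3] with z hz
  exact hinj ((hΞ z).trans hz.symm)

/-- A map that agrees on `ℝⁿ × ℝ≥0` with a diffeomorphism of `ℝⁿ × ℝ` over `ℝ` is a
diffeomorphism of `ℝⁿ × ℝ≥0`. -/
lemma isC1Diffeo_of_eqOn {Ψ Θ Ξ : Vec n × ℝ → Vec n × ℝ} (hΘ : ContDiff ℝ 1 Θ)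
    (hΞ : ContDiff ℝ 1 Ξ) (h1 : ∀ p, Θ (Ξ p) = p) (h2 : ∀ p, Ξ (Θ p) = p)
    (hsnd : ∀ p, (Θ p).2 = p.2) (hΨ : EqOn Ψ Θ (halfSpace n)) :
    IsC1Diffeo Ψ ∧ EqOn (halfInv Ψ) Ξ (halfSpace n) := by
  have hmap : ∀ p ∈ halfSpace n, Θ p ∈ halfSpace n := fun p hp => by
    refine ⟨mem_univ _, ?_⟩
    rw [hsnd]; exact hp.2
  have hmap' : ∀ p ∈ halfSpace n, Ξ p ∈ halfSpace n := fun p hp => by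
    refine ⟨mem_univ _, ?_⟩
    rw [← hsnd, h1]; exact hp.2
  have hbij : BijOn Ψ (halfSpace n) (halfSpace n) := by
    refine ⟨fun p hp => by rw [hΨ hp]; exact hmap p hp, fun p hp q hq hpq => ?_, fun p hp => ?_⟩
    · rw [hΨ hp, hΨ hq] at hpq
      rw [← h2 p, hpq, h2]
    · exact ⟨Ξ p, hmap' p hp, by rw [hΨ (hmap' p hp), h1]⟩
  have hinv : EqOn (halfInv Ψ) Ξ (halfSpace n) := fun p hp => by
    have hs := hbij.surjOn hp
    refine hbij.injOn (Function.invFunOn_mem hs) (hmap' p hp) ?_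
    rw [Function.invFunOn_eq hs, hΨ (hmap' p hp), h1]
  exact ⟨⟨hbij, hΘ.contDiffOn.congr hΨ, hΞ.contDiffOn.congr hinv⟩, hinv⟩

/-! ### The near-identity transformation in terms of the extended fields -/

section Transformation

variable {f₁ f₂ : Vec n → ℝ → Vec n} {T δ₁ δ₂ K : ℝ}

lemma fHat_periodicExtension {f : Vec n → ℝ → Vec n} (hT : 0 < T)
    (hp : ∀ x τ, 0 ≤ τ → f x (τ + T) = f x τ) (x : Vec n) {τ : ℝ} (hτ : 0 ≤ τ) :
    fHat δ₁ δ₂ (periodicExtension T f) x τ = fHat δ₁ δ₂ f x τ := by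
  simp only [fHat, periodicExtension_of_nonneg hT hp x hτ]

lemma v1_eq_primitive {f : Vec n → ℝ → Vec n} (hT : 0 < T)
    (hp : ∀ x τ, 0 ≤ τ → f x (τ + T) = f x τ) (x : Vec n) {τ : ℝ} (hτ : 0 ≤ τ) :
    v1 δ₁ δ₂ f x τ = primitive (fHat δ₁ δ₂ (periodicExtension T f)) x τ := by
  refine intervalIntegral.integral_congr fun s hs => ?_
  rw [uIcc_of_le hτ] at hs
  exact (fHat_periodicExtension hT hp x hs.1).symm

lemma fBar_eq_secondAverage (h : RegularityAssumption f₁ f₂ T δ₁)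
    (hD : AveragingData (fHat δ₁ δ₂ (periodicExtension T f₁))
      (fHat δ₁ δ₂ (periodicExtension T f₂)) T K) (x : Vec n) :
    fBar δ₁ δ₂ T f₁ f₂ x = secondAverage (fHat δ₁ δ₂ (periodicExtension T f₁))
      (fHat δ₁ δ₂ (periodicExtension T f₂)) T x := by
  rw [hD.secondAverage_eq, fBar]
  congr 1
  refine intervalIntegral.integral_congr fun s hs => ?_
  rw [uIcc_of_le h.T_pos.le] at hs
  simp only [v1_eq_primitive h.T_pos h.periodic₁ _ hs.1,
    fHat_periodicExtension h.T_pos h.periodic₁ _ hs.1,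
    fHat_periodicExtension h.T_pos h.periodic₂ _ hs.1]

lemma v2_eq_primitive (h : RegularityAssumption f₁ f₂ T δ₁)
    (hD : AveragingData (fHat δ₁ δ₂ (periodicExtension T f₁))
      (fHat δ₁ δ₂ (periodicExtension T f₂)) T K) (x : Vec n) {τ : ℝ} (hτ : 0 ≤ τ) :
    v2 δ₁ δ₂ T f₁ f₂ x τ = primitive (secondResidual (fHat δ₁ δ₂ (periodicExtension T f₁))
      (fHat δ₁ δ₂ (periodicExtension T f₂)) T) x τ := by
  rw [hD.primitive_secondResidual_eq, v2, wFun]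
  simp only [v1_eq_primitive h.T_pos h.periodic₁ _ hτ]
  congr 1
  refine intervalIntegral.integral_congr fun s hs => ?_
  rw [uIcc_of_le hτ] at hs
  simp only [v1_eq_primitive h.T_pos h.periodic₁ _ hs.1,
    fHat_periodicExtension h.T_pos h.periodic₁ _ hs.1,
    fHat_periodicExtension h.T_pos h.periodic₂ _ hs.1, fBar_eq_secondAverage h hD]

/-- Bounds that are uniform in time for the fields and correctors. -/
lemma AveragingData.exists_bounds {F₁ F₂ : Vec n → ℝ → Vec n} (h : AveragingData F₁ F₂ T K) :
    ∃ A, 0 < A ∧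
      (∀ τ x y, ‖primitive F₁ x τ - primitive F₁ y τ‖ ≤ A * ‖x - y‖) ∧
      (∀ τ x y, ‖primitive (secondResidual F₁ F₂ T) x τ -
        primitive (secondResidual F₁ F₂ T) y τ‖ ≤ A * ‖x - y‖) ∧
      (∀ x y, ‖secondAverage F₁ F₂ T x - secondAverage F₁ F₂ T y‖ ≤ A * ‖x - y‖) ∧
      (∀ τ x, ‖primitive F₁ x τ‖ ≤ A * (1 + ‖x‖)) ∧
      (∀ τ x, ‖primitive (secondResidual F₁ F₂ T) x τ‖ ≤ A * (1 + ‖x‖)) ∧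
      (∀ τ x, ‖F₁ x τ‖ ≤ A * (1 + ‖x‖)) ∧ (∀ τ x, ‖F₂ x τ‖ ≤ A * (1 + ‖x‖)) := by
  have hK := h.K_nonneg
  have hT := h.T_pos
  have growth : ∀ {F : Vec n → ℝ → Vec n} {L : ℝ},
      (∀ τ x y, ‖F x τ - F y τ‖ ≤ L * ‖x - y‖) → (∃ C, ∀ τ, ‖F 0 τ‖ ≤ C) →
      ∃ B, ∀ A, B ≤ A → ∀ τ x, ‖F x τ‖ ≤ A * (1 + ‖x‖) := by
    rintro F L hL ⟨C, hC⟩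
    refine ⟨max C L, fun A hA τ x => ?_⟩
    have h1 := hL τ x 0
    rw [sub_zero] at h1
    have h2 : ‖F x τ‖ ≤ ‖F x τ - F 0 τ‖ + ‖F 0 τ‖ := by
      simpa using norm_add_le (F x τ - F 0 τ) (F 0 τ)
    have h3 := mul_le_mul_of_nonneg_right ((le_max_right C L).trans hA) (norm_nonneg x)
    linarith [hC τ, (le_max_left C L).trans hA]
  obtain ⟨B₁, hB₁⟩ := growth h.lip_primitive (bounded_of_continuous_periodic hT
    (h.contDiff_primitive.continuous.uncurry_left 0) (h.primitive_add_period 0))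
  obtain ⟨B₂, hB₂⟩ := growth h.lip_primitive_secondResidual (bounded_of_continuous_periodic hT
    (h.contDiff_primitive_secondResidual.continuous.uncurry_left 0)
    (h.primitive_secondResidual_add_period 0))
  obtain ⟨B₃, hB₃⟩ := growth h.lip₁ (h.field₁.bdd 0)
  obtain ⟨B₄, hB₄⟩ := growth h.lip₂ (h.field₂.bdd 0)
  have hlip : ∀ {a A : ℝ} {z w : Vec n}, a ≤ A → ‖z‖ ≤ a * ‖w‖ → ‖z‖ ≤ A * ‖w‖ :=
    fun haA hz => hz.trans (mul_le_mul_of_nonneg_right haA (norm_nonneg _))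
  obtain ⟨A, hA⟩ : ∃ A : ℝ, 0 < A ∧ K * T ≤ A ∧ 2 * (K + K * T) * T ≤ A ∧ K + K * T ≤ A ∧
      B₁ ≤ A ∧ B₂ ≤ A ∧ B₃ ≤ A ∧ B₄ ≤ A :=
    ((eventually_gt_atTop 0).and ((eventually_ge_atTop _).and ((eventually_ge_atTop _).and
      ((eventually_ge_atTop _).and ((eventually_ge_atTop _).and ((eventually_ge_atTop _).and
      ((eventually_ge_atTop _).and (eventually_ge_atTop _)))))))).exists
  obtain ⟨hA0, hA1, hA2, hA3, hA4, hA5, hA6, hA7⟩ := hA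
  exact ⟨A, hA0, fun τ x y => hlip hA1 (h.lip_primitive τ x y),
    fun τ x y => hlip hA2 (h.lip_primitive_secondResidual τ x y),
    fun x y => hlip hA3 (h.lip_secondAverage x y), hB₁ A hA4, hB₂ A hA5, hB₃ A hA6, hB₄ A hA7⟩

/-- For small `ε` the near-identity transformation is a diffeomorphism, and the transformed field
is a continuous small perturbation of the second-order average. -/
theorem nearId_transformed (h : RegularityAssumption f₁ f₂ T δ₁) (hδ : δ₁ < δ₂ ∨ δ₁ = 0) :
    ∃ ε₀ C : ℝ, 0 < ε₀ ∧ 0 < C ∧ ∀ ε ∈ Ioo 0 ε₀,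
      IsC1Diffeo (nearId δ₁ δ₂ T f₁ f₂ ε) ∧
      ContinuousOn (fun p : Vec n × ℝ => transformed δ₁ δ₂ T f₁ f₂ ε p.1 p.2) (halfSpace n) ∧
      ∀ x τ, 0 ≤ τ → ∃ y, halfInv (nearId δ₁ δ₂ T f₁ f₂ ε) (x, τ) = (y, τ) ∧
        nearId δ₁ δ₂ T f₁ f₂ ε (y, τ) = (x, τ) ∧
        ‖x - y‖ ≤ C * ε * (1 + ‖y‖) ∧ C * ε ≤ 1 / 2 ∧
        (δ₂ ≤ ‖y‖ → ‖transformed δ₁ δ₂ T f₁ f₂ ε x τ - fBar δ₁ δ₂ T f₁ f₂ x‖ ≤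
          C * ε * (1 + ‖y‖)) := by
  obtain ⟨K, hD⟩ := exists_averagingData h hδ
  have hv2 := fun x τ (hτ : 0 ≤ τ) => v2_eq_primitive h hD x hτ
  have hv1 := fun x τ (hτ : 0 ≤ τ) => v1_eq_primitive (δ₁ := δ₁) (δ₂ := δ₂) h.T_pos h.periodic₁ x hτ
  have hbar := fBar_eq_secondAverage h hD
  have hF₁ : ∀ x τ, 0 ≤ τ → δ₂ ≤ ‖x‖ → fHat δ₁ δ₂ (periodicExtension T f₁) x τ = f₁ x τ :=
    fun x τ hτ hx => by
      rw [fHat_periodicExtension h.T_pos h.periodic₁ x hτ, fHat, bump_eq_one hx, one_smul]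
  have hF₂ : ∀ x τ, 0 ≤ τ → δ₂ ≤ ‖x‖ → fHat δ₁ δ₂ (periodicExtension T f₂) x τ = f₂ x τ :=
    fun x τ hτ hx => by
      rw [fHat_periodicExtension h.T_pos h.periodic₂ x hτ, fHat, bump_eq_one hx, one_smul]
  set F₁ := fHat δ₁ δ₂ (periodicExtension T f₁)
  set F₂ := fHat δ₁ δ₂ (periodicExtension T f₂)
  obtain ⟨A, hA, hLW, hLZ, hLa, hW, hZ, hG₁, hG₂⟩ := hD.exists_bounds
  set W := primitive F₁ with hWdef
  set Z := primitive (secondResidual F₁ F₂ T) with hZdef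
  have hWc : ContDiff ℝ 1 (Function.uncurry W) := hD.contDiff_primitive
  have hZc : ContDiff ℝ 1 (Function.uncurry Z) := hD.contDiff_primitive_secondResidual
  have hDW : ∀ x τ, ‖fderiv ℝ (fun z => W z τ) x‖ ≤ A := fun x τ =>
    norm_fderiv_le_of_forall_norm_sub_le hA.le (hLW τ) x
  have hDZ : ∀ x τ, ‖fderiv ℝ (fun z => Z z τ) x‖ ≤ A := fun x τ =>
    norm_fderiv_le_of_forall_norm_sub_le hA.le (hLZ τ) x
  -- 2A bounds the displacement, since ε² ≤ ε. In 5A², two come from f̄(y) - f̄(x) and three from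
  -- the terms of order at least ε left in the pushforward.
  set C := 2 * A + 5 * A ^ 2 with hC
  have hC0 : 0 < C := by positivity
  refine ⟨min 1 (1 / (2 * C)), C, by positivity, hC0, fun ε hε => ?_⟩
  have hε0 : 0 < ε := hε.1
  have hε1 : ε ≤ 1 := (hε.2.trans_le (min_le_left _ _)).le
  have hεC : C * ε ≤ 1 / 2 := by
    have h1 := (hε.2.trans_le (min_le_right _ _)).le
    rw [le_div_iff₀ (by positivity)] at h1
    linarith
  have hε2 : ε ^ 2 ≤ ε := by nlinarith
  have hCA : 2 * A ≤ C := by nlinarith [sq_nonneg A]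
  let u : Vec n → ℝ → Vec n := fun x τ => ε • W x τ + ε ^ 2 • Z x τ
  have hu : ContDiff ℝ 1 (Function.uncurry u) := (hWc.const_smul ε).add (hZc.const_smul (ε ^ 2))
  have hcomb : ∀ {z w : Vec n} {b : ℝ}, ‖z‖ ≤ A * b → ‖w‖ ≤ A * b → 0 ≤ b →
      ‖ε • z + ε ^ 2 • w‖ ≤ C * ε * b := by
    intro z w b hz hw hb
    refine (norm_add_le _ _).trans ?_
    rw [norm_smul, norm_smul, Real.norm_of_nonneg hε0.le, Real.norm_of_nonneg (sq_nonneg ε)]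
    have h1 : ε * ‖z‖ ≤ ε * (A * b) := mul_le_mul_of_nonneg_left hz hε0.le
    have h2 : ε ^ 2 * ‖w‖ ≤ ε * (A * b) := mul_le_mul hε2 hw (norm_nonneg _) hε0.le
    have h3 : (2 * A) * (ε * b) ≤ C * (ε * b) :=
      mul_le_mul_of_nonneg_right hCA (mul_nonneg hε0.le hb)
    linarith
  have hulip : ∀ τ x y, ‖u x τ - u y τ‖ ≤ 1 / 2 * ‖x - y‖ := by
    intro τ x y
    have e : u x τ - u y τ = ε • (W x τ - W y τ) + ε ^ 2 • (Z x τ - Z y τ) := by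
      simp only [u]; module
    rw [e]
    exact (hcomb (hLW τ x y) (hLZ τ x y) (norm_nonneg _)).trans
      (mul_le_mul_of_nonneg_right hεC (norm_nonneg _))
  obtain ⟨Ξ, hΞc, hΘΞ, hΞΘ⟩ := exists_contDiff_inverse hu hulip
  have hN : ∀ x τ, 0 ≤ τ → nearId δ₁ δ₂ T f₁ f₂ ε (x, τ) = (x - u x τ, τ) := by
    intro x τ hτ
    simp only [nearId, u, hv1 x τ hτ, hv2 x τ hτ, sub_sub]
  obtain ⟨hdiffeo, hinv⟩ := isC1Diffeo_of_eqOn (Ψ := nearId δ₁ δ₂ T f₁ f₂ ε)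
    (Θ := fun p => (p.1 - u p.1 p.2, p.2)) ((contDiff_fst.sub hu).prodMk contDiff_snd) hΞc hΘΞ hΞΘ
    (fun p => rfl) (fun p hp => hN p.1 p.2 hp.2)
  have hΞ2 : ∀ p, (Ξ p).2 = p.2 := fun p => by
    have := congrArg Prod.snd (hΘΞ p)
    exact this
  -- Valid at every point: the time derivatives of the two correctors are F₁ and the mean-free
  -- residual. The bump enters only when the original field is replaced by the truncated one.
  have htr : ∀ x τ, 0 ≤ τ → transformed δ₁ δ₂ T f₁ f₂ ε x τ =
      oscField f₁ f₂ ε (Ξ (x, τ)).1 τ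
        - ε • fderiv ℝ (fun z => W z τ) (Ξ (x, τ)).1 (oscField f₁ f₂ ε (Ξ (x, τ)).1 τ)
        - ε ^ 2 • fderiv ℝ (fun z => Z z τ) (Ξ (x, τ)).1 (oscField f₁ f₂ ε (Ξ (x, τ)).1 τ)
        - ε⁻¹ • F₁ (Ξ (x, τ)).1 τ - secondResidual F₁ F₂ T (Ξ (x, τ)).1 τ := by
    intro x τ hτ
    simp only [transformed, pushforward]
    rw [hinv (show (x, τ) ∈ halfSpace n from ⟨mem_univ _, hτ⟩), hΞ2]
    simp only
    set y := (Ξ (x, τ)).1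
    have hx : HasFDerivAt (fun z => (nearId δ₁ δ₂ T f₁ f₂ ε (z, τ)).1)
        (ContinuousLinearMap.id ℝ (Vec n) - (ε • fderiv ℝ (fun z => W z τ) y +
          ε ^ 2 • fderiv ℝ (fun z => Z z τ) y)) y := by
      simp only [hN _ τ hτ, u]
      exact (hasFDerivAt_id y).sub
        (((fderiv_slice hWc y τ).differentiableAt.hasFDerivAt.const_smul ε).add
          ((fderiv_slice hZc y τ).differentiableAt.hasFDerivAt.const_smul (ε ^ 2)))
    have ht : HasDerivWithinAt (fun s => (nearId δ₁ δ₂ T f₁ f₂ ε (y, s)).1)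
        (0 - (ε • F₁ y τ + ε ^ 2 • secondResidual F₁ F₂ T y τ)) (Ici 0) τ := by
      have h1 : HasDerivAt (fun s => y - u y s)
          (0 - (ε • F₁ y τ + ε ^ 2 • secondResidual F₁ F₂ T y τ)) τ :=
        (hasDerivAt_const τ y).sub (((hD.hasDerivAt_primitive y τ).const_smul ε).add
          ((hD.hasDerivAt_primitive_secondResidual y τ).const_smul (ε ^ 2)))
      refine h1.hasDerivWithinAt.congr (fun s hs => ?_) ?_
      · rw [hN y s hs]
      · rw [hN y τ hτ]
    rw [hx.fderiv, ht.derivWithin (uniqueDiffOn_Ici 0 τ hτ)]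
    simp only [sub_apply, add_apply, ContinuousLinearMap.id_apply, smul_apply]
    have e1 : (ε ^ 2)⁻¹ • (0 - (ε • F₁ y τ + ε ^ 2 • secondResidual F₁ F₂ T y τ)) =
        - (ε⁻¹ • F₁ y τ) - secondResidual F₁ F₂ T y τ := by
      rw [zero_sub, smul_neg, smul_add, smul_smul, smul_smul,
        inv_mul_cancel₀ (pow_ne_zero 2 hε0.ne'), one_smul,
        show (ε ^ 2)⁻¹ * ε = ε⁻¹ by field_simp, neg_add]
      rfl
    rw [e1]
    abel
  refine ⟨hdiffeo, ?_, fun x τ hτ => ⟨(Ξ (x, τ)).1, ?_, ?_, ?_, hεC, fun hy => ?_⟩⟩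
  · have hΞ1 : Continuous fun p : Vec n × ℝ => ((Ξ p).1, p.2) :=
      (hΞc.continuous.fst).prodMk continuous_snd
    have hosc : ContinuousOn (fun p : Vec n × ℝ => oscField f₁ f₂ ε (Ξ p).1 p.2)
        (halfSpace n) := by
      have hmaps : MapsTo (fun p : Vec n × ℝ => ((Ξ p).1, p.2)) (halfSpace n) (halfSpace n) :=
        fun p hp => ⟨mem_univ _, hp.2⟩
      exact ((h.cont₁.comp hΞ1.continuousOn hmaps).const_smul ε⁻¹).add
        (h.cont₂.comp hΞ1.continuousOn hmaps)
    have cW := ((continuous_fderiv_slice hWc).comp hΞ1).continuousOn (s := halfSpace n)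
    have cZ := ((continuous_fderiv_slice hZc).comp hΞ1).continuousOn (s := halfSpace n)
    have c₁ := (hD.cont₁.comp hΞ1).continuousOn (s := halfSpace n)
    have c₂ := (hD.continuous_secondResidual.comp hΞ1).continuousOn (s := halfSpace n)
    have := (((hosc.sub ((cW.clm_apply hosc).const_smul ε)).sub
      ((cZ.clm_apply hosc).const_smul (ε ^ 2))).sub (c₁.const_smul ε⁻¹)).sub c₂
    exact this.congr fun p hp => htr p.1 p.2 hp.2
  · rw [hinv (show (x, τ) ∈ halfSpace n from ⟨mem_univ _, hτ⟩)]
    exact Prod.ext rfl (hΞ2 _)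
  · rw [hN _ τ hτ]
    have := hΘΞ (x, τ)
    rwa [hΞ2] at this
  all_goals
    have hxy : x = (Ξ (x, τ)).1 - u (Ξ (x, τ)).1 τ := by
      have := congrArg Prod.fst (hΘΞ (x, τ))
      rw [hΞ2] at this
      exact this.symm
  · rw [norm_sub_rev]
    have e : (Ξ (x, τ)).1 - x = u (Ξ (x, τ)).1 τ := by
      rw [sub_eq_iff_eq_add, ← sub_eq_iff_eq_add']; exact hxy.symm
    rw [e]
    exact hcomb (hW τ _) (hZ τ _) (by positivity)
  · rw [htr x τ hτ, hbar]
    set y := (Ξ (x, τ)).1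
    set b := 1 + ‖y‖ with hb
    have hb0 : 0 ≤ b := by positivity
    have hosc : oscField f₁ f₂ ε y τ = ε⁻¹ • F₁ y τ + F₂ y τ := by
      rw [oscField, hF₁ y τ hτ hy, hF₂ y τ hτ hy]
    -- Here the bump is one at y. The terms ε⁻¹F₁ and F₂ cancel, and the self-transport in the
    -- residual cancels ε D_x v₁ applied to ε⁻¹F₁; only f̄(y) survives at order one.
    have e : oscField f₁ f₂ ε y τ - ε • fderiv ℝ (fun z => W z τ) y (oscField f₁ f₂ ε y τ)
        - ε ^ 2 • fderiv ℝ (fun z => Z z τ) y (oscField f₁ f₂ ε y τ)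
        - ε⁻¹ • F₁ y τ - secondResidual F₁ F₂ T y τ - secondAverage F₁ F₂ T x =
        (secondAverage F₁ F₂ T y - secondAverage F₁ F₂ T x) -
        (ε • fderiv ℝ (fun z => W z τ) y (F₂ y τ) + ε • fderiv ℝ (fun z => Z z τ) y (F₁ y τ) +
          ε ^ 2 • fderiv ℝ (fun z => Z z τ) y (F₂ y τ)) := by
      rw [hosc]
      simp only [map_add, map_smul, smul_add, smul_smul, secondResidual, selfTransport]
      rw [show ε * ε⁻¹ = 1 from mul_inv_cancel₀ hε0.ne', show ε ^ 2 * ε⁻¹ = ε by field_simp,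
        one_smul]
      abel
    rw [e]
    have n0 : ‖secondAverage F₁ F₂ T y - secondAverage F₁ F₂ T x‖ ≤ 2 * A ^ 2 * ε * b := by
      refine (hLa y x).trans ?_
      have e2 : y - x = u y τ := by
        rw [sub_eq_iff_eq_add, ← sub_eq_iff_eq_add']; exact hxy.symm
      rw [e2]
      have n1 : ‖u y τ‖ ≤ ε * (A * b) + ε * (A * b) := by
        refine (norm_add_le _ _).trans ?_
        rw [norm_smul, norm_smul, Real.norm_of_nonneg hε0.le, Real.norm_of_nonneg (sq_nonneg ε)]
        exact add_le_add (mul_le_mul_of_nonneg_left (hW τ y) hε0.le)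
          (mul_le_mul hε2 (hZ τ y) (norm_nonneg _) hε0.le)
      calc A * ‖u y τ‖ ≤ A * (ε * (A * b) + ε * (A * b)) := mul_le_mul_of_nonneg_left n1 hA.le
        _ = 2 * A ^ 2 * ε * b := by ring
    have napp : ∀ (D : Vec n →L[ℝ] Vec n) (z : Vec n) (e : ℝ), ‖D‖ ≤ A → ‖z‖ ≤ A * b → 0 ≤ e →
        e ≤ ε → ‖e • D z‖ ≤ A ^ 2 * ε * b := by
      intro D z e hDA hz he0 heε
      rw [norm_smul, Real.norm_of_nonneg he0]
      calc e * ‖D z‖ ≤ ε * (A * (A * b)) :=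
            mul_le_mul heε ((D.le_opNorm z).trans (mul_le_mul hDA hz (norm_nonneg _) hA.le))
              (norm_nonneg _) hε0.le
        _ = A ^ 2 * ε * b := by ring
    have n1 := napp _ _ ε (hDW y τ) (hG₂ τ y) hε0.le le_rfl
    have n2 := napp _ _ ε (hDZ y τ) (hG₁ τ y) hε0.le le_rfl
    have n3 := napp _ _ (ε ^ 2) (hDZ y τ) (hG₂ τ y) (sq_nonneg ε) hε2
    refine (norm_sub_le _ _).trans ((add_le_add n0 ((norm_add₃_le).trans
      (add_le_add (add_le_add n1 n2) n3))).trans ?_)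
    have : 0 ≤ A * ε * b := by positivity
    rw [hC]
    nlinarith

end Transformation

end SecondOrderAveraging

namespace SecondOrderAveraging

variable {n : ℕ}

/-! ### Independence of the truncation radius far from the origin -/

section Agreement

variable {f₁ f₂ : Vec n → ℝ → Vec n} {T δ₁ δ₂ δ₂' m : ℝ}

lemma fHat_congr (f : Vec n → ℝ → Vec n) (h : δ₂ ≤ m) (h' : δ₂' ≤ m) {y : Vec n} (hy : m < ‖y‖) :
    fHat δ₁ δ₂ f y = fHat δ₁ δ₂' f y := by
  funext τ
  rw [fHat, fHat, bump_eq_one (h.trans hy.le), bump_eq_one (h'.trans hy.le)]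

lemma v1_congr (f : Vec n → ℝ → Vec n) (h : δ₂ ≤ m) (h' : δ₂' ≤ m) {y : Vec n} (hy : m < ‖y‖) :
    v1 δ₁ δ₂ f y = v1 δ₁ δ₂' f y := by
  funext τ
  rw [v1, v1, fHat_congr f h h' hy]

lemma eventually_lt_norm {y : Vec n} (hy : m < ‖y‖) : ∀ᶠ z in 𝓝 y, m < ‖z‖ :=
  continuous_norm.continuousAt.eventually (lt_mem_nhds hy)

/-- The strict inequality defines an open set, so agreement there passes to the derivatives that
enter f̄ and Ψ_ε. -/
lemma fHat_eventuallyEq (f : Vec n → ℝ → Vec n) (h : δ₂ ≤ m) (h' : δ₂' ≤ m) {y : Vec n}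
    (hy : m < ‖y‖) (τ : ℝ) : (fun z => fHat δ₁ δ₂ f z τ) =ᶠ[𝓝 y] fun z => fHat δ₁ δ₂' f z τ :=
  (eventually_lt_norm hy).mono fun _ hz => congrFun (fHat_congr f h h' hz) τ

lemma v1_eventuallyEq (f : Vec n → ℝ → Vec n) (h : δ₂ ≤ m) (h' : δ₂' ≤ m) {y : Vec n}
    (hy : m < ‖y‖) (τ : ℝ) : (fun z => v1 δ₁ δ₂ f z τ) =ᶠ[𝓝 y] fun z => v1 δ₁ δ₂' f z τ :=
  (eventually_lt_norm hy).mono fun _ hz => congrFun (v1_congr f h h' hz) τ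

lemma fBar_congr (h : δ₂ ≤ m) (h' : δ₂' ≤ m) {y : Vec n} (hy : m < ‖y‖) :
    fBar δ₁ δ₂ T f₁ f₂ y = fBar δ₁ δ₂' T f₁ f₂ y := by
  simp only [fBar, VectorField.lieBracket, (v1_eventuallyEq f₁ h h' hy _).fderiv_eq,
    (fHat_eventuallyEq f₁ h h' hy _).fderiv_eq, fHat_congr f₁ h h' hy, fHat_congr f₂ h h' hy,
    v1_congr f₁ h h' hy]

lemma nearId_congr (h : δ₂ ≤ m) (h' : δ₂' ≤ m) {y : Vec n} (hy : m < ‖y‖) (ε τ : ℝ) :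
    nearId δ₁ δ₂ T f₁ f₂ ε (y, τ) = nearId δ₁ δ₂' T f₁ f₂ ε (y, τ) := by
  simp only [nearId, v2, wFun, (v1_eventuallyEq f₁ h h' hy _).fderiv_eq,
    (fHat_eventuallyEq f₁ h h' hy _).fderiv_eq, fHat_congr f₂ h h' hy,
    v1_congr f₁ h h' hy, fBar_congr h h' hy]

/-- The two transformations agree near (y, τ) at time τ and at y for all times. Since the second one
is injective, y is also its preimage of x, and all ingredients of the pushforwards coincide. -/
lemma transformed_congr (h : δ₂ ≤ m) (h' : δ₂' ≤ m) {x y : Vec n} {ε τ : ℝ} (hy : m < ‖y‖)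
    (hd : IsC1Diffeo (nearId δ₁ δ₂' T f₁ f₂ ε))
    (hinv : halfInv (nearId δ₁ δ₂ T f₁ f₂ ε) (x, τ) = (y, τ))
    (hN : nearId δ₁ δ₂ T f₁ f₂ ε (y, τ) = (x, τ)) (hτ : 0 ≤ τ) :
    transformed δ₁ δ₂ T f₁ f₂ ε x τ = transformed δ₁ δ₂' T f₁ f₂ ε x τ := by
  have hmem : ∀ z : Vec n, (z, τ) ∈ halfSpace n := fun z => ⟨mem_univ _, hτ⟩
  have hinv' : halfInv (nearId δ₁ δ₂' T f₁ f₂ ε) (x, τ) = (y, τ) := by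
    have hs := hd.1.surjOn (hmem x)
    refine hd.1.injOn (Function.invFunOn_mem hs) (hmem y) ?_
    rw [Function.invFunOn_eq hs, ← nearId_congr h h' hy, hN]
  have he : (fun z => (nearId δ₁ δ₂ T f₁ f₂ ε (z, τ)).1) =ᶠ[𝓝 y]
      fun z => (nearId δ₁ δ₂' T f₁ f₂ ε (z, τ)).1 :=
    (eventually_lt_norm hy).mono fun _ hz => by simp only [nearId_congr h h' hz]
  simp only [transformed, pushforward, hinv, hinv', he.fderiv_eq, nearId_congr h h' hy]

end Agreement

/-- Decay of a Lyapunov function along a perturbation of a field along which it decays. -/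
lemma inner_le_of_perturbation {g F G : Vec n} {c₁ c₂ L p a ε : ℝ} (hc₁ : 0 < c₁) (hc₂ : 0 < c₂)
    (hL : 0 < L) (ha : 0 < a) (hp : a ≤ p) (hε : 0 < ε)
    (hε' : ε * (c₂ * L * (1 + a⁻¹)) ≤ c₁ / 2) (hg : ‖g‖ ≤ c₂ * p)
    (hG : inner ℝ g G ≤ -c₁ * p ^ 2) (hFG : ‖F - G‖ ≤ ε * (L * (p + 1))) :
    inner ℝ g F ≤ -(c₁ / 2 * a ^ 2) := by
  have hp0 : 0 < p := ha.trans_le hp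
  have h1 : inner ℝ g F = inner ℝ g G + inner ℝ g (F - G) := by rw [inner_sub_right]; ring
  have h2 : inner ℝ g (F - G) ≤ (c₂ * p) * (ε * (L * (p + 1))) :=
    (real_inner_le_norm _ _).trans (mul_le_mul hg hFG (norm_nonneg _) (by positivity))
  -- The lower bound a ≤ p absorbs the constant 1, so the perturbation becomes quadratic in p and
  -- can be compared with -c₁p².
  have h3 : p + 1 ≤ (1 + a⁻¹) * p := by
    have : 1 ≤ a⁻¹ * p := by rw [inv_mul_eq_div, one_le_div ha]; exact hp
    linarith
  have h4 : (c₂ * p) * (ε * (L * (p + 1))) ≤ c₁ / 2 * p ^ 2 := by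
    calc (c₂ * p) * (ε * (L * (p + 1))) ≤ (c₂ * p) * (ε * (L * ((1 + a⁻¹) * p))) := by gcongr
      _ = ε * (c₂ * L * (1 + a⁻¹)) * p ^ 2 := by ring
      _ ≤ c₁ / 2 * p ^ 2 := mul_le_mul_of_nonneg_right hε' (sq_nonneg _)
  have h5 : a ^ 2 ≤ p ^ 2 := by gcongr
  have h6 : c₁ / 2 * a ^ 2 ≤ c₁ / 2 * p ^ 2 := by gcongr
  rw [h1]
  linarith

/-- Under either of the growth conditions, the transformed field is close to the average, relative
to the function `φ`, far from the origin and uniformly in the truncation radius. -/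
lemma exists_perturbation_bound {f₁ f₂ : Vec n → ℝ → Vec n} {T δ₁ δ₂ δ₂' δ₃' : ℝ}
    (hreg : RegularityAssumption f₁ f₂ T δ₁) (hδ : δ₁ < δ₂ ∨ δ₁ = 0) (hδ' : δ₁ < δ₂' ∨ δ₁ = 0)
    {φ : Vec n → ℝ}
    (hφ : (∃ (L ε₀ : ℝ), 0 < L ∧ 0 < ε₀ ∧ ∀ x ∈ outer n δ₃', ∀ τ, 0 ≤ τ → ∀ ε ∈ Ioc 0 ε₀,
        ‖gFun δ₁ δ₂' T f₁ f₂ x τ ε‖ ≤ L * (φ x + 1)) ∨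
      (∃ α₃ : ℝ → ℝ, IsClassK α₃ ∧ ∀ x, α₃ ‖x‖ * ‖x‖ ≤ φ x)) :
    ∃ R L ε₀ : ℝ, 0 < L ∧ 0 < ε₀ ∧ ∀ ε ∈ Ioo 0 ε₀, ∀ x, R ≤ ‖x‖ →
      fBar δ₁ δ₂ T f₁ f₂ x = fBar δ₁ δ₂' T f₁ f₂ x ∧ ∀ τ, 0 ≤ τ →
      ‖transformed δ₁ δ₂ T f₁ f₂ ε x τ - fBar δ₁ δ₂ T f₁ f₂ x‖ ≤ ε * (L * (φ x + 1)) := by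
  obtain ⟨ε₁, C, hε₁, hC, hmain⟩ := nearId_transformed hreg hδ
  obtain ⟨ε₂, _, hε₂, -, hmain'⟩ := nearId_transformed hreg hδ'
  set m := max δ₂ δ₂' with hm
  have hm1 : δ₂ ≤ m := le_max_left _ _
  have hm2 : δ₂' ≤ m := le_max_right _ _
  -- If |y| ≤ m, then |x| ≤ |y| + (1 + |y|)/2 ≤ 2m + 1. So the preimage of a distant point lies
  -- where neither truncation acts.
  have far : ∀ {x y : Vec n} {ε : ℝ}, ‖x - y‖ ≤ C * ε * (1 + ‖y‖) → C * ε ≤ 1 / 2 →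
      2 * m + 1 < ‖x‖ → m < ‖y‖ := by
    intro x y ε hxy hCε hx
    by_contra! hle
    have h1 : ‖x‖ ≤ ‖x - y‖ + ‖y‖ := by simpa using norm_add_le (x - y) y
    have h2 := mul_le_mul_of_nonneg_right hCε (show 0 ≤ 1 + ‖y‖ by positivity)
    have : 0 ≤ m := (norm_nonneg _).trans hle
    linarith
  rcases hφ with ⟨L, ε₀, hL, hε₀, hg⟩ | ⟨α₃, hα₃, hφα⟩
  -- m + 1 is listed separately because the hypotheses do not give m a sign.
  · refine ⟨max δ₃' (max (2 * m + 2) (m + 1)), L, min ε₀ (min ε₁ ε₂), hL,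
      lt_min hε₀ (lt_min hε₁ hε₂), fun ε hε x hx => ?_⟩
    have hx1 : δ₃' ≤ ‖x‖ := (le_max_left _ _).trans hx
    have hx2 : 2 * m + 1 < ‖x‖ := by
      linarith [(le_max_left (2 * m + 2) (m + 1)).trans ((le_max_right δ₃' _).trans hx)]
    have hx3 : m < ‖x‖ := by
      linarith [(le_max_right (2 * m + 2) (m + 1)).trans ((le_max_right δ₃' _).trans hx)]
    have hεa : ε ≤ ε₀ := (hε.2.trans_le (min_le_left _ _)).le
    have hεb : ε < ε₁ := hε.2.trans_le ((min_le_right _ _).trans (min_le_left _ _))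
    have hεc : ε < ε₂ := hε.2.trans_le ((min_le_right _ _).trans (min_le_right _ _))
    have hbar := fBar_congr (T := T) (f₁ := f₁) (f₂ := f₂) (δ₁ := δ₁) hm1 hm2 hx3
    refine ⟨hbar, fun τ hτ => ?_⟩
    obtain ⟨-, -, hy⟩ := hmain ε ⟨hε.1, hεb⟩
    obtain ⟨y, hinv, hN, hxy, hCε, -⟩ := hy x τ hτ
    rw [hbar, transformed_congr hm1 hm2 (far hxy hCε hx2) (hmain' ε ⟨hε.1, hεc⟩).1 hinv hN hτ]
    have h1 := hg x hx1 τ hτ ε ⟨hε.1, hεa⟩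
    rwa [gFun, norm_smul, norm_inv, Real.norm_of_nonneg hε.1.le, inv_mul_le_iff₀ hε.1] at h1
  · have ha : 0 < α₃ 1 := by
      rw [← hα₃.map_zero]
      exact hα₃.strictMonoOn self_mem_Ici (mem_Ici.2 zero_le_one) one_pos
    refine ⟨max 1 (max (2 * m + 2) (m + 1)), C * (2 + 2 * (α₃ 1)⁻¹), ε₁, by positivity, hε₁,
      fun ε hε x hx => ?_⟩
    have hx1 : 1 ≤ ‖x‖ := (le_max_left _ _).trans hx
    have hx2 : 2 * m + 1 < ‖x‖ := by
      linarith [(le_max_left (2 * m + 2) (m + 1)).trans ((le_max_right 1 _).trans hx)]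
    have hx3 : m < ‖x‖ := by
      linarith [(le_max_right (2 * m + 2) (m + 1)).trans ((le_max_right 1 _).trans hx)]
    refine ⟨fBar_congr hm1 hm2 hx3, fun τ hτ => ?_⟩
    obtain ⟨y, -, -, hxy, hCε, hest⟩ := (hmain ε hε).2.2 x τ hτ
    have hy : δ₂ ≤ ‖y‖ := hm1.trans (far hxy hCε hx2).le
    refine (hest hy).trans ?_
    have h1 : ‖y‖ ≤ ‖x - y‖ + ‖x‖ := by
      rw [norm_sub_rev]; simpa using norm_add_le (y - x) x
    have h2 := mul_le_mul_of_nonneg_right hCε (show 0 ≤ 1 + ‖y‖ by positivity)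
    have h3 : 1 + ‖y‖ ≤ 2 + 2 * ‖x‖ := by linarith
    -- For ‖x‖ ≥ 1 the value α₃(‖x‖) is at least α₃(1) > 0, so φ grows at least linearly and
    -- dominates the linear growth of the error.
    have h4 : ‖x‖ ≤ (α₃ 1)⁻¹ * φ x := by
      rw [inv_mul_eq_div, le_div_iff₀ ha, mul_comm]
      refine le_trans ?_ (hφα x)
      refine mul_le_mul_of_nonneg_right ?_ (norm_nonneg _)
      exact hα₃.strictMonoOn.monotoneOn (mem_Ici.2 zero_le_one) (norm_nonneg x) hx1
    have h5 : 0 ≤ φ x := by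
      have h6 : 0 < (α₃ 1)⁻¹ := inv_pos.2 ha
      have h7 : 0 ≤ (α₃ 1)⁻¹ * φ x := (norm_nonneg _).trans h4
      exact nonneg_of_mul_nonneg_right h7 h6
    have h8 : 2 + 2 * ‖x‖ ≤ (2 + 2 * (α₃ 1)⁻¹) * (φ x + 1) := by
      have : 0 < (α₃ 1)⁻¹ := inv_pos.2 ha
      nlinarith
    calc C * ε * (1 + ‖y‖) ≤ C * ε * ((2 + 2 * (α₃ 1)⁻¹) * (φ x + 1)) :=
          mul_le_mul_of_nonneg_left (h3.trans h8) (mul_nonneg hC.le hε.1.le)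
      _ = ε * (C * (2 + 2 * (α₃ 1)⁻¹) * (φ x + 1)) := by ring

end SecondOrderAveraging

/-! ### Conclusion: diffeomorphism and ultimate boundedness -/

theorem theorem1 (n : ℕ) (f₁ f₂ : Vec n → ℝ → Vec n) (T δ₁ : ℝ)
    (hreg : RegularityAssumption f₁ f₂ T δ₁)
    (hlyap : LyapunovAssumption f₁ f₂ T δ₁)
    (η δ₂ δ₃ : ℝ) (hδ : DeltaCondition η δ₁ δ₂ δ₃) :
    (∃ ε₀ : ℝ, 0 < ε₀ ∧ ∀ ε ∈ Set.Ioo 0 ε₀, IsC1Diffeo (nearId δ₁ δ₂ T f₁ f₂ ε)) ∧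
    ∃ Δ : ℝ, 0 < Δ ∧ IsUGUB Δ (transformed δ₁ δ₂ T f₁ f₂) := by
  obtain ⟨ε₁, _, hε₁, -, hmain⟩ := nearId_transformed hreg hδ.lt_or_eq
  refine ⟨⟨ε₁, hε₁, fun ε hε => (hmain ε hε).1⟩, ?_⟩
  obtain ⟨η', δ₂', δ₃', hδ', V, α₁, α₂, c₁, c₂, φ, hV, hα₁, hα₂, hc₁, hc₂, hφ, hVα, hVg, hVf,
    hgrowth⟩ := hlyap
  obtain ⟨R, L, ε₂, hL, hε₂, hbound⟩ := exists_perturbation_bound hreg hδ.lt_or_eq hδ'.lt_or_eq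
    hgrowth
  obtain ⟨α, hα, hαφ⟩ := hφ.lower
  -- Beyond R' both the perturbation bound and the Lyapunov inequality hold. Since R' ≥ 1, φ ≥ α(R')
  -- > 0 there, which gives the decay rate c₁α(R')²/2.
  set R' := max 1 (max R δ₃') with hR'
  have hR'0 : 0 < R' := lt_max_of_lt_left one_pos
  have ha : 0 < α R' := by
    rw [← hα.map_zero]
    exact hα.strictMonoOn self_mem_Ici hR'0.le hR'0
  set B := c₂ * L * (1 + (α R')⁻¹) with hB
  have hB0 : 0 < B := by positivity
  refine exists_isUGUB_of_lyapunov (ρ := c₁ / 2 * α R' ^ 2) (R := R')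
    (εs := min (min ε₁ ε₂) (c₁ / 2 / B)) hV hα₁ hα₂ hVα (by positivity) hR'0 (by positivity)
    (fun ε hε => (hmain ε ⟨hε.1, hε.2.trans_le ((min_le_left _ _).trans (min_le_left _ _))⟩).2.1)
    fun ε hε x hx τ hτ => ?_
  have hε2 : ε < ε₂ := hε.2.trans_le ((min_le_left _ _).trans (min_le_right _ _))
  have hεB : ε * B ≤ c₁ / 2 := (le_div_iff₀ hB0).1 (hε.2.trans_le (min_le_right _ _)).le
  have hxR : R ≤ ‖x‖ := (le_max_left R δ₃').trans ((le_max_right 1 _).trans hx)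
  have hxδ : δ₃' ≤ ‖x‖ := (le_max_right R δ₃').trans ((le_max_right 1 _).trans hx)
  obtain ⟨hbar, hest⟩ := hbound ε ⟨hε.1, hε2⟩ x hxR
  have hφa : α R' ≤ φ x :=
    (hα.strictMonoOn.monotoneOn hR'0.le (norm_nonneg x) hx).trans (hαφ x)
  refine inner_le_of_perturbation hc₁ hc₂ hL ha hφa hε.1 hεB (hVg x) ?_ (hest τ hτ)
  rw [hbar]
  exact hVf x hxδ
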